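/- **Proposition 5.8 (nets of standard subspaces from antiunitary representations; BGL construction).** Let $\mathcal H$ be a complex Hilbert space and let $\mathrm{AU}(\mathcal H)$ be the group of all complex-linear (unitary) and conjugate-linear (antiunitary) surjective isometries of $\mathcal H$. A *standard subspace* is a closed real subspace $V\subseteq\mathcal H$ with $V\cap iV=\{0\}$ and $V+iV$ dense in $\mathcal H$; put $V'=\{w\in\mathcal H:\operatorname{Im}\langle v,w\rangle=0\ \text{for all } v\in V\}$. The closed antilinear operator $S_V\colon V+iV\to\mathcal H$, $S_V(v+iw)=v-iw$, has the polar decomposition $S_V=J_V\Delta_V^{1/2}$ with $\Delta_V=S_V^*S_V$ and $J_V$ an antiunitary involution, and one writes $U^V\colon\mathbb R^\times\to\mathrm{AU}(\mathcal H)$ for the representation given by $U^V_{-1}=J_V$ and $U^V_{e^t}=\Delta_V^{-it/2\pi}$ $(t\in\mathbb R)$. Let $G$ be a finite-dimensional Lie group, $G_1\subseteq G$ a subgroup of index $2$, and $U\colon G\to\mathrm{AU}(\mathcal H)$ an antiunitary representation of $(G,G_1)$, i.e. a strongly continuous homomorphism such that $U_g$ is unitary for $g\in G_1$ and antiunitary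 for $g\notin G_1$. Let $\mathrm{Hom}((\mathbb R^\times,\mathbb R^\times_+),(G,G_1))$ be the set of continuous homomorphisms $\gamma\colon\mathbb R^\times\to G$ with $\gamma^{-1}(G_1)=\mathbb R^\times_+$, and write $\gamma^g(t)=g\gamma(t)g^{-1}$ and $\gamma^\vee(t)=\gamma(t^{-1})$. 1. For every $\gamma\in\mathrm{Hom}((\mathbb R^\times,\mathbb R^\times_+),(G,G_1))$ there is exactly one standard subspace $V_\gamma$ with $U^{V_\gamma}=U\circ\gamma$. Let $\Gamma\subseteq\mathrm{Hom}((\mathbb R^\times,\mathbb R^\times_+),(G,G_1))$ be a non-empty subset with $\gamma^g\in\Gamma$ and $\gamma^\vee\in\Gamma$ for all $\gamma\in\Gamma$, $g\in G$. Then the net $\mathcal V=(V_\gamma)_{\gamma\in\Gamma}$ has the following properties. 2. For every $\gamma\in\Gamma$, $U_gV_\gamma=V_{\gamma^g}$ if $g\in G_1$, and $U_gV_\gamma=V_{\gamma^g}'$ if $g\in G\setminus G_1$. 3. $\{\gamma(-1):\gamma\in\Gamma\}$ is a conjugation invariant set of involutions (elements of order $2$) contained in $G\setminus G_1$, and $J_{V_\gamma}=U_{\gamma(-1)}$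 for every $\gamma\in\Gamma$. 4. The modular symmetry group $\mathcal J$, i.e. the subgroup of $\mathrm{AU}(\mathcal H)$ generated by $\{J_{V_\gamma}:\gamma\in\Gamma\}$, is the image under $U$ of the subgroup of $G$ generated by $\{\gamma(-1):\gamma\in\Gamma\}$. 5. (CGMA) $\mathcal J\subseteq\mathrm{Aut}(\mathcal V)$: every $\alpha\in\mathcal J$ permutes the net, i.e. there is a permutation $\sigma$ of $\Gamma$ with $\alpha V_\gamma=V_{\sigma(\gamma)}$ for all $\gamma\in\Gamma$. -/

import Mathlib

open scoped ComplexConjugate ContDiff Manifold ComplexInnerProductSpace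

noncomputable section

section AntiunitaryGroup

variable (H : Type*) [NormedAddCommGroup H] [InnerProductSpace ℂ H]

/-- A surjective real-linear isometry is unitary if it commutes with complex scalars. -/
def IsUnitaryIsometry {H : Type*} [NormedAddCommGroup H] [InnerProductSpace ℂ H]
    (f : H ≃ₗᵢ[ℝ] H) : Prop :=
  ∀ (c : ℂ) (x : H), f (c • x) = c • f x

/-- A surjective real-linear isometry is antiunitary if it is conjugate-linear. -/
def IsAntiunitaryIsometry {H : Type*} [NormedAddCommGroup H] [InnerProductSpace ℂ H]
    (f : H ≃ₗᵢ[ℝ] H) : Prop :=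
  ∀ (c : ℂ) (x : H), f (c • x) = conj c • f x

/-- The antiunitary group `AU(H)`: all complex-linear and all conjugate-linear surjective isometries
of `H`, as a subgroup of the group of surjective real-linear isometries. -/
def AU : Subgroup (H ≃ₗᵢ[ℝ] H) where
  carrier := {f | IsUnitaryIsometry f ∨ IsAntiunitaryIsometry f}
  one_mem' := Or.inl fun _ _ => rfl
  mul_mem' := by
    rintro f g (hf | hf) (hg | hg)
    · exact Or.inl fun c x => by
        simp only [LinearIsometryEquiv.coe_mul, Function.comp_apply, hg c x, hf c]
    · exact Or.inr fun c x => by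
        simp only [LinearIsometryEquiv.coe_mul, Function.comp_apply, hg c x, hf (conj c)]
    · exact Or.inr fun c x => by
        simp only [LinearIsometryEquiv.coe_mul, Function.comp_apply, hg c x, hf c]
    · exact Or.inl fun c x => by
        simp only [LinearIsometryEquiv.coe_mul, Function.comp_apply, hg c x, hf (conj c),
          Complex.conj_conj]
  inv_mem' := by
    rintro f (hf | hf)
    · refine Or.inl fun c x => f.injective ?_
      rw [hf]
      change f (f.symm _) = c • f (f.symm _)
      simp
    · refine Or.inr fun c x => f.injective ?_
      rw [hf]
      change f (f.symm _) = conj (conj c) • f (f.symm _)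
      simp

end AntiunitaryGroup

namespace StandardSubspace

variable {H : Type*} [NormedAddCommGroup H] [InnerProductSpace ℂ H]

open ClosedSubmodule in
theorem mapEquiv_mulI (f : AU H) (S : ClosedSubmodule ℝ H) :
    (S.mapEquiv f.1.toContinuousLinearEquiv).mulI =
      S.mulI.mapEquiv f.1.toContinuousLinearEquiv := by
  have hf := (AU H).inv_mem f.2
  have hx : ∀ x : H, f.1.toContinuousLinearEquiv.symm x = (f.1⁻¹ : H ≃ₗᵢ[ℝ] H) x := fun _ => rfl
  apply SetLike.ext
  intro x
  simp only [mem_mapEquiv_iff, scalarSMulCLE_symm_apply, Units.smul_def, hx]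
  rcases hf with hf | hf
  · rw [hf]
  · rw [hf]
    have h2 : conj ((Complex.UnitI⁻¹ : ℂˣ) : ℂ) = -((Complex.UnitI⁻¹ : ℂˣ) : ℂ) := by
      simp
    rw [h2, neg_smul]
    exact neg_mem_iff (S := Submodule ℝ H) (H := S.toSubmodule)

/-- The natural action of `AU(H)` on standard subspaces: `f • V` is the image `f(V)`. -/
instance : MulAction (AU H) (StandardSubspace H) where
  smul f V :=
    { toClosedSubmodule := V.toClosedSubmodule.mapEquiv f.1.toContinuousLinearEquiv
      IsSeparating := by
        rw [mapEquiv_mulI, ← ClosedSubmodule.mapEquiv_inf_eq, V.IsSeparating,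
          ClosedSubmodule.mapEquiv_bot_eq_bot]
      IsCyclic := by
        rw [mapEquiv_mulI, ← ClosedSubmodule.mapEquiv_sup_eq, V.IsCyclic,
          ClosedSubmodule.mapEquiv_top_eq_top] }
  one_smul V := by
    apply StandardSubspace.ext
    apply SetLike.ext
    intro x
    change x ∈ V.toClosedSubmodule.mapEquiv _ ↔ _
    rw [ClosedSubmodule.mem_mapEquiv_iff]
    exact Iff.rfl
  mul_smul f g V := by
    apply StandardSubspace.ext
    apply SetLike.ext
    intro x
    change x ∈ V.toClosedSubmodule.mapEquiv _ ↔
      x ∈ (V.toClosedSubmodule.mapEquiv _).mapEquiv _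
    simp only [ClosedSubmodule.mem_mapEquiv_iff]
    exact Iff.rfl

theorem coe_smul (f : AU H) (V : StandardSubspace H) :
    ((f • V).toClosedSubmodule : Set H) = f.1 '' (V.toClosedSubmodule : Set H) := by
  ext x
  change x ∈ V.toClosedSubmodule.mapEquiv f.1.toContinuousLinearEquiv ↔ _
  rw [ClosedSubmodule.mem_mapEquiv_iff]
  constructor
  · intro hx
    exact ⟨f.1.symm x, hx, f.1.apply_symm_apply x⟩
  · rintro ⟨y, hy, rfl⟩
    have : f.1.toContinuousLinearEquiv.symm (f.1 y) = y := f.1.symm_apply_apply y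
    rw [this]
    exact hy

theorem smul_decomp (c : ℂ) (v w : H) :
    c • (v + Complex.I • w) = (c.re • v - c.im • w) + Complex.I • (c.re • w + c.im • v) := by
  simp only [← Complex.coe_smul]
  conv_lhs => rw [← Complex.re_add_im c]
  match_scalars
  · ring
  · linear_combination (c.im : ℂ) * Complex.I_mul_I

theorem conj_smul_decomp (c : ℂ) (v w : H) :
    (c.re • v - c.im • w) - Complex.I • (c.re • w + c.im • v) =
      conj c • (v - Complex.I • w) := by
  have h : conj c = c.re - c.im * Complex.I := by
    apply Complex.ext <;> simp
  rw [h]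
  simp only [← Complex.coe_smul]
  match_scalars
  · ring
  · linear_combination (-(c.im : ℂ)) * Complex.I_mul_I

theorem decomp_unique (V : StandardSubspace H) {v w v' w' : H}
    (hv : v ∈ V.toClosedSubmodule) (hw : w ∈ V.toClosedSubmodule)
    (hv' : v' ∈ V.toClosedSubmodule) (hw' : w' ∈ V.toClosedSubmodule)
    (h : v + Complex.I • w = v' + Complex.I • w') : v = v' ∧ w = w' := by
  have h1 : v - v' = Complex.I • (w' - w) := by
    rw [smul_sub, sub_eq_sub_iff_add_eq_add, h, add_comm]
  have h2 : v - v' ∈ V.toClosedSubmodule ⊓ V.toClosedSubmodule.mulI := by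
    refine ⟨V.toClosedSubmodule.toSubmodule.sub_mem hv hv', ?_⟩
    change v - v' ∈ V.toClosedSubmodule.mulI
    rw [h1, ClosedSubmodule.mem_mapEquiv_iff, scalarSMulCLE_symm_apply, Units.smul_def, smul_smul]
    simpa using! V.toClosedSubmodule.toSubmodule.sub_mem hw' hw
  rw [V.IsSeparating, ClosedSubmodule.mem_bot] at h2
  refine ⟨sub_eq_zero.1 h2, ?_⟩
  rw [h2] at h1
  have h3 := (smul_eq_zero.1 h1.symm).resolve_left Complex.I_ne_zero
  exact (sub_eq_zero.1 h3).symm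

/-- The complex subspace `V + iV` (algebraic sum). -/
def complexSpan (V : StandardSubspace H) : Submodule ℂ H where
  carrier := {x | ∃ p : H × H, p.1 ∈ V.toClosedSubmodule ∧ p.2 ∈ V.toClosedSubmodule ∧
    x = p.1 + Complex.I • p.2}
  zero_mem' := ⟨0, V.toClosedSubmodule.toSubmodule.zero_mem,
    V.toClosedSubmodule.toSubmodule.zero_mem, by simp⟩
  add_mem' := by
    rintro _ _ ⟨p, hv, hw, rfl⟩ ⟨q, hv', hw', rfl⟩
    exact ⟨p + q, add_mem hv hv', add_mem hw hw', by
      rw [Prod.fst_add, Prod.snd_add, smul_add]; abel⟩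
  smul_mem' := by
    rintro c _ ⟨p, hv, hw, rfl⟩
    refine ⟨(c.re • p.1 - c.im • p.2, c.re • p.2 + c.im • p.1),
      V.toClosedSubmodule.toSubmodule.sub_mem (Submodule.smul_mem _ _ hv)
        (Submodule.smul_mem _ _ hw),
      V.toClosedSubmodule.toSubmodule.add_mem (Submodule.smul_mem _ _ hw)
        (Submodule.smul_mem _ _ hv), smul_decomp c p.1 p.2⟩

theorem exists_decomp (V : StandardSubspace H) (x : V.complexSpan) : ∃ p : H × H,
    p.1 ∈ V.toClosedSubmodule ∧ p.2 ∈ V.toClosedSubmodule ∧ (x : H) = p.1 + Complex.I • p.2 :=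
  x.2

/-- The components `(v, w)` of an element `v + i w` of `V + iV`. -/
def decomp (V : StandardSubspace H) (x : V.complexSpan) : H × H :=
  (V.exists_decomp x).choose

theorem decomp_spec (V : StandardSubspace H) (x : V.complexSpan) :
    (V.decomp x).1 ∈ V.toClosedSubmodule ∧ (V.decomp x).2 ∈ V.toClosedSubmodule ∧
      (x : H) = (V.decomp x).1 + Complex.I • (V.decomp x).2 :=
  (V.exists_decomp x).choose_spec

theorem decomp_eq (V : StandardSubspace H) (x : V.complexSpan) {v w : H}
    (hv : v ∈ V.toClosedSubmodule) (hw : w ∈ V.toClosedSubmodule)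
    (h : (x : H) = v + Complex.I • w) : V.decomp x = (v, w) := by
  have hx := V.decomp_spec x
  have h' := V.decomp_unique hx.1 hx.2.1 hv hw (hx.2.2.symm.trans h)
  exact Prod.ext h'.1 h'.2

/-- The Tomita operator `S : V + iV → H`, `S (v + i w) = v - i w`, an unbounded antilinear
operator. -/
def tomita (V : StandardSubspace H) : H →ₛₗ.[starRingEnd ℂ] H where
  domain := V.complexSpan
  toFun :=
    { toFun := fun x => (V.decomp x).1 - Complex.I • (V.decomp x).2
      map_add' := by
        intro x y
        have hx := V.decomp_spec x
        have hy := V.decomp_spec y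
        rw [V.decomp_eq (x + y) (V.toClosedSubmodule.toSubmodule.add_mem hx.1 hy.1)
          (V.toClosedSubmodule.toSubmodule.add_mem hx.2.1 hy.2.1) (by
            rw [Submodule.coe_add, smul_add, add_add_add_comm, ← hx.2.2, ← hy.2.2])]
        simp only [smul_add]
        abel
      map_smul' := by
        intro c x
        have hx := V.decomp_spec x
        rw [V.decomp_eq (c • x)
          (V.toClosedSubmodule.toSubmodule.sub_mem (Submodule.smul_mem _ c.re hx.1)
            (Submodule.smul_mem _ c.im hx.2.1))
          (V.toClosedSubmodule.toSubmodule.add_mem (Submodule.smul_mem _ c.re hx.2.1)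
            (Submodule.smul_mem _ c.im hx.1)) (by
            rw [← smul_decomp, ← hx.2.2, Submodule.coe_smul])]
        exact conj_smul_decomp c _ _ }

theorem tomita_apply (V : StandardSubspace H) {v w : H} (hv : v ∈ V.toClosedSubmodule)
    (hw : w ∈ V.toClosedSubmodule) (h : v + Complex.I • w ∈ V.tomita.domain) :
    V.tomita ⟨v + Complex.I • w, h⟩ = v - Complex.I • w := by
  change (V.decomp ⟨v + Complex.I • w, h⟩).1 - Complex.I • (V.decomp ⟨v + Complex.I • w, h⟩).2 = _
  rw [V.decomp_eq _ hv hw rfl]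

/-- The graph of `S* S`, where `S*` is the adjoint of the antilinear operator `S`: `S* y = z` iff
`⟪S a, y⟫ = ⟪z, a⟫` for all `a` in the domain of `S`. So `(x, z)` belongs to it iff `x` is in the
domain of `S` and `S* (S x) = z`. -/
def modularGraph (V : StandardSubspace H) : Submodule ℂ (H × H) where
  carrier := {p : H × H | ∃ hx : p.1 ∈ V.tomita.domain,
    ∀ a : V.tomita.domain, ⟪V.tomita a, V.tomita ⟨p.1, hx⟩⟫ = ⟪p.2, (a : H)⟫}
  zero_mem' := ⟨zero_mem _, fun a => by
    have : V.tomita ⟨0, zero_mem _⟩ = 0 := V.tomita.toFun.map_zero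
    simp [this]⟩
  add_mem' := by
    rintro p q ⟨hp, hp'⟩ ⟨hq, hq'⟩
    refine ⟨add_mem hp hq, fun a => ?_⟩
    have : V.tomita ⟨(p + q).1, add_mem hp hq⟩ = V.tomita ⟨p.1, hp⟩ + V.tomita ⟨q.1, hq⟩ :=
      V.tomita.toFun.map_add ⟨p.1, hp⟩ ⟨q.1, hq⟩
    rw [this, inner_add_right, hp', hq', Prod.snd_add, inner_add_left]
  smul_mem' := by
    rintro c p ⟨hp, hp'⟩
    refine ⟨Submodule.smul_mem _ c hp, fun a => ?_⟩
    have : V.tomita ⟨(c • p).1, Submodule.smul_mem _ c hp⟩ = conj c • V.tomita ⟨p.1, hp⟩ :=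
      V.tomita.toFun.map_smulₛₗ c ⟨p.1, hp⟩
    rw [this, inner_smul_right, hp', Prod.smul_snd, inner_smul_left]

theorem modularGraph_functional (V : StandardSubspace H) (p : H × H) (hp : p ∈ V.modularGraph)
    (h0 : p.1 = 0) : p.2 = 0 := by
  obtain ⟨x, z⟩ := p
  obtain rfl : x = 0 := h0
  obtain ⟨hx, h⟩ := hp
  have h1 : ∀ a ∈ V.complexSpan, ⟪z, a⟫ = 0 := fun a ha => by
    have h2 : V.tomita ⟨0, hx⟩ = 0 := V.tomita.toFun.map_zero
    have h3 := h ⟨a, ha⟩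
    rw [h2, inner_zero_right] at h3
    exact h3.symm
  let K : ClosedSubmodule ℝ H :=
    { toSubmodule := (LinearMap.ker (innerSL ℂ z).toLinearMap).restrictScalars ℝ
      isClosed' := (innerSL ℂ z).isClosed_ker }
  have hK : ∀ a, a ∈ K ↔ ⟪z, a⟫ = 0 := fun a => Iff.rfl
  have h4 : V.toClosedSubmodule ⊔ V.toClosedSubmodule.mulI ≤ K := by
    refine sup_le (fun a ha => ?_) (fun a ha => ?_)
    · exact (hK a).2 (h1 a ⟨(a, 0), ha, V.toClosedSubmodule.toSubmodule.zero_mem, by simp⟩)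
    · have ha' : a ∈ V.toClosedSubmodule.mulI := ha
      rw [ClosedSubmodule.mem_mapEquiv_iff, scalarSMulCLE_symm_apply, Units.smul_def] at ha'
      refine (hK a).2 (h1 a ⟨(0, _), V.toClosedSubmodule.toSubmodule.zero_mem, ha', ?_⟩)
      simp [smul_smul]
  rw [V.IsCyclic] at h4
  exact inner_self_eq_zero.1 ((hK z).1 (h4 (ClosedSubmodule.mem_top)))

/-- The modular operator `Δ_V = S* S` of a standard subspace. -/
def modularOperator (V : StandardSubspace H) : H →ₗ.[ℂ] H :=
  V.modularGraph.toLinearPMap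

theorem graph_modularOperator (V : StandardSubspace H) :
    V.modularOperator.graph = V.modularGraph :=
  Submodule.toLinearPMap_graph_eq _ V.modularGraph_functional

end StandardSubspace

/-- A spectral measure (projection-valued measure) on the Borel sets of `ℝ`, acting on `H`;
countable additivity is in the strong operator topology. -/
structure SpectralMeasure (H : Type*) [NormedAddCommGroup H] [InnerProductSpace ℂ H]
    [CompleteSpace H] where
  /-- The projection of a Borel set. -/
  proj : Set ℝ → H →L[ℂ] H
  isStarProjection : ∀ B, MeasurableSet B → IsStarProjection (proj B)
  empty : proj ∅ = 0
  univ : proj Set.univ = 1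
  inter : ∀ A B, MeasurableSet A → MeasurableSet B → proj (A ∩ B) = proj A * proj B
  iUnion : ∀ A : ℕ → Set ℝ, (∀ n, MeasurableSet (A n)) → Pairwise (Function.onFun Disjoint A) →
    ∀ x : H, HasSum (fun n => proj (A n) x) (proj (⋃ n, A n) x)

namespace SpectralMeasure

variable {H : Type*} [NormedAddCommGroup H] [InnerProductSpace ℂ H] [CompleteSpace H]

theorem re_inner_nonneg (P : SpectralMeasure H) (x : H) {B : Set ℝ} (hB : MeasurableSet B) :
    0 ≤ (⟪x, P.proj B x⟫).re := by
  have h := P.isStarProjection B hB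
  have h1 : P.proj B x = P.proj B (P.proj B x) := by
    conv_lhs => rw [← h.isIdempotentElem.eq]
    rfl
  have h2 : ⟪x, P.proj B x⟫ = ⟪P.proj B x, P.proj B x⟫ := by
    conv_lhs => rw [h1]
    rw [← ContinuousLinearMap.adjoint_inner_left, ← ContinuousLinearMap.star_eq_adjoint,
      h.isSelfAdjoint.star_eq]
  rw [h2]
  exact inner_self_nonneg (𝕜 := ℂ)

/-- The finite measure `μ_x(B) = ⟪x, P(B) x⟫`. -/
def vectorMeasure (P : SpectralMeasure H) (x : H) : MeasureTheory.Measure ℝ :=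
  MeasureTheory.Measure.ofMeasurable (fun B _ => ENNReal.ofReal (⟪x, P.proj B x⟫).re)
    (by simp [P.empty])
    (by
      intro A hA hd
      have h := P.iUnion A hA hd x
      have h' : HasSum (fun n => (⟪x, P.proj (A n) x⟫).re) (⟪x, P.proj (⋃ n, A n) x⟫).re :=
        Complex.hasSum_re (h.mapL (innerSL ℂ x))
      rw [← h'.tsum_eq]
      exact ENNReal.ofReal_tsum_of_nonneg (fun n => P.re_inner_nonneg x (hA n)) h'.summable)

theorem vectorMeasure_apply (P : SpectralMeasure H) (x : H) {B : Set ℝ} (hB : MeasurableSet B) :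
    P.vectorMeasure x B = ENNReal.ofReal (⟪x, P.proj B x⟫).re :=
  MeasureTheory.Measure.ofMeasurable_apply B hB

/-- `T = ∫ f dP` for a (possibly unbounded) operator `T`: its domain consists of the `x` with
`∫ |f|² dμ_x < ∞`, and `⟪x, T x⟫ = ∫ f dμ_x` on it (which fixes `T` by polarization). -/
def IsIntegral (P : SpectralMeasure H) (f : ℝ → ℂ) (T : H →ₗ.[ℂ] H) : Prop :=
  (∀ x : H, x ∈ T.domain ↔ ∫⁻ s, ‖f s‖ₑ ^ 2 ∂(P.vectorMeasure x) < ⊤) ∧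
    ∀ x : T.domain, ⟪(x : H), T x⟫ = ∫ s, f s ∂(P.vectorMeasure x)

end SpectralMeasure

namespace StandardSubspace

variable {H : Type*} [NormedAddCommGroup H] [InnerProductSpace ℂ H] [CompleteSpace H]

/-- `P` is the spectral measure of the modular operator: `Δ_V = ∫ s dP(s)`. -/
def IsModularSpectralMeasure (V : StandardSubspace H) (P : SpectralMeasure H) : Prop :=
  P.IsIntegral (fun s => (s : ℂ)) V.modularOperator

/-- `J` is the modular conjugation `J_V`: it is antiunitary and `S = J Δ_V^{1/2}` (polar
decomposition, with equality of domains). -/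
def IsModularConjugation (V : StandardSubspace H) (J : AU H) : Prop :=
  IsAntiunitaryIsometry J.1 ∧
    ∃ (P : SpectralMeasure H) (T : H →ₗ.[ℂ] H), V.IsModularSpectralMeasure P ∧
      P.IsIntegral (fun s => (Real.sqrt s : ℂ)) T ∧ V.tomita.domain = T.domain ∧
      ∀ (x : V.tomita.domain) (y : T.domain), (x : H) = y → V.tomita x = J.1 (T y)

/-- `u = U^V` is the representation of `ℝˣ` attached to the standard subspace `V`:
`u(-1) = J_V`, and `u(e^t)` is the unitary operator `Δ_V^{-it/2π}` for all real `t`. -/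
def IsModularRep (V : StandardSubspace H) (u : ℝˣ →* AU H) : Prop :=
  V.IsModularConjugation (u (-1)) ∧
    ∃ P : SpectralMeasure H, V.IsModularSpectralMeasure P ∧
      ∀ t : ℝ, IsUnitaryIsometry (u (Units.mk0 (Real.exp t) (Real.exp_ne_zero t))).1 ∧
        ∀ x : H, ⟪x, (u (Units.mk0 (Real.exp t) (Real.exp_ne_zero t))).1 x⟫ =
          ∫ s, (s : ℂ) ^ (-(Complex.I * t) / (2 * Real.pi)) ∂(P.vectorMeasure x)

end StandardSubspace

/-- A (strongly continuous) antiunitary representation of the pair `(G, G₁)`: elements of `G₁` act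
by unitary, elements outside `G₁` by antiunitary operators. -/
structure AntiunitaryRep {G : Type*} [Group G] [TopologicalSpace G] (G₁ : Subgroup G)
    (H : Type*) [NormedAddCommGroup H] [InnerProductSpace ℂ H] where
  /-- The underlying homomorphism. -/
  toHom : G →* AU H
  unitary : ∀ g ∈ G₁, IsUnitaryIsometry (toHom g).1
  antiunitary : ∀ g ∉ G₁, IsAntiunitaryIsometry (toHom g).1
  continuous : ∀ x : H, Continuous fun g => (toHom g).1 x

/-- `γ` is a morphism of topological group pairs `(ℝˣ, ℝˣ₊) → (G, G₁)`: it is continuous, and it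
maps `t` into `G₁` exactly if `t > 0`. -/
def IsPairHom {G : Type*} [Group G] [TopologicalSpace G] (G₁ : Subgroup G) (γ : ℝˣ →* G) : Prop :=
  Continuous γ ∧ ∀ t : ℝˣ, γ t ∈ G₁ ↔ 0 < (t : ℝ)

/-- `γ^g(t) = g γ(t) g⁻¹`. -/
def conjHom {G : Type*} [Group G] (g : G) (γ : ℝˣ →* G) : ℝˣ →* G :=
  (MulAut.conj g).toMonoidHom.comp γ

/-- `γ^∨(t) = γ(t⁻¹)`. -/
def invHom {G : Type*} [Group G] (γ : ℝˣ →* G) : ℝˣ →* G :=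
  γ.comp invMonoidHom

section Nets

variable {H : Type*} [NormedAddCommGroup H] [InnerProductSpace ℂ H]

/-- The group `Aut(𝒱)` of automorphisms of a net `(V_ℓ)` of standard subspaces: those elements
of `AU(H)` that permute the `V_ℓ`. -/
def netAut {L : Type*} (V : L → StandardSubspace H) : Subgroup (AU H) where
  carrier := {f | ∃ σ : Equiv.Perm L, ∀ l, f • V l = V (σ l)}
  one_mem' := ⟨1, fun l => one_smul _ _⟩
  mul_mem' := by
    rintro f g ⟨σ, hσ⟩ ⟨τ, hτ⟩
    exact ⟨σ * τ, fun l => by rw [mul_smul, hτ, hσ]; rfl⟩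
  inv_mem' := by
    rintro f ⟨σ, hσ⟩
    exact ⟨σ⁻¹, fun l => by rw [inv_smul_eq_iff, hσ]; simp⟩

/-- The modular symmetry group of a net: the subgroup of `AU(H)` generated by the modular
conjugations of its members. -/
def modularSymmetryGroup [CompleteSpace H] {L : Type*} (V : L → StandardSubspace H) :
    Subgroup (AU H) :=
  Subgroup.closure {J | ∃ l, (V l).IsModularConjugation J}

/-- The condition of geometric modular action. -/
def CGMA [CompleteSpace H] {L : Type*} (V : L → StandardSubspace H) : Prop :=
  modularSymmetryGroup V ≤ netAut V

end Nets

end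

/-! A standard subspace is the fixed space of its Tomita operator `S = J Δ^{1/2}`, so it amounts to
a pair of a strictly positive operator `Δ` and an antiunitary involution `J` with `J Δ J = Δ⁻¹`.
Such pairs are the same as antiunitary representations `u` of `ℝˣ`. Given `u`, Stone's theorem
produces `Δ` with `u(e^t) = Δ^{-it/2π}` (`IsGenerator.exists_isGenerator`). As `ℝˣ` is abelian, `J =
u(-1)` commutes with every `Δ^{it}`, and being antilinear it must invert `Δ`
(`IsGenerator.isModularPair`). Then `J Δ^{1/2}` is a closed antilinear involution, its fixed space
is standard (`IsModularPair.exists_isFixedSpace`), and the modular objects of that space are `Δ` and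
`J` again. All of this is condensed in `StandardSubspace.isModularRep_iff`, which also yields
uniqueness.

The statements on nets follow from uniqueness and three facts: a unitary `f` carries the space of
`u` to the space of `f u f⁻¹` (`IsModularRep.smul`); `V' = J V` (`IsModularRep.symplComp_eq`); and
`V'` belongs to `u^∨` (`IsModularRep.symplComp`). For `g ∉ G₁` the element `g γ(-1)` lies in `G₁`
and conjugates `γ` to `γ^g`, which reduces the antiunitary case to the unitary one. A modular
conjugation, with `r = γ(-1)`, then sends `V_δ` to `V_{δ^r}'`, the member of the net with index
`(δ^r)^∨`.

The analytic groundwork is the spectral theory of unbounded operators. A `SpectralFrame` models the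
orbit of each vector `x` in `L²(μ_x)`. It is used with indicator functions, to build the functional
calculus of a spectral measure, and with characters, to build the spectral measure in Stone's
theorem, where Bochner's theorem supplies the measures `μ_x`. -/

noncomputable section

/-! ### Bochner's theorem for stationary curves in a Hilbert space -/

section Bochner

open MeasureTheory Filter Topology FourierTransform

/-- Gaussian means of `𝓕 f` converge to `f 0` by continuity at the origin. For a nonnegative
transform these means dominate, up to a constant, the integral over a bounded interval, so those
integrals stay bounded. -/
theorem integrable_fourier_of_nonneg {f : ℝ → ℂ} (hf : Integrable f) (hc : ContinuousAt f 0)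
    (hpos : ∀ s, 𝓕 f s = (‖𝓕 f s‖ : ℂ)) : Integrable (𝓕 f) := by
  have hcont : Continuous (𝓕 f) :=
    VectorFourier.fourierIntegral_continuous Real.continuous_fourierChar
      (by exact continuous_inner) hf
  have key : ∀ c : ℝ, 0 < c → (∫ s : ℝ, Complex.exp (-c⁻¹ * ‖s‖ ^ 2) • 𝓕 f s) =
      ∫ w : ℝ, ((Real.pi * c : ℂ) ^ (Module.finrank ℝ ℝ / 2 : ℂ) *
        Complex.exp (-Real.pi ^ 2 * c * ‖(0 : ℝ) - w‖ ^ 2)) • f w := by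
    intro c hc
    have J : Integrable (fun w : ℝ => Complex.exp (-c⁻¹ * ‖w‖ ^ 2 +
        2 * Real.pi * Complex.I * inner ℝ (0 : ℝ) w)) :=
      GaussianFourier.integrable_cexp_neg_mul_sq_norm_add (by simpa) _ _
    have h := VectorFourier.integral_fourierIntegral_smul_eq_flip (L := innerₗ ℝ)
      Real.continuous_fourierChar continuous_inner J hf
    have h2 : ∀ w : ℝ, 𝓕 (fun w : ℝ => Complex.exp (-c⁻¹ * ‖w‖ ^ 2 +
        2 * Real.pi * Complex.I * inner ℝ (0 : ℝ) w)) w =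
        ((Real.pi * c : ℂ) ^ (Module.finrank ℝ ℝ / 2 : ℂ) *
        Complex.exp (-Real.pi ^ 2 * c * ‖(0 : ℝ) - w‖ ^ 2)) := by
      intro w
      have := fourier_gaussian_innerProductSpace' (V := ℝ) (b := ((c⁻¹ : ℝ) : ℂ)) (by simpa) 0 w
      rw [this]
      congr
      · simp
      · simp; ring
    have h' : (∫ w : ℝ, 𝓕 (fun w : ℝ => Complex.exp (-c⁻¹ * ‖w‖ ^ 2 +
        2 * Real.pi * Complex.I * inner ℝ (0 : ℝ) w)) w • f w) =
        ∫ s : ℝ, Complex.exp (-c⁻¹ * ‖s‖ ^ 2 +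
        2 * Real.pi * Complex.I * inner ℝ (0 : ℝ) s) • 𝓕 f s := by
      simpa using! h
    simp only [h2] at h'
    rw [h']
    simp
  have hlim := (Real.tendsto_integral_gaussian_smul' hf hc).congr'
    (by filter_upwards [Ioi_mem_atTop 0] with c hc using (key c hc).symm)
  have hbd : ∀ᶠ c : ℝ in atTop, ‖∫ s : ℝ, Complex.exp (-c⁻¹ * ‖s‖ ^ 2) • 𝓕 f s‖ ≤ ‖f 0‖ + 1 := by
    have := hlim.norm.eventually (gt_mem_nhds (lt_add_one ‖f 0‖))
    filter_upwards [this] with c hc using hc.le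
  -- The Gaussian parameter is taken to be `R ^ 2`: on `[-R, R]` the weight is then at least `exp
  -- (-1)`, whence the constant `Real.exp 1`.
  have hsq : Tendsto (fun R : ℝ => R ^ 2) atTop atTop := tendsto_pow_atTop two_ne_zero
  refine integrable_of_intervalIntegral_norm_bounded (a := fun R : ℝ => -R) (b := fun R => R)
    (l := atTop) (Real.exp 1 * (‖f 0‖ + 1))
    (fun R => (hcont.integrableOn_Icc).mono_set Set.Ioc_subset_Icc_self)
    tendsto_neg_atTop_atBot tendsto_id ?_
  filter_upwards [hsq.eventually hbd, eventually_gt_atTop 0] with R hR hR0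
  have hint : Integrable (fun s : ℝ => Real.exp (-(R ^ 2)⁻¹ * s ^ 2) * ‖𝓕 f s‖) := by
    have hg : Integrable (fun s : ℝ => Real.exp (-(R ^ 2)⁻¹ * s ^ 2)) :=
      integrable_exp_neg_mul_sq (by positivity)
    refine hg.mul_bdd (c := ∫ v, ‖f v‖) hcont.norm.aestronglyMeasurable ?_
    filter_upwards with s
    rw [norm_norm]
    exact VectorFourier.norm_fourierIntegral_le_integral_norm _ _ _ _ _
  have heq : (∫ s : ℝ, Complex.exp (-(((R ^ 2)⁻¹ : ℝ) : ℂ) * ‖s‖ ^ 2) • 𝓕 f s) =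
      ((∫ s : ℝ, Real.exp (-(R ^ 2)⁻¹ * s ^ 2) * ‖𝓕 f s‖ : ℝ) : ℂ) := by
    rw [← integral_complex_ofReal]
    refine integral_congr_ae (ae_of_all _ fun s => ?_)
    show _ • 𝓕 f s = _
    rw [hpos s]
    have : ((‖s‖ : ℝ) : ℂ) ^ 2 = ((s ^ 2 : ℝ) : ℂ) := by
      rw [← Complex.ofReal_pow, Real.norm_eq_abs, sq_abs]
    rw [this]
    push_cast
    simp
  rw [heq, Complex.norm_real, Real.norm_eq_abs] at hR
  have hR' := (le_abs_self _).trans hR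
  rw [intervalIntegral.integral_of_le (by linarith)]
  calc ∫ s in Set.Ioc (-R) R, ‖𝓕 f s‖
      ≤ ∫ s in Set.Ioc (-R) R, Real.exp 1 * (Real.exp (-(R ^ 2)⁻¹ * s ^ 2) * ‖𝓕 f s‖) := by
        refine setIntegral_mono_on ?_ (hint.const_mul _).integrableOn measurableSet_Ioc ?_
        · exact (hcont.norm.integrableOn_Icc).mono_set Set.Ioc_subset_Icc_self
        · intro s hs
          rw [← mul_assoc, ← Real.exp_add]
          refine le_mul_of_one_le_left (norm_nonneg _) (Real.one_le_exp ?_)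
          have h1 : s ^ 2 ≤ R ^ 2 := by
            exact sq_le_sq' hs.1.le hs.2
          have h2 : (R ^ 2)⁻¹ * s ^ 2 ≤ (R ^ 2)⁻¹ * R ^ 2 := by gcongr
          rw [inv_mul_cancel₀ (by positivity)] at h2
          linarith
    _ ≤ ∫ s, Real.exp 1 * (Real.exp (-(R ^ 2)⁻¹ * s ^ 2) * ‖𝓕 f s‖) :=
        setIntegral_le_integral (hint.const_mul _) (ae_of_all _ fun s => by positivity)
    _ ≤ Real.exp 1 * (‖f 0‖ + 1) := by
        rw [integral_const_mul]
        gcongr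

variable {H : Type*} [NormedAddCommGroup H] [InnerProductSpace ℂ H] [CompleteSpace H]

/-- Up to a positive constant the transform at `s` is `‖∫ K‖²`, where `K` is the curve `G` twisted
by a character and damped by a Gaussian. The damping `exp (-2εt²)` is chosen because `2r² + 2(r+τ)²
= 4(r+τ/2)² + τ²`: integrating out `r` leaves exactly `exp (-ετ²)`. -/
theorem fourier_gaussian_mul_nonneg {G : ℝ → H} (hG : Continuous G) {M : ℝ}
    (hM : ∀ t, ‖G t‖ ≤ M) {φ : ℝ → ℂ} (hφ : ∀ r t, ⟪G r, G t⟫ = φ (t - r)) {ε : ℝ} (hε : 0 < ε)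
    (s : ℝ) : 𝓕 (fun t => (Real.exp (-ε * t ^ 2) : ℂ) * φ t) s =
      (‖𝓕 (fun t => (Real.exp (-ε * t ^ 2) : ℂ) * φ t) s‖ : ℂ) := by
  set e : ℝ → ℂ := fun t => (Real.fourierChar (-(t * s)) : ℂ) with he
  have he1 : ∀ t, ‖e t‖ = 1 := fun t => Circle.norm_coe _
  have hec : Continuous e := by fun_prop
  have hmul : ∀ r t, conj (e r) * e t = e (t - r) := by
    intro r t
    simp only [he, ← Circle.coe_inv_eq_conj, ← Circle.coe_mul, ← AddChar.map_neg_eq_inv,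
      ← AddChar.map_add_eq_mul]
    congr 2
    ring
  have hφc : Continuous φ := by
    have : φ = fun t => ⟪G 0, G t⟫ := by
      ext t; rw [hφ, sub_zero]
    rw [this]
    fun_prop
  have hφM : ∀ t, ‖φ t‖ ≤ M * M := by
    intro t
    have := hφ 0 t
    rw [sub_zero] at this
    rw [← this]
    exact (norm_inner_le_norm _ _).trans
      (mul_le_mul (hM _) (hM _) (norm_nonneg _) ((norm_nonneg _).trans (hM 0)))
  have hgi : ∀ a : ℝ, 0 < a → Integrable (fun t : ℝ => Real.exp (-a * t ^ 2)) :=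
    fun a ha => integrable_exp_neg_mul_sq ha
  let K : ℝ → H := fun t => ((Real.exp (-(2 * ε) * t ^ 2) : ℂ) * e t) • G t
  have hKc : Continuous K := by fun_prop
  have hKi : Integrable K := by
    refine ((hgi (2 * ε) (by positivity)).mul_const M).mono' hKc.aestronglyMeasurable
      (ae_of_all _ fun t => ?_)
    rw [norm_smul, norm_mul, he1, mul_one, Complex.norm_real, Real.norm_of_nonneg (by positivity)]
    gcongr
    exact hM t
  have hK : ∀ r t, ⟪K r, K t⟫ = (Real.exp (-(2 * ε) * r ^ 2) * Real.exp (-(2 * ε) * t ^ 2) : ℂ) *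
      (e (t - r) * φ (t - r)) := by
    intro r t
    simp only [K]
    rw [inner_smul_left, inner_smul_right, hφ, ← hmul]
    simp only [map_mul, Complex.conj_ofReal]
    ring
  have h1 : ⟪∫ t, K t, ∫ t, K t⟫ = ∫ r, ∫ t, ⟪K r, K t⟫ := by
    rw [← inner_conj_symm, ← integral_inner hKi, ← integral_conj]
    congr 1
    ext r
    rw [inner_conj_symm, ← integral_inner hKi]
  have h2 : ∀ r, ∫ t, ⟪K r, K t⟫ = ∫ τ, ((Real.exp (-(2 * ε) * r ^ 2 + -(2 * ε) * (r + τ) ^ 2) : ℝ)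
      : ℂ) * (e τ * φ τ) := by
    intro r
    rw [← integral_add_left_eq_self _ r]
    congr 1
    ext τ
    rw [hK, add_sub_cancel_left, Real.exp_add]
    push_cast
    ring
  have hswap : Integrable (Function.uncurry fun r τ : ℝ =>
      ((Real.exp (-(2 * ε) * r ^ 2 + -(2 * ε) * (r + τ) ^ 2) : ℝ) : ℂ) * (e τ * φ τ))
      (volume.prod volume) := by
    refine (((hgi ε hε).mul_prod (hgi (ε / 2) (by positivity))).mul_const (M * M)).mono'
      (Continuous.aestronglyMeasurable (by unfold Function.uncurry; fun_prop))
      (ae_of_all _ fun p => ?_)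
    obtain ⟨r, τ⟩ := p
    simp only [Function.uncurry]
    rw [norm_mul, norm_mul, he1, one_mul, Complex.norm_real, Real.norm_of_nonneg (by positivity),
      ← Real.exp_add]
    refine mul_le_mul (Real.exp_le_exp.2 ?_) (hφM τ) (norm_nonneg _) (by positivity)
    -- The excess `3r² + 4rτ + 3τ²/2` equals `(3r+2τ)²/3 + τ²/6`.
    nlinarith [sq_nonneg (3 * r + 2 * τ), sq_nonneg τ, sq_nonneg r]
  have h3 : ∀ τ, ∫ r, ((Real.exp (-(2 * ε) * r ^ 2 + -(2 * ε) * (r + τ) ^ 2) : ℝ) : ℂ) * (e τ * φ τ)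
      = ((∫ r : ℝ, Real.exp (-(4 * ε) * r ^ 2) : ℝ) : ℂ) *
        (e τ * ((Real.exp (-ε * τ ^ 2) : ℂ) * φ τ)) := by
    intro τ
    rw [integral_mul_const, integral_complex_ofReal]
    have : ∀ r : ℝ, Real.exp (-(2 * ε) * r ^ 2 + -(2 * ε) * (r + τ) ^ 2) =
        Real.exp (-(4 * ε) * (r + τ / 2) ^ 2) * Real.exp (-ε * τ ^ 2) := by
      intro r
      rw [← Real.exp_add]
      congr 1
      ring
    simp only [this]
    rw [integral_mul_const, integral_add_right_eq_self (fun r => Real.exp (-(4 * ε) * r ^ 2))]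
    push_cast
    ring
  have h4 : ⟪∫ t, K t, ∫ t, K t⟫ = ((∫ r : ℝ, Real.exp (-(4 * ε) * r ^ 2) : ℝ) : ℂ) *
      𝓕 (fun t => (Real.exp (-ε * t ^ 2) : ℂ) * φ t) s := by
    rw [h1]
    simp only [h2]
    rw [integral_integral_swap hswap]
    simp only [h3]
    rw [integral_const_mul, Real.fourier_real_eq]
    congr 1
  have hC : 0 < ∫ r : ℝ, Real.exp (-(4 * ε) * r ^ 2) := by
    rw [integral_gaussian]
    positivity
  set C := ∫ r : ℝ, Real.exp (-(4 * ε) * r ^ 2)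
  have h5 : 𝓕 (fun t => (Real.exp (-ε * t ^ 2) : ℂ) * φ t) s =
      ((‖∫ t, K t‖ ^ 2 / C : ℝ) : ℂ) := by
    rw [inner_self_eq_norm_sq_to_K] at h4
    rw [Complex.ofReal_div, Complex.ofReal_pow, eq_div_iff (by exact_mod_cast hC.ne'), mul_comm, ← h4]
    rfl
  rw [h5, Complex.norm_real, Real.norm_of_nonneg (by positivity)]

/-- Damping `φ` by Gaussians gives functions whose Fourier transforms are densities of probability
measures. Their characteristic functions tend to `φ`, which is continuous at zero, so the measures
are tight; any limit point has characteristic function `φ`. -/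
theorem exists_probabilityMeasure_charFun {G : ℝ → H} (hG : Continuous G) {φ : ℝ → ℂ}
    (hφ : ∀ r t, ⟪G r, G t⟫ = φ (t - r)) (h0 : φ 0 = 1) :
    ∃ μ : ProbabilityMeasure ℝ, ∀ t, charFun (μ : Measure ℝ) t = φ t := by
  have hM : ∀ t, ‖G t‖ ≤ 1 := by
    intro t
    have := hφ t t
    rw [sub_self, h0, inner_self_eq_norm_sq_to_K] at this
    have h : ‖G t‖ ^ 2 = 1 := Complex.ofReal_injective (by simpa using this)
    nlinarith [norm_nonneg (G t)]
  have hφc : Continuous φ := by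
    have : φ = fun t => ⟪G 0, G t⟫ := by
      ext t; rw [hφ, sub_zero]
    rw [this]
    fun_prop
  have hφM : ∀ t, ‖φ t‖ ≤ 1 := by
    intro t
    have := hφ 0 t
    rw [sub_zero] at this
    rw [← this]
    exact (norm_inner_le_norm _ _).trans (mul_le_one₀ (hM _) (norm_nonneg _) (hM _))
  let ε : ℕ → ℝ := fun n => 1 / ((n : ℝ) + 1)
  have hε : ∀ n, 0 < ε n := fun n => Nat.one_div_pos_of_nat
  -- The factor `2π` reconciles the kernel `exp (-2πi ts)` of `𝓕` with the kernel `exp (its)` of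
  -- `charFun`.
  let f : ℕ → ℝ → ℂ := fun n t => (Real.exp (-ε n * t ^ 2) : ℂ) * φ (2 * Real.pi * t)
  have hfc : ∀ n, Continuous (f n) := fun n => by fun_prop
  have hfi : ∀ n, Integrable (f n) := by
    intro n
    refine (integrable_exp_neg_mul_sq (hε n)).mono' (hfc n).aestronglyMeasurable
      (ae_of_all _ fun t => ?_)
    rw [norm_mul, Complex.norm_real, Real.norm_of_nonneg (by positivity)]
    exact mul_le_of_le_one_right (by positivity) (hφM _)
  have hpos : ∀ n s, 𝓕 (f n) s = (‖𝓕 (f n) s‖ : ℂ) := by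
    intro n s
    refine fourier_gaussian_mul_nonneg (G := fun t => G (2 * Real.pi * t)) (by fun_prop)
      (M := 1) (fun t => hM _) (φ := fun t => φ (2 * Real.pi * t)) (fun r t => ?_) (hε n) s
    rw [hφ, mul_sub]
  have hFi : ∀ n, Integrable (𝓕 (f n)) := fun n =>
    integrable_fourier_of_nonneg (hfi n) (hfc n).continuousAt (hpos n)
  let μ : ℕ → Measure ℝ := fun n => volume.withDensity fun s => ENNReal.ofReal ‖𝓕 (f n) s‖
  have hint : ∀ n (g : ℝ → ℂ), ∫ s, g s ∂(μ n) = ∫ s, g s * 𝓕 (f n) s := by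
    intro n g
    have hFc : Continuous (𝓕 (f n)) :=
      VectorFourier.fourierIntegral_continuous Real.continuous_fourierChar
        (by exact continuous_inner) (hfi n)
    rw [integral_withDensity_eq_integral_toReal_smul (by fun_prop) (by simp)]
    refine integral_congr_ae (ae_of_all _ fun s => ?_)
    show _ = g s * 𝓕 (f n) s
    rw [hpos n s]
    simp only [ENNReal.toReal_ofReal (norm_nonneg _), Complex.real_smul]
    rw [mul_comm]
  have hchar : ∀ n t, charFun (μ n) t = (Real.exp (-ε n * (t / (2 * Real.pi)) ^ 2) : ℂ) * φ t := by
    intro n t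
    have hinv := (hfc n).fourierInv_fourier_eq (hfi n) (hFi n)
    have h1 : 𝓕⁻ (𝓕 (f n)) (t / (2 * Real.pi)) = f n (t / (2 * Real.pi)) := by rw [hinv]
    rw [charFun_apply_real, hint]
    rw [Real.fourierInv_eq'] at h1
    have h2 : f n (t / (2 * Real.pi)) = (Real.exp (-ε n * (t / (2 * Real.pi)) ^ 2) : ℂ) * φ t := by
      simp only [f]
      congr 2
      field_simp
    rw [← h2, ← h1]
    refine integral_congr_ae (ae_of_all _ fun s => ?_)
    show _ = _ • _
    rw [smul_eq_mul]
    simp only [RCLike.inner_apply, conj_trivial]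
    push_cast
    field_simp
  have hprob : ∀ n, IsProbabilityMeasure (μ n) := by
    intro n
    have h := hchar n 0
    rw [charFun_zero, h0] at h
    have h' : (μ n).real Set.univ = 1 := by
      have : (((μ n).real Set.univ : ℝ) : ℂ) = (1 : ℝ) := by rw [h]; simp
      exact_mod_cast this
    refine ⟨?_⟩
    rw [Measure.real, ENNReal.toReal_eq_one_iff] at h'
    exact h'
  have hlim : ∀ t, Tendsto (fun n => charFun (μ n) t) atTop (𝓝 (φ t)) := by
    intro t
    simp only [hchar]
    have h1 : Tendsto ε atTop (𝓝 0) := tendsto_one_div_add_atTop_nhds_zero_nat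
    have h2 : Continuous fun a : ℝ => (Real.exp (-a * (t / (2 * Real.pi)) ^ 2) : ℂ) * φ t := by
      fun_prop
    have h3 := (h2.tendsto 0).comp h1
    simpa using! h3
  have htight := isTightMeasureSet_of_tendsto_charFun hφc.continuousAt hlim
  let μ' : ℕ → ProbabilityMeasure ℝ := fun n => ⟨μ n, hprob n⟩
  have hcomp := isCompact_closure_of_isTightMeasureSet (S := Set.range μ') (by
    convert htight using 1
    ext ν
    constructor
    · rintro ⟨_, ⟨n, rfl⟩, rfl⟩
      exact ⟨n, rfl⟩
    · rintro ⟨n, rfl⟩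
      exact ⟨μ' n, ⟨n, rfl⟩, rfl⟩)
  -- A limit along an ultrafilter finer than `atTop` suffices, since the characteristic functions
  -- converge along `atTop` anyway; no subsequence is extracted.
  obtain ⟨ν, -, hν⟩ := hcomp.ultrafilter_le_nhds ((Ultrafilter.of atTop).map μ')
    (by
      rw [le_principal_iff]
      refine mem_of_superset ?_ subset_closure
      exact mem_map.2 (univ_mem' fun n => ⟨n, rfl⟩))
  refine ⟨ν, fun t => ?_⟩
  have hν' : Tendsto μ' (Ultrafilter.of (atTop : Filter ℕ)) (𝓝 ν) := hν
  rw [ProbabilityMeasure.tendsto_iff_forall_integral_rclike_tendsto ℂ] at hν'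
  have h1 := hν' (BoundedContinuousFunction.innerProbChar t)
  simp_rw [← charFun_eq_integral_innerProbChar] at h1
  exact tendsto_nhds_unique h1 ((hlim t).mono_left (Ultrafilter.of_le _))

/-- **Bochner's theorem** for the positive definite functions `t ↦ ⟪G 0, G t⟫` given by a
continuous stationary curve `G` in a Hilbert space. -/
theorem exists_finiteMeasure_charFun {G : ℝ → H} (hG : Continuous G) {φ : ℝ → ℂ}
    (hφ : ∀ r t, ⟪G r, G t⟫ = φ (t - r)) :
    ∃ μ : Measure ℝ, IsFiniteMeasure μ ∧ ∀ t, charFun μ t = φ t := by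
  have hn : ∀ t, φ 0 = ((‖G t‖ ^ 2 : ℝ) : ℂ) := by
    intro t
    have := hφ t t
    rw [sub_self, inner_self_eq_norm_sq_to_K] at this
    rw [← this]; simp
  by_cases h : G 0 = 0
  · refine ⟨0, inferInstance, fun t => ?_⟩
    rw [charFun_zero_measure, ← sub_zero t, ← hφ, h, inner_zero_left]
  · have hpos : 0 < ‖G 0‖ := norm_pos_iff.2 h
    set a : ℝ := ‖G 0‖ with ha
    have ha' : (a : ℂ) ≠ 0 := by exact_mod_cast hpos.ne'
    obtain ⟨μ, hμ⟩ := exists_probabilityMeasure_charFun (G := fun t => (a⁻¹ : ℂ) • G t)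
      (by fun_prop) (φ := fun t => (a⁻¹ : ℂ) ^ 2 * φ t) (fun r t => by
        rw [inner_smul_left, inner_smul_right, hφ, ← Complex.ofReal_inv, Complex.conj_ofReal]
        ring) (by
        rw [hn 0, ← ha]
        push_cast
        field_simp)
    refine ⟨ENNReal.ofReal (a ^ 2) • (μ : Measure ℝ), ?_, fun t => ?_⟩
    · exact Measure.smul_finite _ ENNReal.ofReal_ne_top
    · have h1 := hμ t
      rw [charFun_apply] at h1 ⊢
      rw [integral_smul_measure, h1, ENNReal.toReal_ofReal (by positivity), Complex.real_smul]
      push_cast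
      field_simp

end Bochner

/-! ### Frames: modelling the orbit of a vector in an `L²` space -/

section SpectralFrame

open MeasureTheory Filter Topology

/-- A family of square-integrable functions `e i` on `ℝ`, total in `L²` of every finite measure,
together with operators `op i` whose action on each vector `x` is modelled by the `e i` in
`L²(μ x)`. -/
structure SpectralFrame (ι : Type*) (H : Type*) [NormedAddCommGroup H] [InnerProductSpace ℂ H] where
  /-- The model functions. -/
  e : ι → ℝ → ℂ
  /-- The operators. -/
  op : ι → H →L[ℂ] H
  /-- The spectral measures of vectors. -/
  μ : H → Measure ℝ
  isFinite : ∀ x, IsFiniteMeasure (μ x)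
  memLp : ∀ i (ν : Measure ℝ) [IsFiniteMeasure ν], MemLp (e i) 2 ν
  total : ∀ (ν : Measure ℝ) [IsFiniteMeasure ν] (g : ℝ → ℂ), MemLp g 2 ν →
    (∀ i, ∫ s, conj (e i s) * g s ∂ν = 0) → g =ᵐ[ν] 0
  inner_op : ∀ x i j, ⟪op i x, op j x⟫ = ∫ s, conj (e i s) * e j s ∂(μ x)

theorem inner_toLp_eq_integral {ν : Measure ℝ} {f g : ℝ → ℂ} (hf : MemLp f 2 ν) (hg : MemLp g 2 ν) :
    ⟪hf.toLp f, hg.toLp g⟫ = ∫ s, conj (f s) * g s ∂ν := by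
  rw [MeasureTheory.L2.inner_def]
  refine integral_congr_ae ?_
  filter_upwards [hf.coeFn_toLp, hg.coeFn_toLp] with s h1 h2
  rw [h1, h2, RCLike.inner_apply, mul_comm]

theorem memLp_two_add_measure {ν ν' : Measure ℝ} {f : ℝ → ℂ} (h : MemLp f 2 ν)
    (h' : MemLp f 2 ν') : MemLp f 2 (ν + ν') := by
  have hm : AEStronglyMeasurable f (ν + ν') := aestronglyMeasurable_add_measure_iff.2 ⟨h.1, h'.1⟩
  rw [memLp_two_iff_integrable_sq_norm hm]
  exact ((memLp_two_iff_integrable_sq_norm h.1).1 h).add_measure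
    ((memLp_two_iff_integrable_sq_norm h'.1).1 h')

theorem memLp_two_iff_lintegral_lt_top {ν : Measure ℝ} {f : ℝ → ℂ} (hf : Measurable f) :
    MemLp f 2 ν ↔ ∫⁻ s, ‖f s‖ₑ ^ 2 ∂ν < ⊤ := by
  have h := eLpNorm_lt_top_iff_lintegral_rpow_enorm_lt_top (f := f) (μ := ν)
    (p := 2) two_ne_zero ENNReal.ofNat_ne_top
  simp only [ENNReal.toReal_ofNat, ENNReal.rpow_ofNat] at h
  rw [← h]
  exact ⟨fun h => h.2, fun h => ⟨hf.aestronglyMeasurable, h⟩⟩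

namespace SpectralFrame

variable {ι : Type*} {H : Type*} [NormedAddCommGroup H] [InnerProductSpace ℂ H]
  (F : SpectralFrame ι H)

instance (x : H) : IsFiniteMeasure (F.μ x) := F.isFinite x

/-- A finite linear combination of the model functions. -/
def comb (c : ι →₀ ℂ) : ℝ → ℂ := c.sum fun i a => a • F.e i

/-- The corresponding linear combination of the operators. -/
def combOp (c : ι →₀ ℂ) : H →L[ℂ] H := c.sum fun i a => a • F.op i

theorem memLp_comb (c : ι →₀ ℂ) (ν : Measure ℝ) [IsFiniteMeasure ν] : MemLp (F.comb c) 2 ν :=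
  memLp_finsetSum' _ fun i _ => (F.memLp i ν).const_smul _

/-- The class of a linear combination of the model functions in `L²`. -/
def toLpMap (ν : Measure ℝ) [IsFiniteMeasure ν] : (ι →₀ ℂ) →ₗ[ℂ] Lp ℂ 2 ν :=
  Finsupp.linearCombination ℂ fun i => (F.memLp i ν).toLp (F.e i)

/-- The action of linear combinations of the operators on a vector. -/
def opMap (x : H) : (ι →₀ ℂ) →ₗ[ℂ] H := Finsupp.linearCombination ℂ fun i => F.op i x

theorem opMap_apply (x : H) (c : ι →₀ ℂ) : F.opMap x c = F.combOp c x := by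
  simp [opMap, combOp, Finsupp.linearCombination_apply, Finsupp.sum]

theorem toLpMap_apply (ν : Measure ℝ) [IsFiniteMeasure ν] (c : ι →₀ ℂ) :
    F.toLpMap ν c = (F.memLp_comb c ν).toLp (F.comb c) := by
  refine Lp.ext ?_
  refine EventuallyEq.trans ?_ (MemLp.coeFn_toLp _).symm
  simp only [toLpMap, comb, Finsupp.linearCombination_apply, Finsupp.sum]
  have h : ∀ s : Finset ι, (⇑(∑ i ∈ s, c i • (F.memLp i ν).toLp (F.e i)) : ℝ → ℂ) =ᵐ[ν]
      ∑ i ∈ s, c i • F.e i := by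
    intro s
    classical
    induction s using Finset.induction_on with
    | empty => simpa using! Lp.coeFn_zero ℂ 2 ν
    | insert i s hi ih =>
      rw [Finset.sum_insert hi, Finset.sum_insert hi]
      refine (Lp.coeFn_add _ _).trans (EventuallyEq.add ?_ ih)
      exact (Lp.coeFn_smul _ _).trans ((F.memLp i ν).coeFn_toLp.const_smul (c i))
  exact h _

theorem denseRange_toLpMap (ν : Measure ℝ) [IsFiniteMeasure ν] : DenseRange (F.toLpMap ν) := by
  have h : (LinearMap.range (F.toLpMap ν)).topologicalClosure = ⊤ := by
    rw [Submodule.topologicalClosure_eq_top_iff, Submodule.eq_bot_iff]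
    intro g hg
    rw [Submodule.mem_orthogonal] at hg
    have h1 := F.total ν g (Lp.memLp g) fun i => by
      have h2 := hg (F.toLpMap ν (Finsupp.single i 1)) ⟨_, rfl⟩
      rw [← inner_toLp_eq_integral (F.memLp i ν) (Lp.memLp g), Lp.toLp_coeFn]
      simpa [toLpMap] using h2
    exact Lp.ext (h1.trans (Lp.coeFn_zero ℂ 2 ν).symm)
  have h2 := (Submodule.dense_iff_topologicalClosure_eq_top).2 h
  simpa [DenseRange] using! h2

/-- The Gram matrices of the vectors `op i x` and of the functions `e i` coincide by `inner_op`.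
This makes `model` well defined and isometric. -/
theorem norm_opMap (x : H) (c : ι →₀ ℂ) : ‖F.opMap x c‖ = ‖F.toLpMap (F.μ x) c‖ := by
  have h : ⟪F.opMap x c, F.opMap x c⟫ = ⟪F.toLpMap (F.μ x) c, F.toLpMap (F.μ x) c⟫ := by
    simp only [opMap, toLpMap, Finsupp.linearCombination_apply, Finsupp.sum, sum_inner, inner_sum,
      inner_smul_left, inner_smul_right, F.inner_op, inner_toLp_eq_integral]
  rw [inner_self_eq_norm_sq_to_K, inner_self_eq_norm_sq_to_K] at h
  have h' : ‖F.opMap x c‖ ^ 2 = ‖F.toLpMap (F.μ x) c‖ ^ 2 :=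
    Complex.ofReal_injective (by simpa using h)
  exact (sq_eq_sq₀ (norm_nonneg _) (norm_nonneg _)).1 h'

theorem exists_comb_approx {ν : Measure ℝ} [IsFiniteMeasure ν] {f : ℝ → ℂ} (hf : MemLp f 2 ν)
    {ε : ℝ} (hε : 0 < ε) : ∃ c : ι →₀ ℂ, eLpNorm (f - F.comb c) 2 ν ≤ ENNReal.ofReal ε := by
  obtain ⟨c, hc⟩ := (F.denseRange_toLpMap ν).exists_dist_lt (hf.toLp f) hε
  refine ⟨c, ?_⟩
  rw [toLpMap_apply, Lp.dist_edist, Lp.edist_toLp_toLp] at hc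
  have hfin : eLpNorm (f - F.comb c) 2 ν ≠ ⊤ := (hf.sub (F.memLp_comb c ν)).2.ne
  rw [← ENNReal.ofReal_toReal hfin]
  exact ENNReal.ofReal_le_ofReal hc.le

variable [CompleteSpace H]

/-- The isometric embedding `L²(μ x) → H` mapping `e i` to `op i x`. -/
def model (x : H) : Lp ℂ 2 (F.μ x) →L[ℂ] H := (F.opMap x).extendOfNorm (F.toLpMap (F.μ x))

theorem model_toLpMap (x : H) (c : ι →₀ ℂ) : F.model x (F.toLpMap (F.μ x) c) = F.combOp c x := by
  rw [← opMap_apply]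
  exact LinearMap.extendOfNorm_eq (F.denseRange_toLpMap _)
    ⟨1, fun c => by rw [one_mul, F.norm_opMap]⟩ c

theorem norm_model (x : H) (g : Lp ℂ 2 (F.μ x)) : ‖F.model x g‖ = ‖g‖ := by
  refine (F.denseRange_toLpMap (F.μ x)).induction_on
    (p := fun g => ‖F.model x g‖ = ‖g‖) g (isClosed_eq (by fun_prop) (by fun_prop)) fun c => ?_
  rw [F.model_toLpMap, ← opMap_apply, norm_opMap]

open Classical in
/-- The vector `∫ f dP x`, for `f` square-integrable for the spectral measure of `x`. -/
def integralAt (f : ℝ → ℂ) (x : H) : H :=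
  if h : MemLp f 2 (F.μ x) then F.model x (h.toLp f) else 0

variable {F}

theorem integralAt_eq {f : ℝ → ℂ} {x : H} (h : MemLp f 2 (F.μ x)) :
    F.integralAt f x = F.model x (h.toLp f) := dif_pos h

theorem integralAt_comb (c : ι →₀ ℂ) (x : H) : F.integralAt (F.comb c) x = F.combOp c x := by
  rw [integralAt_eq (F.memLp_comb c _), ← toLpMap_apply, model_toLpMap]

theorem integralAt_e (i : ι) (x : H) : F.integralAt (F.e i) x = F.op i x := by
  have := integralAt_comb (F := F) (Finsupp.single i 1) x
  simpa [comb, combOp] using this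

theorem integralAt_add {f g : ℝ → ℂ} {x : H} (hf : MemLp f 2 (F.μ x)) (hg : MemLp g 2 (F.μ x)) :
    F.integralAt (f + g) x = F.integralAt f x + F.integralAt g x := by
  rw [integralAt_eq hf, integralAt_eq hg, integralAt_eq (hf.add hg), ← map_add]
  rfl

theorem integralAt_sub {f g : ℝ → ℂ} {x : H} (hf : MemLp f 2 (F.μ x)) (hg : MemLp g 2 (F.μ x)) :
    F.integralAt (f - g) x = F.integralAt f x - F.integralAt g x := by
  rw [integralAt_eq hf, integralAt_eq hg, integralAt_eq (hf.sub hg), ← map_sub]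
  rfl

theorem integralAt_const_smul {f : ℝ → ℂ} {x : H} (a : ℂ) (hf : MemLp f 2 (F.μ x)) :
    F.integralAt (a • f) x = a • F.integralAt f x := by
  rw [integralAt_eq hf, integralAt_eq (hf.const_smul a), ← map_smul]
  rfl

theorem norm_integralAt {f : ℝ → ℂ} {x : H} (hf : MemLp f 2 (F.μ x)) :
    ‖F.integralAt f x‖ = (eLpNorm f 2 (F.μ x)).toReal := by
  rw [integralAt_eq hf, norm_model, Lp.norm_toLp]

theorem inner_integralAt {f g : ℝ → ℂ} {x : H} (hf : MemLp f 2 (F.μ x))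
    (hg : MemLp g 2 (F.μ x)) :
    ⟪F.integralAt f x, F.integralAt g x⟫ = ∫ s, conj (f s) * g s ∂(F.μ x) := by
  let W : Lp ℂ 2 (F.μ x) →ₗᵢ[ℂ] H := ⟨(F.model x).toLinearMap, F.norm_model x⟩
  rw [integralAt_eq hf, integralAt_eq hg, ← inner_toLp_eq_integral hf hg]
  exact W.inner_map_map _ _

theorem integralAt_congr {f g : ℝ → ℂ} {x : H} (h : f =ᵐ[F.μ x] g) :
    F.integralAt f x = F.integralAt g x := by
  by_cases hf : MemLp f 2 (F.μ x)
  · have hg := (memLp_congr_ae h).1 hf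
    rw [integralAt_eq hf, integralAt_eq hg]
    congr 1
    exact (MemLp.toLp_eq_toLp_iff hf hg).2 h
  · have hg : ¬ MemLp g 2 (F.μ x) := fun hg => hf ((memLp_congr_ae h).2 hg)
    rw [integralAt, integralAt, dif_neg hf, dif_neg hg]

/-- The same coefficients `c` serve every vector whose measure is dominated by `ν`. Identities
between values at several vectors can therefore be checked on the bounded operators `combOp c`. -/
theorem norm_integralAt_sub_comb_le {f : ℝ → ℂ} {x : H} {ν : Measure ℝ} (hx : F.μ x ≤ ν)
    (hf : MemLp f 2 ν) {c : ι →₀ ℂ} {ε : ℝ} (hε : 0 < ε)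
    (hc : eLpNorm (f - F.comb c) 2 ν ≤ ENNReal.ofReal ε) :
    ‖F.integralAt f x - F.combOp c x‖ ≤ ε := by
  have hf' := hf.mono_measure hx
  rw [← integralAt_comb, ← integralAt_sub hf' (F.memLp_comb c _),
    norm_integralAt (hf'.sub (F.memLp_comb c _))]
  exact ENNReal.toReal_le_of_le_ofReal hε.le ((eLpNorm_mono_measure _ hx).trans hc)

theorem integralAt_vector_add {f : ℝ → ℂ} {x y : H} (hx : MemLp f 2 (F.μ x))
    (hy : MemLp f 2 (F.μ y)) (hxy : MemLp f 2 (F.μ (x + y))) :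
    F.integralAt f (x + y) = F.integralAt f x + F.integralAt f y := by
  rw [← sub_eq_zero, ← norm_le_zero_iff]
  refine le_of_forall_pos_le_add fun ε hε => ?_
  -- Approximating in `L²` of the sum of the three measures gives one `c` for `x`, `y` and `x + y`;
  -- linearity of `combOp c` then does the rest.
  have hν : MemLp f 2 (F.μ x + F.μ y + F.μ (x + y)) := by
    exact memLp_two_add_measure (memLp_two_add_measure hx hy) hxy
  obtain ⟨c, hc⟩ := F.exists_comb_approx hν (show 0 < ε / 3 by positivity)
  have h1 := norm_integralAt_sub_comb_le (F := F) (x := x) (by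
    rw [add_assoc]; exact Measure.le_add_right le_rfl) hν (by positivity) hc
  have h2 := norm_integralAt_sub_comb_le (F := F) (x := y) (by
    rw [add_assoc]; exact Measure.le_add_left (Measure.le_add_right le_rfl)) hν (by positivity) hc
  have h3 := norm_integralAt_sub_comb_le (F := F) (x := x + y) (Measure.le_add_left le_rfl)
    hν (by positivity) hc
  have h4 : F.integralAt f (x + y) - (F.integralAt f x + F.integralAt f y) =
      (F.integralAt f (x + y) - F.combOp c (x + y)) - (F.integralAt f x - F.combOp c x) -
        (F.integralAt f y - F.combOp c y) := by
    rw [map_add]; abel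
  rw [h4]
  have h5 := norm_sub_le ((F.integralAt f (x + y) - F.combOp c (x + y)) -
    (F.integralAt f x - F.combOp c x)) (F.integralAt f y - F.combOp c y)
  have h6 := norm_sub_le (F.integralAt f (x + y) - F.combOp c (x + y))
    (F.integralAt f x - F.combOp c x)
  linarith

theorem integralAt_vector_smul {f : ℝ → ℂ} {x : H} (a : ℂ) (hx : MemLp f 2 (F.μ x))
    (hax : MemLp f 2 (F.μ (a • x))) : F.integralAt f (a • x) = a • F.integralAt f x := by
  rw [← sub_eq_zero, ← norm_le_zero_iff]
  refine le_of_forall_pos_le_add fun ε hε => ?_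
  have hν : MemLp f 2 (F.μ x + F.μ (a • x)) := memLp_two_add_measure hx hax
  set δ := ε / (1 + ‖a‖) with hδ
  have hδ0 : 0 < δ := by positivity
  obtain ⟨c, hc⟩ := F.exists_comb_approx hν hδ0
  have h1 := norm_integralAt_sub_comb_le (F := F) (x := x) (Measure.le_add_right le_rfl) hν hδ0 hc
  have h3 := norm_integralAt_sub_comb_le (F := F) (x := a • x) (Measure.le_add_left le_rfl)
    hν hδ0 hc
  have h4 : F.integralAt f (a • x) - a • F.integralAt f x =
      (F.integralAt f (a • x) - F.combOp c (a • x)) - a • (F.integralAt f x - F.combOp c x) := by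
    rw [map_smul, smul_sub]; abel
  rw [h4]
  have h5 := norm_sub_le (F.integralAt f (a • x) - F.combOp c (a • x))
    (a • (F.integralAt f x - F.combOp c x))
  rw [norm_smul] at h5
  have h6 : ‖a‖ * ‖F.integralAt f x - F.combOp c x‖ ≤ ‖a‖ * δ := by gcongr
  have h7 : δ * (1 + ‖a‖) = ε := by rw [hδ]; field_simp
  linarith

end SpectralFrame

end SpectralFrame

/-! ### Functional calculus of a spectral measure -/

section Calculus

open MeasureTheory Filter Topology

/-- Polarization: the diagonal identity at `x + y` and at `x + i y` gives the sum and the difference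
of the two off-diagonal identities. -/
theorem inner_eq_inner_of_diagonal {H : Type*} [NormedAddCommGroup H] [InnerProductSpace ℂ H]
    {D : Submodule ℂ H} (A B : D →ₗ[ℂ] H) (h : ∀ x : D, ⟪A x, (x : H)⟫ = ⟪(x : H), B x⟫) (x y : D) :
    ⟪A x, (y : H)⟫ = ⟪(x : H), B y⟫ := by
  have h1 := h (x + y)
  have h2 := h (x + Complex.I • y)
  simp only [map_add, map_smul, Submodule.coe_add, Submodule.coe_smul, inner_add_left,
    inner_add_right, inner_smul_left, inner_smul_right, h x, h y, Complex.conj_I] at h1 h2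
  have h3 : Complex.I * (⟪A x, (y : H)⟫ - ⟪A y, (x : H)⟫) =
      Complex.I * (⟪(x : H), B y⟫ - ⟪(y : H), B x⟫) := by linear_combination h2
  have h4 := mul_left_cancel₀ Complex.I_ne_zero h3
  linear_combination (h1 + h4) / 2

namespace SpectralMeasure

variable {H : Type*} [NormedAddCommGroup H] [InnerProductSpace ℂ H] [CompleteSpace H]
  (P : SpectralMeasure H)

theorem proj_proj_apply {A B : Set ℝ} (hA : MeasurableSet A) (hB : MeasurableSet B) (x : H) :
    P.proj A (P.proj B x) = P.proj (A ∩ B) x := by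
  rw [P.inter A B hA hB]; rfl

theorem inner_proj_left {B : Set ℝ} (hB : MeasurableSet B) (x y : H) :
    ⟪P.proj B x, y⟫ = ⟪x, P.proj B y⟫ := by
  rw [← ContinuousLinearMap.adjoint_inner_right, ← ContinuousLinearMap.star_eq_adjoint,
    (P.isStarProjection B hB).isSelfAdjoint.star_eq]

theorem inner_proj_self {B : Set ℝ} (hB : MeasurableSet B) (x : H) :
    ⟪x, P.proj B x⟫ = ((‖P.proj B x‖ ^ 2 : ℝ) : ℂ) := by
  conv_lhs => rw [← Set.inter_self B, ← P.proj_proj_apply hB hB, ← P.inner_proj_left hB,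
    inner_self_eq_norm_sq_to_K]
  push_cast; rfl

theorem vectorMeasure_apply_eq_enorm {B : Set ℝ} (hB : MeasurableSet B) (x : H) :
    P.vectorMeasure x B = ‖P.proj B x‖ₑ ^ 2 := by
  rw [P.vectorMeasure_apply x hB, P.inner_proj_self hB, Complex.ofReal_re, ← ofReal_norm,
    ENNReal.ofReal_pow (norm_nonneg _)]

theorem vectorMeasure_univ (x : H) : P.vectorMeasure x Set.univ = ‖x‖ₑ ^ 2 := by
  rw [P.vectorMeasure_apply_eq_enorm MeasurableSet.univ, P.univ]; rfl

instance (x : H) : IsFiniteMeasure (P.vectorMeasure x) :=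
  ⟨by rw [vectorMeasure_univ]; exact ENNReal.pow_lt_top enorm_lt_top⟩

theorem measureReal_vectorMeasure {B : Set ℝ} (hB : MeasurableSet B) (x : H) :
    (P.vectorMeasure x).real B = ‖P.proj B x‖ ^ 2 := by
  rw [Measure.real, P.vectorMeasure_apply_eq_enorm hB, ENNReal.toReal_pow, toReal_enorm]

/-- The frame of indicator functions of Borel sets. -/
def frame : SpectralFrame {B : Set ℝ // MeasurableSet B} H where
  e B := B.1.indicator 1
  op B := P.proj B.1
  μ := P.vectorMeasure
  isFinite _ := inferInstance
  memLp B ν _ := (memLp_const (1 : ℂ)).indicator B.2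
  total ν _ g hg h := by
    refine (hg.integrable one_le_two).ae_eq_zero_of_forall_setIntegral_eq_zero fun B hB _ => ?_
    rw [← integral_indicator hB, ← h ⟨B, hB⟩]
    refine integral_congr_ae (ae_of_all _ fun s => ?_)
    by_cases hs : s ∈ B <;> simp [hs]
  inner_op x A B := by
    rw [P.inner_proj_left A.2, P.proj_proj_apply A.2 B.2, P.inner_proj_self (A.2.inter B.2),
      ← P.measureReal_vectorMeasure (A.2.inter B.2)]
    have : ∀ s, conj (A.1.indicator (1 : ℝ → ℂ) s) * B.1.indicator (1 : ℝ → ℂ) s =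
        (A.1 ∩ B.1).indicator (1 : ℝ → ℂ) s := by
      intro s
      by_cases h1 : s ∈ A.1 <;> by_cases h2 : s ∈ B.1 <;> simp [h1, h2]
    simp only [this]
    rw [integral_indicator (A.2.inter B.2)]
    simp

theorem measurable_comb (c : {B : Set ℝ // MeasurableSet B} →₀ ℂ) :
    Measurable (P.frame.comb c) := by
  have h : P.frame.comb c = fun s => ∑ B ∈ c.support, (c B • B.1.indicator (1 : ℝ → ℂ)) s := by
    ext s
    simp only [SpectralFrame.comb, Finsupp.sum, Finset.sum_apply]
    rfl
  rw [h]
  exact Finset.measurable_sum _ fun B _ => (measurable_one.indicator B.2).const_smul (c B)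

/-- The vector `(∫ f dP) x`; it is zero if `f` is not square-integrable for `μ_x`. -/
def func (f : ℝ → ℂ) (x : H) : H := P.frame.integralAt f x

variable {P}

theorem func_indicator {B : Set ℝ} (hB : MeasurableSet B) (x : H) :
    P.func (B.indicator 1) x = P.proj B x :=
  SpectralFrame.integralAt_e (F := P.frame) ⟨B, hB⟩ x

theorem func_one (x : H) : P.func 1 x = x := by
  have := func_indicator (P := P) MeasurableSet.univ x
  rwa [P.univ, Set.indicator_univ] at this

theorem func_zero (x : H) : P.func 0 x = 0 := by
  have := func_indicator (P := P) MeasurableSet.empty x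
  rwa [P.empty, Set.indicator_empty] at this

theorem func_congr {f g : ℝ → ℂ} {x : H} (h : f =ᵐ[P.vectorMeasure x] g) :
    P.func f x = P.func g x := SpectralFrame.integralAt_congr h

theorem func_add {f g : ℝ → ℂ} {x : H} (hf : MemLp f 2 (P.vectorMeasure x))
    (hg : MemLp g 2 (P.vectorMeasure x)) : P.func (f + g) x = P.func f x + P.func g x :=
  SpectralFrame.integralAt_add hf hg

theorem func_sub {f g : ℝ → ℂ} {x : H} (hf : MemLp f 2 (P.vectorMeasure x))
    (hg : MemLp g 2 (P.vectorMeasure x)) : P.func (f - g) x = P.func f x - P.func g x :=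
  SpectralFrame.integralAt_sub hf hg

theorem func_const_smul {f : ℝ → ℂ} {x : H} (a : ℂ) (hf : MemLp f 2 (P.vectorMeasure x)) :
    P.func (a • f) x = a • P.func f x := SpectralFrame.integralAt_const_smul a hf

theorem enorm_func {f : ℝ → ℂ} {x : H} (hf : MemLp f 2 (P.vectorMeasure x)) :
    ‖P.func f x‖ₑ = eLpNorm f 2 (P.vectorMeasure x) := by
  rw [← ofReal_norm, func, SpectralFrame.norm_integralAt hf]
  exact ENNReal.ofReal_toReal hf.2.ne

theorem enorm_func_sq {f : ℝ → ℂ} {x : H} (hf : MemLp f 2 (P.vectorMeasure x)) :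
    ‖P.func f x‖ₑ ^ 2 = ∫⁻ s, ‖f s‖ₑ ^ 2 ∂(P.vectorMeasure x) := by
  rw [enorm_func hf, eLpNorm_eq_lintegral_rpow_enorm_toReal two_ne_zero ENNReal.ofNat_ne_top,
    ← ENNReal.rpow_natCast, ← ENNReal.rpow_mul]
  simp

theorem inner_func {f g : ℝ → ℂ} {x : H} (hf : MemLp f 2 (P.vectorMeasure x))
    (hg : MemLp g 2 (P.vectorMeasure x)) :
    ⟪P.func f x, P.func g x⟫ = ∫ s, conj (f s) * g s ∂(P.vectorMeasure x) :=
  SpectralFrame.inner_integralAt hf hg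

theorem inner_self_func {f : ℝ → ℂ} {x : H} (hf : MemLp f 2 (P.vectorMeasure x)) :
    ⟪x, P.func f x⟫ = ∫ s, f s ∂(P.vectorMeasure x) := by
  have h := inner_func (P := P) (f := 1) (g := f) (x := x) (memLp_const (1 : ℂ)) hf
  rw [func_one] at h
  simpa using h

theorem vectorMeasure_smul (a : ℂ) (x : H) :
    P.vectorMeasure (a • x) = (‖a‖ₑ ^ 2) • P.vectorMeasure x := by
  ext B hB
  rw [Measure.smul_apply, P.vectorMeasure_apply_eq_enorm hB, P.vectorMeasure_apply_eq_enorm hB,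
    map_smul, enorm_smul, mul_pow, smul_eq_mul]

theorem vectorMeasure_zero : P.vectorMeasure 0 = 0 := by
  have := vectorMeasure_smul (P := P) 0 0
  simpa using this

/-- This is `‖a + b‖² ≤ 2(‖a‖² + ‖b‖²)` for the projected vectors. It makes the domain of `∫ f dP`
closed under addition. -/
theorem vectorMeasure_add_le (x y : H) :
    P.vectorMeasure (x + y) ≤ (2 : ENNReal) • (P.vectorMeasure x + P.vectorMeasure y) := by
  refine Measure.le_iff.2 fun B hB => ?_
  rw [Measure.smul_apply, Measure.add_apply, P.vectorMeasure_apply_eq_enorm hB,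
    P.vectorMeasure_apply_eq_enorm hB, P.vectorMeasure_apply_eq_enorm hB, map_add, smul_eq_mul]
  refine (pow_le_pow_left₀ (by simp) (enorm_add_le _ _) 2).trans ?_
  have h := parallelogram_law_with_norm ℂ (P.proj B x) (P.proj B y)
  have h3 : (‖P.proj B x‖ + ‖P.proj B y‖) ^ 2 ≤ 2 * (‖P.proj B x‖ ^ 2 + ‖P.proj B y‖ ^ 2) := by
    nlinarith [sq_nonneg (‖P.proj B x‖ - ‖P.proj B y‖)]
  simp only [← ofReal_norm]
  rw [← ENNReal.ofReal_add (norm_nonneg _) (norm_nonneg _), ← ENNReal.ofReal_pow (by positivity),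
    ← ENNReal.ofReal_pow (by positivity), ← ENNReal.ofReal_pow (by positivity),
    ← ENNReal.ofReal_add (by positivity) (by positivity),
    show (2 : ENNReal) = ENNReal.ofReal 2 by simp, ← ENNReal.ofReal_mul (by positivity)]
  exact ENNReal.ofReal_le_ofReal h3

theorem memLp_vector_add {f : ℝ → ℂ} {x y : H} (hx : MemLp f 2 (P.vectorMeasure x))
    (hy : MemLp f 2 (P.vectorMeasure y)) : MemLp f 2 (P.vectorMeasure (x + y)) :=
  ((memLp_two_add_measure hx hy).smul_measure ENNReal.ofNat_ne_top).mono_measure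
    (vectorMeasure_add_le x y)

theorem memLp_vector_smul {f : ℝ → ℂ} {x : H} (a : ℂ) (hx : MemLp f 2 (P.vectorMeasure x)) :
    MemLp f 2 (P.vectorMeasure (a • x)) := by
  rw [vectorMeasure_smul]
  exact hx.smul_measure (ENNReal.pow_lt_top enorm_lt_top).ne

theorem func_vector_add {f : ℝ → ℂ} {x y : H} (hx : MemLp f 2 (P.vectorMeasure x))
    (hy : MemLp f 2 (P.vectorMeasure y)) : P.func f (x + y) = P.func f x + P.func f y :=
  SpectralFrame.integralAt_vector_add (F := P.frame) hx hy (memLp_vector_add hx hy)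

theorem func_vector_smul {f : ℝ → ℂ} {x : H} (a : ℂ) (hx : MemLp f 2 (P.vectorMeasure x)) :
    P.func f (a • x) = a • P.func f x :=
  SpectralFrame.integralAt_vector_smul (F := P.frame) a hx (memLp_vector_smul a hx)

variable (P) in
/-- The (unbounded) operator `∫ f dP`. -/
def integral (f : ℝ → ℂ) : H →ₗ.[ℂ] H where
  domain :=
    { carrier := {x | MemLp f 2 (P.vectorMeasure x)}
      zero_mem' := by
        rw [Set.mem_ofPred_eq, vectorMeasure_zero]
        exact ⟨aestronglyMeasurable_zero_measure f, by simp⟩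
      add_mem' := memLp_vector_add
      smul_mem' := fun a _ hx => memLp_vector_smul a hx }
  toFun :=
    { toFun := fun x => P.func f x
      map_add' := fun x y => func_vector_add x.2 y.2
      map_smul' := fun a x => func_vector_smul a x.2 }

theorem mem_integral_domain {f : ℝ → ℂ} {x : H} :
    x ∈ (P.integral f).domain ↔ MemLp f 2 (P.vectorMeasure x) := Iff.rfl

theorem isIntegral_integral {f : ℝ → ℂ} (hf : Measurable f) : P.IsIntegral f (P.integral f) :=
  ⟨fun _ => memLp_two_iff_lintegral_lt_top hf, fun x => inner_self_func x.2⟩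

theorem memLp_conj {f : ℝ → ℂ} {ν : Measure ℝ} (hf : MemLp f 2 ν) :
    MemLp (fun s => conj (f s)) 2 ν := hf.star

theorem inner_func_left {f : ℝ → ℂ} {x y : H} (hx : MemLp f 2 (P.vectorMeasure x))
    (hy : MemLp f 2 (P.vectorMeasure y)) :
    ⟪P.func f x, y⟫ = ⟪x, P.func (fun s => conj (f s)) y⟫ := by
  let A : (P.integral f).domain →ₗ[ℂ] H := (P.integral f).toFun
  let B : (P.integral f).domain →ₗ[ℂ] H := (P.integral fun s => conj (f s)).toFun.comp
    (Submodule.inclusion fun x hx => memLp_conj hx)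
  refine inner_eq_inner_of_diagonal A B (fun z => ?_) ⟨x, hx⟩ ⟨y, hy⟩
  rw [← inner_conj_symm]
  show conj ⟪(z : H), P.func f z⟫ = ⟪(z : H), P.func _ z⟫
  rw [inner_self_func z.2, inner_self_func (memLp_conj z.2), integral_conj]

theorem vectorMeasure_proj {B : Set ℝ} (hB : MeasurableSet B) (x : H) :
    P.vectorMeasure (P.proj B x) = (P.vectorMeasure x).restrict B := by
  ext A hA
  rw [Measure.restrict_apply hA, P.vectorMeasure_apply_eq_enorm hA, P.proj_proj_apply hA hB,
    P.vectorMeasure_apply_eq_enorm (hA.inter hB)]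

theorem proj_add_proj_compl {B : Set ℝ} (hB : MeasurableSet B) (x : H) :
    P.proj B x + P.proj Bᶜ x = x := by
  have h1 : MemLp (1 : ℝ → ℂ) 2 (P.vectorMeasure x) := memLp_const (1 : ℂ)
  rw [← func_indicator hB, ← func_indicator hB.compl, Set.indicator_compl,
    func_sub h1 (h1.indicator hB), func_one, add_sub_cancel]

/-- The squared distance from `P(B n) x` to `x` is `μ_x` of the complement of `B n`, which decreases
to zero by continuity from above. -/
theorem tendsto_proj_of_monotone {B : ℕ → Set ℝ} (hB : ∀ n, MeasurableSet (B n)) (hm : Monotone B)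
    (hu : ⋃ n, B n = Set.univ) (x : H) :
    Tendsto (fun n => P.proj (B n) x) atTop (𝓝 x) := by
  have h1 : Tendsto (fun n => (P.vectorMeasure x).real (B n)ᶜ) atTop (𝓝 0) := by
    have := tendsto_measure_iInter_atTop (μ := P.vectorMeasure x) (s := fun n => (B n)ᶜ)
      (fun n => (hB n).compl.nullMeasurableSet)
      (fun m n hmn => Set.compl_subset_compl.2 (hm hmn)) ⟨0, measure_ne_top _ _⟩
    rw [← Set.compl_iUnion, hu, Set.compl_univ, measure_empty] at this
    simpa using! (ENNReal.tendsto_toReal ENNReal.zero_ne_top).comp this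
  have h2 : ∀ n, ‖P.proj (B n) x - x‖ ^ 2 = (P.vectorMeasure x).real (B n)ᶜ := by
    intro n
    rw [P.measureReal_vectorMeasure (hB n).compl, norm_sub_rev]
    congr 2
    rw [sub_eq_iff_eq_add', proj_add_proj_compl (hB n)]
  simp only [← h2] at h1
  rw [tendsto_iff_norm_sub_tendsto_zero]
  have h4 := (Real.continuous_sqrt.tendsto 0).comp h1
  simpa [Function.comp_def, Real.sqrt_sq] using h4

/-- Spectral projections commute with each other, hence with `combOp c`. A single approximation
works on both sides because the measure of `P(B) x` is dominated by that of `x`. -/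
theorem proj_func {f : ℝ → ℂ} {x : H} {B : Set ℝ} (hB : MeasurableSet B)
    (hf : MemLp f 2 (P.vectorMeasure x)) :
    P.proj B (P.func f x) = P.func f (P.proj B x) := by
  rw [← sub_eq_zero, ← norm_le_zero_iff]
  refine le_of_forall_pos_le_add fun ε hε => ?_
  set δ := ε / (1 + ‖P.proj B‖) with hδ
  have hδ0 : 0 < δ := by positivity
  obtain ⟨c, hc⟩ := P.frame.exists_comb_approx hf hδ0
  have h1 := SpectralFrame.norm_integralAt_sub_comb_le (F := P.frame) (x := x) le_rfl hf hδ0 hc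
  have h2 := SpectralFrame.norm_integralAt_sub_comb_le (F := P.frame) (x := P.proj B x)
    (show P.vectorMeasure _ ≤ P.vectorMeasure x by
      rw [vectorMeasure_proj hB]; exact Measure.restrict_le_self) hf hδ0 hc
  have h3 : P.frame.combOp c (P.proj B x) = P.proj B (P.frame.combOp c x) := by
    simp only [SpectralFrame.combOp, Finsupp.sum, sum_apply, map_sum]
    refine Finset.sum_congr rfl fun A _ => ?_
    show c A • P.proj A.1 (P.proj B x) = P.proj B (c A • P.proj A.1 x)
    rw [map_smul, P.proj_proj_apply A.2 hB, P.proj_proj_apply hB A.2, Set.inter_comm]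
  have h4 : P.proj B (P.func f x) - P.func f (P.proj B x) =
      P.proj B (P.frame.integralAt f x - P.frame.combOp c x) -
        (P.frame.integralAt f (P.proj B x) - P.frame.combOp c (P.proj B x)) := by
    rw [h3, map_sub, func, func]; abel
  rw [h4]
  have h5 := norm_sub_le (P.proj B (P.frame.integralAt f x - P.frame.combOp c x))
    (P.frame.integralAt f (P.proj B x) - P.frame.combOp c (P.proj B x))
  have h6 : ‖P.proj B (P.frame.integralAt f x - P.frame.combOp c x)‖ ≤ ‖P.proj B‖ * δ :=
    ((P.proj B).le_opNorm _).trans (by gcongr)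
  have h7 : δ * (1 + ‖P.proj B‖) = ε := by rw [hδ]; field_simp
  linarith

theorem func_proj_of_eqOn {f g : ℝ → ℂ} {B : Set ℝ} (hB : MeasurableSet B) (h : Set.EqOn f g B)
    (x : H) : P.func f (P.proj B x) = P.func g (P.proj B x) := by
  refine func_congr ?_
  rw [vectorMeasure_proj hB]
  exact (ae_restrict_mem hB).mono fun s hs => h hs

theorem proj_func_eq_indicator {f : ℝ → ℂ} {x : H} {B : Set ℝ} (hB : MeasurableSet B)
    (hf : MemLp f 2 (P.vectorMeasure x)) :
    P.proj B (P.func f x) = P.func (B.indicator f) x := by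
  have hg := hf.indicator hB
  rw [← proj_add_proj_compl (P := P) hB (P.func (B.indicator f) x), proj_func hB hg,
    proj_func hB.compl hg, proj_func hB hf,
    func_proj_of_eqOn hB (f := B.indicator f) (g := f) fun s hs => Set.indicator_of_mem hs f,
    func_proj_of_eqOn hB.compl (f := B.indicator f) (g := 0) fun s hs =>
      Set.indicator_of_notMem hs f, func_zero, add_zero]

/-- The projection of `f(P) x` to `B` is the vector of the function `f` cut off to `B`, so its
squared norm is the integral of `|f|²` over `B`. Both the domain and the value of a product of
operators rest on this density. -/
theorem vectorMeasure_func {f : ℝ → ℂ} {x : H} (hf : MemLp f 2 (P.vectorMeasure x)) :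
    P.vectorMeasure (P.func f x) = (P.vectorMeasure x).withDensity fun s => ‖f s‖ₑ ^ 2 := by
  ext B hB
  rw [P.vectorMeasure_apply_eq_enorm hB, proj_func_eq_indicator hB hf,
    enorm_func_sq (hf.indicator hB), withDensity_apply _ hB, ← lintegral_indicator hB]
  refine lintegral_congr fun s => ?_
  by_cases hs : s ∈ B <;> simp [hs]

theorem memLp_vectorMeasure_func {f g : ℝ → ℂ} {x : H} (hfm : Measurable f) (hg : Measurable g)
    (hf : MemLp f 2 (P.vectorMeasure x)) :
    MemLp g 2 (P.vectorMeasure (P.func f x)) ↔ MemLp (g * f) 2 (P.vectorMeasure x) := by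
  rw [memLp_two_iff_lintegral_lt_top hg, memLp_two_iff_lintegral_lt_top (hg.mul hfm),
    vectorMeasure_func hf, lintegral_withDensity_eq_lintegral_mul _ (by fun_prop) (by fun_prop)]
  simp only [Pi.mul_apply, enorm_mul, mul_pow, mul_comm]

/-- For combinations of indicators this is `proj_func_eq_indicator`. By the density formula,
approximating `g` in `L²` of the measure of `f(P) x` is the same as approximating `g f` in
`L²(μ_x)`, so the identity passes to the limit. -/
theorem func_func {f g : ℝ → ℂ} {x : H} (hfm : Measurable f) (hg : Measurable g)
    (hf : MemLp f 2 (P.vectorMeasure x)) (hgf : MemLp (g * f) 2 (P.vectorMeasure x)) :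
    P.func g (P.func f x) = P.func (g * f) x := by
  have hg' := (memLp_vectorMeasure_func hfm hg hf).2 hgf
  rw [← sub_eq_zero, ← norm_le_zero_iff]
  refine le_of_forall_pos_le_add fun ε hε => ?_
  obtain ⟨c, hc⟩ := P.frame.exists_comb_approx hg' (show 0 < ε / 2 by positivity)
  have h1 := SpectralFrame.norm_integralAt_sub_comb_le (F := P.frame) (x := P.func f x) le_rfl hg'
    (by positivity) hc
  have hcm := P.measurable_comb c
  have h2 : P.frame.combOp c (P.func f x) = P.func (P.frame.comb c * f) x ∧
      MemLp (P.frame.comb c * f) 2 (P.vectorMeasure x) := by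
    simp only [SpectralFrame.combOp, SpectralFrame.comb, Finsupp.sum,
      sum_apply]
    induction c.support using Finset.induction_on with
    | empty => simp [func_zero]
    | insert A s hA ih =>
      have h3 : MemLp (A.1.indicator f) 2 (P.vectorMeasure x) := hf.indicator A.2
      have h4 : P.frame.e A * f = A.1.indicator f := by
        ext t
        show A.1.indicator 1 t * f t = _
        by_cases ht : t ∈ A.1 <;> simp [ht]
      rw [Finset.sum_insert hA, Finset.sum_insert hA, add_mul, smul_mul_assoc, h4]
      refine ⟨?_, (h3.const_smul _).add ih.2⟩
      rw [func_add (h3.const_smul _) ih.2, ih.1, func_const_smul _ h3,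
        ← proj_func_eq_indicator A.2 hf]
      rfl
  have h3 : ‖P.func (g * f) x - P.func (P.frame.comb c * f) x‖ ≤ ε / 2 := by
    rw [← func_sub hgf h2.2, ← sub_mul]
    have h4 : MemLp ((g - P.frame.comb c) * f) 2 (P.vectorMeasure x) := by
      rw [sub_mul]; exact hgf.sub h2.2
    have h5 : ‖P.func ((g - P.frame.comb c) * f) x‖ₑ ≤ ENNReal.ofReal (ε / 2) := by
      refine le_trans (le_of_eq ?_) hc
      have h6 : ‖P.func ((g - P.frame.comb c) * f) x‖ₑ ^ 2 =
          (eLpNorm (g - P.frame.comb c) 2 (P.vectorMeasure (P.func f x))) ^ 2 := by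
        rw [enorm_func_sq h4, eLpNorm_eq_lintegral_rpow_enorm_toReal two_ne_zero
          ENNReal.ofNat_ne_top, ← ENNReal.rpow_natCast _ 2, ← ENNReal.rpow_mul,
          vectorMeasure_func hf]
        simp only [ENNReal.toReal_ofNat, ENNReal.rpow_ofNat, Nat.cast_ofNat, one_div, ne_eq,
          OfNat.ofNat_ne_zero, not_false_eq_true, inv_mul_cancel₀, ENNReal.rpow_one]
        rw [lintegral_withDensity_eq_lintegral_mul _ (by fun_prop) (by fun_prop)]
        simp only [Pi.mul_apply, enorm_mul, mul_pow, mul_comm]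
      exact (ENNReal.pow_right_strictMono two_ne_zero).injective h6
    rw [← ofReal_norm] at h5
    exact (ENNReal.ofReal_le_ofReal_iff (by positivity)).1 h5
  have h4 : P.func g (P.func f x) - P.func (g * f) x =
      (P.frame.integralAt g (P.func f x) - P.frame.combOp c (P.func f x)) -
        (P.func (g * f) x - P.func (P.frame.comb c * f) x) := by
    rw [h2.1, func]; abel
  rw [h4]
  exact (norm_sub_le _ _).trans (by linarith)

end SpectralMeasure

end Calculus

/-! ### Self-adjointness, uniqueness and covariance of spectral integrals -/

section SelfAdjoint

open MeasureTheory Filter Topology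

namespace SpectralMeasure

variable {H : Type*} [NormedAddCommGroup H] [InnerProductSpace ℂ H] [CompleteSpace H]
  {P : SpectralMeasure H}

theorem memLp_proj_of_bounded {f : ℝ → ℂ} (hf : Measurable f) {B : Set ℝ} (hB : MeasurableSet B)
    {C : ℝ} (hC : ∀ s ∈ B, ‖f s‖ ≤ C) (x : H) : MemLp f 2 (P.vectorMeasure (P.proj B x)) := by
  refine MemLp.of_bound hf.aestronglyMeasurable C ?_
  rw [vectorMeasure_proj hB]
  exact (ae_restrict_mem hB).mono hC

/-- The sublevel sets of the modulus of a function. -/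
def sublevel (f : ℝ → ℂ) (n : ℕ) : Set ℝ := {s | ‖f s‖ ≤ n}

theorem measurableSet_sublevel {f : ℝ → ℂ} (hf : Measurable f) (n : ℕ) :
    MeasurableSet (sublevel f n) := measurableSet_le hf.norm measurable_const

theorem monotone_sublevel (f : ℝ → ℂ) : Monotone (sublevel f) := fun m n hmn s hs => by
  have h : ‖f s‖ ≤ m := hs
  exact h.trans (Nat.cast_le.2 hmn)

theorem iUnion_sublevel (f : ℝ → ℂ) : ⋃ n, sublevel f n = Set.univ :=
  Set.eq_univ_of_forall fun s => Set.mem_iUnion.2 (exists_nat_ge ‖f s‖)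

theorem memLp_proj_sublevel {f : ℝ → ℂ} (hf : Measurable f) (n : ℕ) (x : H) :
    MemLp f 2 (P.vectorMeasure (P.proj (sublevel f n) x)) :=
  memLp_proj_of_bounded hf (measurableSet_sublevel hf n) (fun _ hs => hs) x

theorem tendsto_proj_sublevel {f : ℝ → ℂ} (hf : Measurable f) (x : H) :
    Tendsto (fun n => P.proj (sublevel f n) x) atTop (𝓝 x) :=
  tendsto_proj_of_monotone (measurableSet_sublevel hf) (monotone_sublevel f) (iUnion_sublevel f) x

/-- The domain is dense: it contains the cutoffs of `z` itself to the sets where `f` is bounded, and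
these converge to `z`. -/
theorem eq_zero_of_inner_domain {f : ℝ → ℂ} (hf : Measurable f) {z : H}
    (h : ∀ x, MemLp f 2 (P.vectorMeasure x) → ⟪x, z⟫ = 0) : z = 0 := by
  have h1 : Tendsto (fun n => ⟪P.proj (sublevel f n) z, z⟫) atTop (𝓝 ⟪z, z⟫) :=
    (tendsto_proj_sublevel hf z).inner tendsto_const_nhds
  simp only [h _ (memLp_proj_sublevel hf _ z)] at h1
  exact inner_self_eq_zero.1 (tendsto_nhds_unique h1 tendsto_const_nhds)

/-- `IsIntegral` prescribes the domain and the diagonal values. Polarization recovers all matrix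
elements, and density of the domain then determines the vectors. -/
theorem IsIntegral.eq_integral {f : ℝ → ℂ} (hf : Measurable f) {T : H →ₗ.[ℂ] H}
    (hT : P.IsIntegral f T) : T = P.integral f := by
  have hD : ∀ x, x ∈ T.domain ↔ MemLp f 2 (P.vectorMeasure x) := fun x =>
    (hT.1 x).trans (memLp_two_iff_lintegral_lt_top hf).symm
  refine LinearPMap.ext (Submodule.ext hD) fun y hy hy' => ?_
  rw [← sub_eq_zero]
  refine eq_zero_of_inner_domain (P := P) hf fun x hx => ?_
  let A : T.domain →ₗ[ℂ] H := (P.integral fun s => conj (f s)).toFun.comp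
    (Submodule.inclusion fun x hx => memLp_conj ((hD x).1 hx))
  have h := inner_eq_inner_of_diagonal A T.toFun (fun z => by
    rw [← inner_conj_symm]
    show conj ⟪(z : H), P.func _ z⟫ = ⟪(z : H), T z⟫
    rw [inner_self_func (memLp_conj ((hD _).1 z.2)), hT.2 z, integral_conj, Complex.conj_conj])
    ⟨x, (hD x).2 hx⟩ ⟨y, hy⟩
  have h2 : ⟪P.func (fun s => conj (f s)) x, y⟫ = ⟪x, P.func f y⟫ := by
    rw [inner_func_left (memLp_conj hx) (memLp_conj hy')]
    simp
  rw [inner_sub_right, sub_eq_zero]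
  exact h.symm.trans h2

/-- The adjoint of `∫ f dP` is contained in `∫ conj f dP`. -/
theorem memLp_and_func_eq_of_adjoint {f : ℝ → ℂ} (hf : Measurable f) {y z : H}
    (h : ∀ a, MemLp f 2 (P.vectorMeasure a) → ⟪y, P.func f a⟫ = ⟪z, a⟫) :
    MemLp (fun s => conj (f s)) 2 (P.vectorMeasure y) ∧ P.func (fun s => conj (f s)) y = z := by
  have hB := measurableSet_sublevel hf
  have hfc : Measurable fun s => conj (f s) := Complex.continuous_conj.measurable.comp hf
  have hmem : ∀ n (x : H), MemLp (fun s => conj (f s)) 2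
      (P.vectorMeasure (P.proj (sublevel f n) x)) := fun n x =>
    memLp_conj (memLp_proj_sublevel hf n x)
  have hidem : ∀ n (x : H), P.proj (sublevel f n) (P.proj (sublevel f n) x) =
      P.proj (sublevel f n) x := fun n x => by
    rw [P.proj_proj_apply (hB n) (hB n), Set.inter_self]
  -- On a sublevel set of `|f|` the operator is bounded, so the adjoint relation can be tested
  -- against every vector `b`.
  have h1 : ∀ n, P.func (fun s => conj (f s)) (P.proj (sublevel f n) y) =
      P.proj (sublevel f n) z := by
    intro n
    refine ext_inner_right ℂ fun b => ?_
    rw [P.inner_proj_left (hB n), ← h _ (memLp_proj_sublevel hf n b)]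
    conv_rhs => rw [← hidem, ← proj_func (hB n) (memLp_proj_sublevel hf n b),
      ← P.inner_proj_left (hB n)]
    conv_lhs => rw [← hidem, ← proj_func (hB n) (hmem n y), P.inner_proj_left (hB n),
      inner_func_left (hmem n y) (hmem n b)]
    simp
  -- Monotone convergence over the sublevel sets bounds `∫ |f|² dμ_y` by `‖z‖²`, so `y` lies in the
  -- domain.
  have hy : MemLp (fun s => conj (f s)) 2 (P.vectorMeasure y) := by
    rw [memLp_two_iff_lintegral_lt_top hfc, ← setLIntegral_univ, ← iUnion_sublevel f,
      setLIntegral_iUnion_of_directed _ (monotone_sublevel f).directed_le]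
    refine lt_of_le_of_lt (iSup_le fun n => ?_) (ENNReal.pow_lt_top (n := 2) (enorm_lt_top (x := z)))
    rw [← vectorMeasure_proj (hB n), ← enorm_func_sq (hmem n y), h1,
      ← P.vectorMeasure_apply_eq_enorm (hB n), ← P.vectorMeasure_univ]
    exact measure_mono (Set.subset_univ _)
  refine ⟨hy, tendsto_nhds_unique (tendsto_proj_sublevel (P := P) hf _) ?_⟩
  simp only [proj_func (hB _) hy, h1]
  exact tendsto_proj_sublevel hf z

/-- `∫ f dP` is self-adjoint for a real function `f`. -/
theorem memLp_and_func_eq_of_symmetric {f : ℝ → ℝ} (hf : Measurable f) {y z : H}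
    (h : ∀ a, MemLp (fun s => (f s : ℂ)) 2 (P.vectorMeasure a) →
      ⟪y, P.func (fun s => (f s : ℂ)) a⟫ = ⟪z, a⟫) :
    MemLp (fun s => (f s : ℂ)) 2 (P.vectorMeasure y) ∧ P.func (fun s => (f s : ℂ)) y = z := by
  have := memLp_and_func_eq_of_adjoint (Complex.measurable_ofReal.comp hf) h
  simpa using! this

theorem inner_func_left_real {f : ℝ → ℝ} {x y : H}
    (hx : MemLp (fun s => (f s : ℂ)) 2 (P.vectorMeasure x))
    (hy : MemLp (fun s => (f s : ℂ)) 2 (P.vectorMeasure y)) :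
    ⟪P.func (fun s => (f s : ℂ)) x, y⟫ = ⟪x, P.func (fun s => (f s : ℂ)) y⟫ := by
  simpa using inner_func_left hx hy

section Intertwining

variable {P Q : SpectralMeasure H} {φ : ℝ → ℝ} {κ : ℂ →+* ℂ} {w : H ≃ₗᵢ[ℝ] H}

theorem vectorMeasure_intertwining (hφ : Measurable φ)
    (hw : ∀ B, MeasurableSet B → ∀ x, w (P.proj (φ ⁻¹' B) x) = Q.proj B (w x)) (x : H) :
    Q.vectorMeasure (w x) = (P.vectorMeasure x).map φ := by
  ext B hB
  rw [Measure.map_apply hφ hB, Q.vectorMeasure_apply_eq_enorm hB, ← hw B hB,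
    P.vectorMeasure_apply_eq_enorm (hφ hB), LinearIsometryEquiv.enorm_map]

theorem memLp_intertwining (hφ : Measurable φ)
    (hw : ∀ B, MeasurableSet B → ∀ x, w (P.proj (φ ⁻¹' B) x) = Q.proj B (w x)) {f : ℝ → ℂ}
    (hf : Measurable f) (x : H) :
    MemLp f 2 (Q.vectorMeasure (w x)) ↔ MemLp (fun s => f (φ s)) 2 (P.vectorMeasure x) := by
  rw [vectorMeasure_intertwining hφ hw,
    memLp_map_measure_iff hf.aestronglyMeasurable hφ.aemeasurable]
  rfl

/-- The endomorphism `κ` is either the identity or conjugation, so that unitary and antiunitary `w`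
are treated together. Combinations of indicators are covered by the hypothesis on projections; the
general case follows by `L²` approximation, because `κ` preserves norms and `w` is isometric. -/
theorem func_intertwining (hφ : Measurable φ)
    (hw : ∀ B, MeasurableSet B → ∀ x, w (P.proj (φ ⁻¹' B) x) = Q.proj B (w x))
    (hκ : ∀ z, κ (κ z) = z) (hκn : ∀ z, ‖κ z‖ = ‖z‖) (hκc : Continuous κ)
    (hwκ : ∀ c x, w (c • x) = κ c • w x) {f : ℝ → ℂ} (hf : Measurable f) {x : H}
    (hx : MemLp f 2 (Q.vectorMeasure (w x))) :
    Q.func f (w x) = w (P.func (fun s => κ (f (φ s))) x) := by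
  rw [← sub_eq_zero, ← norm_le_zero_iff]
  refine le_of_forall_pos_le_add fun ε hε => ?_
  obtain ⟨c, hc⟩ := Q.frame.exists_comb_approx hx (show 0 < ε / 2 by positivity)
  have h1 := SpectralFrame.norm_integralAt_sub_comb_le (F := Q.frame) (x := w x) le_rfl hx
    (by positivity) hc
  have hcm := Q.measurable_comb c
  have hxφ : MemLp (fun s => κ (f (φ s))) 2 (P.vectorMeasure x) := by
    refine ((memLp_intertwining hφ hw hf x).1 hx).congr_norm
      (hκc.measurable.comp (hf.comp hφ)).aestronglyMeasurable (ae_of_all _ fun s => ?_)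
    rw [hκn]
  have h2 : Q.frame.combOp c (w x) = w (P.func (fun s => κ (Q.frame.comb c (φ s))) x) ∧
      MemLp (fun s => κ (Q.frame.comb c (φ s))) 2 (P.vectorMeasure x) := by
    simp only [SpectralFrame.combOp, SpectralFrame.comb, Finsupp.sum, sum_apply,
      Finset.sum_apply, map_sum]
    induction c.support using Finset.induction_on with
    | empty =>
      simp only [Finset.sum_empty]
      exact ⟨by rw [show (fun _ : ℝ => (0 : ℂ)) = 0 from rfl, func_zero, map_zero], MemLp.zero⟩
    | insert A s hA ih =>
      have h4 : (fun s => κ ((c A • Q.frame.e A) (φ s))) =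
          κ (c A) • (φ ⁻¹' A.1).indicator (1 : ℝ → ℂ) := by
        ext t
        show κ (c A * A.1.indicator 1 (φ t)) = κ (c A) * _
        by_cases ht : φ t ∈ A.1
        · rw [Set.indicator_of_mem ht, Set.indicator_of_mem (show t ∈ φ ⁻¹' A.1 from ht)]
          simp
        · rw [Set.indicator_of_notMem ht, Set.indicator_of_notMem (show t ∉ φ ⁻¹' A.1 from ht)]
          simp
      have h3 : MemLp ((φ ⁻¹' A.1).indicator (1 : ℝ → ℂ)) 2 (P.vectorMeasure x) :=
        (memLp_const (1 : ℂ)).indicator (hφ A.2)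
      have h5 : (fun t => ∑ i ∈ insert A s, κ ((c i • Q.frame.e i) (φ t))) =
          κ (c A) • (φ ⁻¹' A.1).indicator (1 : ℝ → ℂ) +
            fun t => ∑ i ∈ s, κ ((c i • Q.frame.e i) (φ t)) := by
        rw [← h4]
        ext t
        rw [Finset.sum_insert hA]
        rfl
      rw [h5, Finset.sum_insert hA]
      refine ⟨?_, (h3.const_smul _).add ih.2⟩
      rw [func_add (h3.const_smul _) ih.2, ih.1, func_const_smul _ h3, map_add, hwκ, hκ,
        func_indicator (hφ A.2), hw _ A.2]
      rfl
  have h3 : ‖P.func (fun s => κ (f (φ s))) x - P.func (fun s => κ (Q.frame.comb c (φ s))) x‖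
      ≤ ε / 2 := by
    rw [← func_sub hxφ h2.2]
    have h4 := enorm_func (hxφ.sub h2.2)
    have h5 : eLpNorm ((fun s => κ (f (φ s))) - fun s => κ (Q.frame.comb c (φ s))) 2
        (P.vectorMeasure x) = eLpNorm (f - Q.frame.comb c) 2 (Q.vectorMeasure (w x)) := by
      rw [vectorMeasure_intertwining hφ hw,
        eLpNorm_map_measure (hf.sub hcm).aestronglyMeasurable hφ.aemeasurable]
      refine eLpNorm_congr_norm_ae (ae_of_all _ fun s => ?_)
      simp only [Pi.sub_apply, Function.comp_apply]
      rw [← map_sub, hκn]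
    rw [h5] at h4
    have h6 := h4.le.trans hc
    rw [← ofReal_norm] at h6
    exact (ENNReal.ofReal_le_ofReal_iff (by positivity)).1 h6
  have h4 : Q.func f (w x) - w (P.func (fun s => κ (f (φ s))) x) =
      (Q.frame.integralAt f (w x) - Q.frame.combOp c (w x)) -
        w (P.func (fun s => κ (f (φ s))) x - P.func (fun s => κ (Q.frame.comb c (φ s))) x) := by
    rw [h2.1, map_sub, func]; abel
  rw [h4]
  refine (norm_sub_le _ _).trans ?_
  rw [LinearIsometryEquiv.norm_map]
  linarith

/-- Covariance of the integrals of real functions under unitary and antiunitary operators. -/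
theorem func_intertwining_real (hφ : Measurable φ)
    (hw : ∀ B, MeasurableSet B → ∀ x, w (P.proj (φ ⁻¹' B) x) = Q.proj B (w x))
    (hwκ : w ∈ AU H) {f : ℝ → ℝ} (hf : Measurable f) {x : H}
    (hx : MemLp (fun s => (f s : ℂ)) 2 (Q.vectorMeasure (w x))) :
    Q.func (fun s => (f s : ℂ)) (w x) = w (P.func (fun s => (f (φ s) : ℂ)) x) := by
  have hf' : Measurable fun s => (f s : ℂ) := Complex.measurable_ofReal.comp hf
  rcases hwκ with h | h
  · exact func_intertwining (κ := RingHom.id ℂ) hφ hw (fun _ => rfl) (fun _ => rfl) continuous_id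
      h hf' hx
  · have := func_intertwining (κ := starRingEnd ℂ) hφ hw Complex.conj_conj RCLike.norm_conj
      Complex.continuous_conj h hf' hx
    simpa only [Complex.conj_ofReal] using this

end Intertwining

variable (P) in
/-- The image of a spectral measure under a Borel map. -/
def map (φ : ℝ → ℝ) (hφ : Measurable φ) : SpectralMeasure H where
  proj B := P.proj (φ ⁻¹' B)
  isStarProjection B hB := P.isStarProjection _ (hφ hB)
  empty := P.empty
  univ := P.univ
  inter A B hA hB := P.inter _ _ (hφ hA) (hφ hB)
  iUnion A hA hd x := by
    rw [Set.preimage_iUnion]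
    exact P.iUnion _ (fun n => hφ (hA n)) (fun i j hij => (hd hij).preimage φ) x

theorem vectorMeasure_map {φ : ℝ → ℝ} (hφ : Measurable φ) (x : H) :
    (P.map φ hφ).vectorMeasure x = (P.vectorMeasure x).map φ :=
  vectorMeasure_intertwining (w := LinearIsometryEquiv.refl ℝ H) hφ (fun _ _ _ => rfl) x

variable (P) in
/-- The conjugate of a spectral measure by a unitary operator. -/
def conjBy (w : H ≃ₗᵢ[ℂ] H) : SpectralMeasure H where
  proj B := (w.toContinuousLinearEquiv : H →L[ℂ] H) ∘L P.proj B ∘L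
    (w.symm.toContinuousLinearEquiv : H →L[ℂ] H)
  isStarProjection B hB := by
    refine ⟨?_, ?_⟩
    · ext x
      show w (P.proj B (w.symm (w (P.proj B (w.symm x))))) = w (P.proj B (w.symm x))
      rw [w.symm_apply_apply, P.proj_proj_apply hB hB, Set.inter_self]
    · rw [ContinuousLinearMap.isSelfAdjoint_iff_isSymmetric]
      intro x y
      show ⟪w (P.proj B (w.symm x)), y⟫ = ⟪x, w (P.proj B (w.symm y))⟫
      calc ⟪w (P.proj B (w.symm x)), y⟫
          = ⟪w (P.proj B (w.symm x)), w (w.symm y)⟫ := by rw [w.apply_symm_apply]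
        _ = ⟪w (w.symm x), w (P.proj B (w.symm y))⟫ := by
          rw [w.inner_map_map, w.inner_map_map, P.inner_proj_left hB]
        _ = ⟪x, w (P.proj B (w.symm y))⟫ := by rw [w.apply_symm_apply]
  empty := by ext x; show w (P.proj ∅ (w.symm x)) = 0; simp [P.empty]
  univ := by ext x; show w (P.proj Set.univ (w.symm x)) = x; simp [P.univ]
  inter A B hA hB := by
    ext x
    show w (P.proj (A ∩ B) (w.symm x)) = w (P.proj A (w.symm (w (P.proj B (w.symm x)))))
    rw [w.symm_apply_apply, P.proj_proj_apply hA hB]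
  iUnion A hA hd x :=
    (P.iUnion A hA hd (w.symm x)).mapL (w.toContinuousLinearEquiv : H →L[ℂ] H)

end SpectralMeasure

end SelfAdjoint

/-! ### Totality of characters and Stone's theorem -/

section Stone

open MeasureTheory Filter Topology

/-- The positive and negative parts of `h` are densities of finite measures with equal
characteristic functions. The measures coincide, hence so do the two parts, and they vanish because
their supports are disjoint. -/
theorem ae_eq_zero_of_integral_char_mul_real {ν : Measure ℝ} [IsFiniteMeasure ν] {h : ℝ → ℝ}
    (hh : Integrable h ν) (h0 : ∀ t : ℝ, ∫ s, Complex.exp (t * s * Complex.I) * (h s : ℂ) ∂ν = 0) :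
    h =ᵐ[ν] 0 := by
  wlog hm : Measurable h generalizing h
  · obtain ⟨g, hg, hgh⟩ := hh.1
    refine hgh.trans (this (hh.congr hgh) (fun t => ?_) hg.measurable)
    rw [← h0 t]
    refine integral_congr_ae ?_
    filter_upwards [hgh] with s hs
    rw [hs]
  have hint : ∀ g : ℝ → ℝ, Integrable g ν → ∀ t : ℝ,
      Integrable (fun s : ℝ => Complex.exp (t * s * Complex.I) * (g s : ℂ)) ν := by
    intro g hg t
    refine hg.ofReal.bdd_mul (c := 1) (Continuous.aestronglyMeasurable (by fun_prop))
      (ae_of_all _ fun s => ?_)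
    rw [← Complex.ofReal_mul, Complex.norm_exp_ofReal_mul_I]
  have hchar : ∀ g : ℝ → ℝ, Measurable g → ∀ t : ℝ,
      charFun (ν.withDensity fun s => ENNReal.ofReal (g s)) t =
        ∫ s, Complex.exp (t * s * Complex.I) * ((max (g s) 0 : ℝ) : ℂ) ∂ν := by
    intro g hg t
    rw [charFun_apply_real, integral_withDensity_eq_integral_toReal_smul (by fun_prop) (by simp)]
    refine integral_congr_ae (ae_of_all _ fun s => ?_)
    simp only [ENNReal.toReal_ofReal', Complex.real_smul]
    rw [mul_comm]
  have hfin : ∀ g : ℝ → ℝ, Integrable g ν →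
      IsFiniteMeasure (ν.withDensity fun s => ENNReal.ofReal (g s)) := fun g hg =>
    isFiniteMeasure_withDensity_ofReal hg.2
  have h1 := hfin h hh
  have h2 := hfin (-h) hh.neg
  have h3 : (ν.withDensity fun s => ENNReal.ofReal (h s)) =
      ν.withDensity fun s => ENNReal.ofReal ((-h) s) := by
    refine Measure.ext_of_charFun (funext fun t => ?_)
    rw [hchar h hm, hchar (-h) hm.neg, ← sub_eq_zero,
      ← integral_sub (hint _ hh.pos_part t) (hint _ hh.neg.pos_part t), ← h0 t]
    refine integral_congr_ae (ae_of_all _ fun s => ?_)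
    simp only [Pi.neg_apply]
    rw [← mul_sub, ← Complex.ofReal_sub]
    congr 2
    rcases le_total (h s) 0 with hs | hs
    · rw [max_eq_right hs, max_eq_left (neg_nonneg.2 hs)]; ring
    · rw [max_eq_left hs, max_eq_right (neg_nonpos.2 hs)]; ring
  rw [withDensity_eq_iff (by fun_prop) (by fun_prop) ?_] at h3
  · filter_upwards [h3] with s hs
    simp only [Pi.neg_apply, Pi.zero_apply] at hs ⊢
    rcases lt_trichotomy (h s) 0 with h4 | h4 | h4
    · rw [ENNReal.ofReal_of_nonpos h4.le, eq_comm, ENNReal.ofReal_eq_zero] at hs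
      linarith
    · exact h4
    · rw [ENNReal.ofReal_of_nonpos (neg_nonpos.2 h4.le), ENNReal.ofReal_eq_zero] at hs
      linarith
  · rw [← lt_top_iff_ne_top]
    exact hh.lintegral_lt_top

/-- The characters `s ↦ exp (i t s)` are total in `L¹(ν)` for a finite measure `ν`. -/
theorem ae_eq_zero_of_integral_char_mul {ν : Measure ℝ} [IsFiniteMeasure ν] {g : ℝ → ℂ}
    (hg : Integrable g ν) (h0 : ∀ t : ℝ, ∫ s, Complex.exp (t * s * Complex.I) * g s ∂ν = 0) :
    g =ᵐ[ν] 0 := by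
  have hexp : ∀ t s : ℝ, conj (Complex.exp (t * s * Complex.I)) =
      Complex.exp ((-t : ℝ) * s * Complex.I) := by
    intro t s
    rw [← Complex.exp_conj]
    simp
  have hint : ∀ f : ℝ → ℂ, Integrable f ν → ∀ t : ℝ,
      Integrable (fun s : ℝ => Complex.exp (t * s * Complex.I) * f s) ν := by
    intro f hf t
    refine hf.bdd_mul (c := 1) (Continuous.aestronglyMeasurable (by fun_prop))
      (ae_of_all _ fun s => ?_)
    rw [← Complex.ofReal_mul, Complex.norm_exp_ofReal_mul_I]
  -- Conjugating the hypothesis at `-t` shows that `conj g` satisfies it too, hence so do the real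
  -- and imaginary parts.
  have hconj : ∀ t : ℝ, ∫ s, Complex.exp (t * s * Complex.I) * conj (g s) ∂ν = 0 := by
    intro t
    have h := congrArg conj (h0 (-t))
    rw [← integral_conj, map_zero] at h
    rw [← h]
    refine integral_congr_ae (ae_of_all _ fun s => ?_)
    simp only [map_mul]
    rw [hexp, neg_neg]
  have hgc : Integrable (fun s => conj (g s)) ν :=
    Complex.conjCLE.toContinuousLinearMap.integrable_comp hg
  have hre := ae_eq_zero_of_integral_char_mul_real hg.re fun t => by
    have h := congrArg₂ (· + ·) (h0 t) (hconj t)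
    simp only [add_zero] at h
    rw [← integral_add (hint g hg t) (hint _ hgc t)] at h
    have h2 : ∀ s : ℝ, Complex.exp (t * s * Complex.I) * g s +
        Complex.exp (t * s * Complex.I) * conj (g s) =
        2 * (Complex.exp (t * s * Complex.I) * ((g s).re : ℂ)) := by
      intro s
      rw [← mul_add, Complex.add_conj]
      push_cast; ring
    simp only [h2] at h
    rw [integral_const_mul] at h
    simpa using h
  have him := ae_eq_zero_of_integral_char_mul_real hg.im fun t => by
    have h := congrArg₂ (· - ·) (h0 t) (hconj t)
    simp only [sub_zero] at h
    rw [← integral_sub (hint g hg t) (hint _ hgc t)] at h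
    have h2 : ∀ s : ℝ, Complex.exp (t * s * Complex.I) * g s -
        Complex.exp (t * s * Complex.I) * conj (g s) =
        (2 * Complex.I) * (Complex.exp (t * s * Complex.I) * ((g s).im : ℂ)) := by
      intro s
      rw [← mul_sub, Complex.sub_conj]
      push_cast; ring
    simp only [h2] at h
    rw [integral_const_mul] at h
    simpa using h
  filter_upwards [hre, him] with s h1 h2
  exact Complex.ext h1 h2

variable {H : Type*} [NormedAddCommGroup H] [InnerProductSpace ℂ H] [CompleteSpace H]

/-- The frame of characters attached to a strongly continuous unitary one-parameter group. -/
def unitaryFrame (u : ℝ → H →L[ℂ] H) (μ : H → Measure ℝ) (hμ : ∀ x, IsFiniteMeasure (μ x))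
    (hchar : ∀ x t, charFun (μ x) t = ⟪x, u t x⟫)
    (hu : ∀ r t x, ⟪u r x, u t x⟫ = ⟪x, u (t - r) x⟫) : SpectralFrame ℝ H where
  e t s := Complex.exp (t * s * Complex.I)
  op := u
  μ := μ
  isFinite := hμ
  memLp t ν _ := by
    refine MemLp.of_bound (Continuous.aestronglyMeasurable (by fun_prop)) 1 (ae_of_all _ fun s => ?_)
    rw [← Complex.ofReal_mul, Complex.norm_exp_ofReal_mul_I]
  total ν _ g hg h := by
    refine ae_eq_zero_of_integral_char_mul (hg.integrable one_le_two) fun t => ?_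
    rw [← h (-t)]
    refine integral_congr_ae (ae_of_all _ fun s => ?_)
    simp [← Complex.exp_conj]
  inner_op x r t := by
    rw [hu, ← hchar, charFun_apply_real]
    refine integral_congr_ae (ae_of_all _ fun s => ?_)
    simp only [← Complex.exp_conj, ← Complex.exp_add]
    congr 1
    simp
    ring

theorem SpectralFrame.memLp_indicator {ι H : Type*} [NormedAddCommGroup H] [InnerProductSpace ℂ H]
    (F : SpectralFrame ι H) {B : Set ℝ} (hB : MeasurableSet B) (x : H) :
    MemLp (B.indicator (1 : ℝ → ℂ)) 2 (F.μ x) := (memLp_const (1 : ℂ)).indicator hB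

namespace SpectralFrame

variable {ι : Type*} (F : SpectralFrame ι H)

theorem inner_integralAt_indicator {A B : Set ℝ} (hA : MeasurableSet A) (hB : MeasurableSet B)
    (x : H) : ⟪F.integralAt (A.indicator 1) x, F.integralAt (B.indicator 1) x⟫ =
      (((F.μ x).real (A ∩ B) : ℝ) : ℂ) := by
  rw [inner_integralAt (F.memLp_indicator hA x) (F.memLp_indicator hB x)]
  have : ∀ s, conj (A.indicator (1 : ℝ → ℂ) s) * B.indicator (1 : ℝ → ℂ) s =
      (A ∩ B).indicator (1 : ℝ → ℂ) s := by
    intro s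
    by_cases h1 : s ∈ A <;> by_cases h2 : s ∈ B <;> simp [h1, h2]
  simp only [this]
  rw [integral_indicator (hA.inter hB)]
  simp

theorem norm_integralAt_indicator {B : Set ℝ} (hB : MeasurableSet B) (x : H) :
    ‖F.integralAt (B.indicator 1) x‖ ^ 2 = (F.μ x).real B := by
  have h := F.inner_integralAt_indicator hB hB x
  rw [Set.inter_self, inner_self_eq_norm_sq_to_K] at h
  exact Complex.ofReal_injective (by simpa using h)

open Classical in
/-- The projections of the spectral measure of a frame. -/
def projOf (hone : ∀ x, F.integralAt 1 x = x) (B : Set ℝ) : H →L[ℂ] H :=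
  if hB : MeasurableSet B then
    LinearMap.mkContinuous
      { toFun := F.integralAt (B.indicator 1)
        map_add' := fun x y => integralAt_vector_add (F.memLp_indicator hB x)
          (F.memLp_indicator hB y) (F.memLp_indicator hB _)
        map_smul' := fun a x => integralAt_vector_smul a (F.memLp_indicator hB x)
          (F.memLp_indicator hB _) } 1 fun x => by
      have h1 := F.norm_integralAt_indicator hB x
      have h2 := F.norm_integralAt_indicator MeasurableSet.univ x
      rw [Set.indicator_univ, hone] at h2
      have h3 : (F.μ x).real B ≤ (F.μ x).real Set.univ := measureReal_mono (Set.subset_univ B)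
      rw [one_mul]
      rw [← h1, ← h2] at h3
      exact (sq_le_sq₀ (norm_nonneg _) (norm_nonneg _)).1 h3
  else 0

variable {F} {hone : ∀ x, F.integralAt 1 x = x}

theorem projOf_apply {B : Set ℝ} (hB : MeasurableSet B) (x : H) :
    F.projOf hone B x = F.integralAt (B.indicator 1) x := by
  rw [projOf, dif_pos hB]; rfl

theorem inner_projOf {B : Set ℝ} (hB : MeasurableSet B) (x : H) :
    ⟪x, F.projOf hone B x⟫ = (((F.μ x).real B : ℝ) : ℂ) := by
  have h := F.inner_integralAt_indicator MeasurableSet.univ hB x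
  rwa [Set.indicator_univ, hone, Set.univ_inter, ← projOf_apply (hone := hone) hB] at h

theorem inner_projOf_left {B : Set ℝ} (hB : MeasurableSet B) (x y : H) :
    ⟪F.projOf hone B x, y⟫ = ⟪x, F.projOf hone B y⟫ := by
  have h : (F.projOf hone B).adjoint = F.projOf hone B := by
    refine ContinuousLinearMap.coe_injective ((ext_inner_map _ _).1 fun x => ?_)
    show ⟪(F.projOf hone B).adjoint x, x⟫ = ⟪F.projOf hone B x, x⟫
    rw [ContinuousLinearMap.adjoint_inner_left, ← inner_conj_symm (F.projOf hone B x),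
      inner_projOf hB, Complex.conj_ofReal]
  rw [← ContinuousLinearMap.adjoint_inner_right, h]

/-- On a complex space an operator is determined by its quadratic form, and both forms equal `μ_x(A
∩ B)`. -/
theorem projOf_inter {A B : Set ℝ} (hA : MeasurableSet A) (hB : MeasurableSet B) :
    F.projOf hone (A ∩ B) = F.projOf hone A * F.projOf hone B := by
  refine ContinuousLinearMap.coe_injective ((ext_inner_map _ _).1 fun x => ?_)
  show ⟪F.projOf hone (A ∩ B) x, x⟫ = ⟪F.projOf hone A (F.projOf hone B x), x⟫
  rw [inner_projOf_left (hA.inter hB), inner_projOf_left hA, inner_projOf (hA.inter hB),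
    projOf_apply hA, projOf_apply hB, F.inner_integralAt_indicator hB hA, Set.inter_comm]

theorem projOf_union {A B : Set ℝ} (hA : MeasurableSet A) (hB : MeasurableSet B)
    (hd : Disjoint A B) (x : H) :
    F.projOf hone (A ∪ B) x = F.projOf hone A x + F.projOf hone B x := by
  rw [projOf_apply hA, projOf_apply hB, projOf_apply (hA.union hB),
    Set.indicator_union_of_disjoint hd, ← integralAt_add (F.memLp_indicator hA x)
      (F.memLp_indicator hB x)]
  rfl

theorem projOf_empty : F.projOf hone ∅ = 0 := by
  ext x
  have h := projOf_union (hone := hone) MeasurableSet.empty MeasurableSet.empty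
    (Set.disjoint_empty _) x
  rw [Set.union_empty] at h
  simpa using h

/-- The distance from a partial sum to the limit is the square root of `μ_x` of the part of the
union not yet covered. Strong countable additivity is thus countable additivity of `μ_x`. -/
theorem hasSum_projOf {A : ℕ → Set ℝ} (hA : ∀ n, MeasurableSet (A n))
    (hd : Pairwise (Function.onFun Disjoint A)) (x : H) :
    HasSum (fun n => F.projOf hone (A n) x) (F.projOf hone (⋃ n, A n) x) := by
  have hU := MeasurableSet.iUnion hA
  have h1 : HasSum (fun n => (F.μ x).real (A n)) ((F.μ x).real (⋃ n, A n)) := by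
    have h := ENNReal.hasSum_toReal (f := fun n => F.μ x (A n)) (by
      rw [← measure_iUnion hd hA]; exact measure_ne_top _ _)
    rwa [← ENNReal.tsum_toReal_eq (f := fun n => F.μ x (A n)) fun n => measure_ne_top _ _,
      ← measure_iUnion hd hA] at h
  have hfin : ∀ s : Finset ℕ, F.projOf hone (⋃ n ∈ s, A n) x = ∑ n ∈ s, F.projOf hone (A n) x ∧
      (F.μ x).real (⋃ n ∈ s, A n) = ∑ n ∈ s, (F.μ x).real (A n) := by
    intro s
    induction s using Finset.induction_on with
    | empty => simp [projOf_empty]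
    | insert n s hn ih =>
      have hm : MeasurableSet (⋃ k ∈ s, A k) := s.measurableSet_biUnion fun k _ => hA k
      have hdis : Disjoint (A n) (⋃ k ∈ s, A k) := by
        rw [Set.disjoint_iUnion₂_right]
        intro k hk
        exact hd (fun h => hn (h ▸ hk))
      rw [Finset.set_biUnion_insert, Finset.sum_insert hn, Finset.sum_insert hn,
        projOf_union (hA n) hm hdis, ih.1, measureReal_union hdis hm (measure_ne_top _ _) (measure_ne_top _ _), ih.2]
      exact ⟨rfl, rfl⟩
  have h2 : ∀ s : Finset ℕ, ‖∑ n ∈ s, F.projOf hone (A n) x - F.projOf hone (⋃ n, A n) x‖ =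
      Real.sqrt ((F.μ x).real (⋃ n, A n) - ∑ n ∈ s, (F.μ x).real (A n)) := by
    intro s
    have hm : MeasurableSet (⋃ k ∈ s, A k) := s.measurableSet_biUnion fun k _ => hA k
    have hsub : (⋃ k ∈ s, A k) ⊆ ⋃ n, A n := Set.iUnion₂_subset fun k _ => Set.subset_iUnion A k
    have h3 := projOf_union (hone := hone) hm (hU.diff hm) Set.disjoint_sdiff_right x
    have h4 := measureReal_union (μ := F.μ x) (Set.disjoint_sdiff_right (s := ⋃ k ∈ s, A k)
      (t := ⋃ n, A n)) (hU.diff hm) (measure_ne_top _ _) (measure_ne_top _ _)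
    rw [Set.union_sdiff_cancel hsub, (hfin s).1] at h3
    rw [Set.union_sdiff_cancel hsub, (hfin s).2] at h4
    rw [h3, h4, sub_add_cancel_left, norm_neg, add_sub_cancel_left, projOf_apply (hU.diff hm),
      ← F.norm_integralAt_indicator (hU.diff hm), Real.sqrt_sq (norm_nonneg _)]
  rw [HasSum, tendsto_iff_norm_sub_tendsto_zero]
  simp only [h2]
  have h3 : Tendsto (fun s : Finset ℕ => (F.μ x).real (⋃ n, A n) - ∑ n ∈ s, (F.μ x).real (A n))
      atTop (𝓝 0) := by
    have := (tendsto_const_nhds (x := (F.μ x).real (⋃ n, A n))).sub h1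
    simpa using this
  have h4 := (Real.continuous_sqrt.tendsto 0).comp h3
  simpa [Function.comp_def] using h4

variable (F) in
/-- The spectral measure of a frame. -/
def spectralMeasure (hone : ∀ x, F.integralAt 1 x = x) : SpectralMeasure H where
  proj := F.projOf hone
  isStarProjection B hB := by
    refine ⟨?_, ?_⟩
    · show _ * _ = _
      rw [← projOf_inter hB hB, Set.inter_self]
    · rw [ContinuousLinearMap.isSelfAdjoint_iff_isSymmetric]
      exact inner_projOf_left hB
  empty := projOf_empty
  univ := by
    ext x
    rw [projOf_apply MeasurableSet.univ, Set.indicator_univ, hone]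
    rfl
  inter A B := projOf_inter
  iUnion A := hasSum_projOf

theorem vectorMeasure_spectralMeasure (x : H) :
    (F.spectralMeasure hone).vectorMeasure x = F.μ x := by
  ext B hB
  rw [SpectralMeasure.vectorMeasure_apply _ _ hB]
  show ENNReal.ofReal (⟪x, F.projOf hone B x⟫).re = _
  rw [inner_projOf hB, Complex.ofReal_re, ofReal_measureReal]

end SpectralFrame

/-- **Stone's theorem**: a strongly continuous unitary one-parameter group has a spectral measure. -/
theorem exists_spectralMeasure_charFun (u : ℝ → H →L[ℂ] H) (h0 : u 0 = 1)
    (hu : ∀ r t x, ⟪u r x, u t x⟫ = ⟪x, u (t - r) x⟫) (hc : ∀ x, Continuous fun t => u t x) :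
    ∃ P : SpectralMeasure H, ∀ x t, charFun (P.vectorMeasure x) t = ⟪x, u t x⟫ := by
  choose μ hμ hchar using fun x => exists_finiteMeasure_charFun (hc x) (φ := fun t => ⟪x, u t x⟫)
    fun r t => hu r t x
  let F := unitaryFrame u μ hμ hchar hu
  -- The constant function is the character at `t = 0`, whose operator `u 0` is the identity.
  have hone : ∀ x, F.integralAt 1 x = x := by
    intro x
    have h1 := SpectralFrame.integralAt_e (F := F) 0 x
    have h2 : F.e 0 = 1 := by
      ext s
      show Complex.exp ((0 : ℝ) * s * Complex.I) = 1
      simp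
    rw [h2] at h1
    rw [h1]
    show u 0 x = x
    rw [h0]; rfl
  refine ⟨F.spectralMeasure hone, fun x t => ?_⟩
  rw [SpectralFrame.vectorMeasure_spectralMeasure]
  exact hchar x t

end Stone

/-! ### Spectral measures are determined by their operators and by their unitary groups -/

section SpectralUniqueness

open MeasureTheory Filter Topology

namespace SpectralMeasure

variable {H : Type*} [NormedAddCommGroup H] [InnerProductSpace ℂ H] [CompleteSpace H]
  {P Q : SpectralMeasure H}

theorem memLp_one {x : H} : MemLp (1 : ℝ → ℂ) 2 (P.vectorMeasure x) := memLp_const (1 : ℂ)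

theorem memLp_boundedContinuous (f : BoundedContinuousFunction ℝ ℂ) (x : H) :
    MemLp f 2 (P.vectorMeasure x) :=
  MemLp.of_bound f.continuous.aestronglyMeasurable ‖f‖ (ae_of_all _ f.norm_coe_le_norm)

variable (P Q) in
/-- The bounded continuous functions on which the functional calculi of two spectral measures
agree. -/
def eqFunc : StarSubalgebra ℂ (BoundedContinuousFunction ℝ ℂ) where
  carrier := {f | ∀ x, P.func f x = Q.func f x}
  mul_mem' {f g} hf hg x := by
    have hP := func_func (P := P) g.continuous.measurable f.continuous.measurable
      (memLp_boundedContinuous g x) (memLp_boundedContinuous (f * g) x)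
    have hQ := func_func (P := Q) g.continuous.measurable f.continuous.measurable
      (memLp_boundedContinuous g x) (memLp_boundedContinuous (f * g) x)
    exact hP.symm.trans ((by rw [hg x, hf]) : _ = Q.func f (Q.func g x)) |>.trans hQ
  add_mem' {f g} hf hg x :=
    (func_add (memLp_boundedContinuous f x) (memLp_boundedContinuous g x)).trans
      (((congrArg₂ (· + ·) (hf x) (hg x))).trans
        (func_add (memLp_boundedContinuous f x) (memLp_boundedContinuous g x)).symm)
  algebraMap_mem' c x := by
    have h : ((algebraMap ℂ (BoundedContinuousFunction ℝ ℂ) c : BoundedContinuousFunction ℝ ℂ) :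
        ℝ → ℂ) = c • (1 : ℝ → ℂ) := by
      ext s; simp
    rw [h, func_const_smul c memLp_one, func_const_smul c memLp_one,
      func_one, func_one]
  star_mem' {f} hf x := by
    refine ext_inner_right ℂ fun y => ?_
    have hP := inner_func_left (P := P) (memLp_boundedContinuous (star f) x)
      (memLp_boundedContinuous (star f) y)
    have hQ := inner_func_left (P := Q) (memLp_boundedContinuous (star f) x)
      (memLp_boundedContinuous (star f) y)
    have h : (fun s => conj ((star f : BoundedContinuousFunction ℝ ℂ) s)) = f := by
      ext s; simp
    rw [h] at hP hQ
    rw [hP, hQ, hf y]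

/-- The resolvent function `s ↦ (s + i)⁻¹`. -/
def resolventFun : BoundedContinuousFunction ℝ ℂ :=
  BoundedContinuousFunction.ofNormedAddCommGroup (fun s : ℝ => ((s : ℂ) + Complex.I)⁻¹)
    (by
      refine Continuous.inv₀ (by fun_prop) fun s h => ?_
      simpa using congrArg Complex.im h) 1 (by
      intro s
      rw [norm_inv]
      refine inv_le_one_of_one_le₀ ?_
      simpa using Complex.abs_im_le_norm ((s : ℂ) + Complex.I))

theorem resolventFun_apply (s : ℝ) : resolventFun s = ((s : ℂ) + Complex.I)⁻¹ := rfl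

theorem add_I_ne_zero (s : ℝ) : (s : ℂ) + Complex.I ≠ 0 := fun h => by
  simpa using congrArg Complex.im h

/-- Since `s (s + i)⁻¹ = 1 - i (s + i)⁻¹` is bounded, the resolvent maps into the domain of `A = ∫ s
dP` and is a right inverse of `A + i`. -/
theorem func_resolventFun (x : H) :
    MemLp (fun s : ℝ => (s : ℂ)) 2 (P.vectorMeasure (P.func resolventFun x)) ∧
      P.func (fun s : ℝ => (s : ℂ)) (P.func resolventFun x) =
        x - Complex.I • P.func resolventFun x := by
  have hr := memLp_boundedContinuous (P := P) resolventFun x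
  have h1 : ((fun s : ℝ => (s : ℂ)) * (resolventFun : ℝ → ℂ)) = 1 - Complex.I • (resolventFun : ℝ → ℂ) := by
    ext s
    simp only [Pi.mul_apply, Pi.sub_apply, Pi.one_apply, Pi.smul_apply, smul_eq_mul,
      resolventFun_apply]
    have := add_I_ne_zero s
    field_simp
    ring
  have h2 : MemLp ((fun s : ℝ => (s : ℂ)) * (resolventFun : ℝ → ℂ)) 2 (P.vectorMeasure x) := by
    rw [h1]; exact memLp_one.sub (hr.const_smul _)
  have hm := resolventFun.continuous.measurable
  refine ⟨(memLp_vectorMeasure_func hm Complex.measurable_ofReal hr).2 h2, ?_⟩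
  rw [func_func hm Complex.measurable_ofReal hr h2, h1,
    func_sub memLp_one (hr.const_smul _), func_const_smul _ hr]
  congr 1
  exact func_one x

/-- `A + i` is injective: `⟪z, A z⟫` is real, yet it would equal `-i ‖z‖²`. -/
theorem eq_zero_of_func_eq_neg_I_smul {z : H}
    (hz : MemLp (fun s : ℝ => (s : ℂ)) 2 (P.vectorMeasure z))
    (h : P.func (fun s : ℝ => (s : ℂ)) z = -(Complex.I • z)) : z = 0 := by
  have h1 := inner_self_func hz
  rw [h, inner_neg_right, inner_smul_right, inner_self_eq_norm_sq_to_K, integral_complex_ofReal]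
    at h1
  have h2 := congrArg Complex.im h1
  have h3 : (-(Complex.I * ((‖z‖ : ℝ) : ℂ) ^ 2)).im = 0 := h2.trans (Complex.ofReal_im _)
  rw [← Complex.ofReal_pow, Complex.neg_im, Complex.I_mul_im, Complex.ofReal_re] at h3
  simpa using h3

/-- A spectral measure is determined by its self-adjoint operator `∫ s dP(s)`. -/
theorem vectorMeasure_eq_of_integral_eq
    (h : P.integral (fun s : ℝ => (s : ℂ)) = Q.integral fun s : ℝ => (s : ℂ)) (x : H) :
    P.vectorMeasure x = Q.vectorMeasure x := by
  have hdom : ∀ z, MemLp (fun s : ℝ => (s : ℂ)) 2 (P.vectorMeasure z) ↔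
      MemLp (fun s : ℝ => (s : ℂ)) 2 (Q.vectorMeasure z) := fun z => by
    rw [← mem_integral_domain, ← mem_integral_domain, h]
  have hval : ∀ z, MemLp (fun s : ℝ => (s : ℂ)) 2 (P.vectorMeasure z) →
      P.func (fun s : ℝ => (s : ℂ)) z = Q.func (fun s : ℝ => (s : ℂ)) z := fun z hz =>
    (LinearPMap.ext_iff.1 h).2 (x := z) (hf := hz) (hg := (hdom z).1 hz)
  -- Both resolvents are right inverses of the same injective operator `A + i`.
  have hr : resolventFun ∈ eqFunc P Q := by
    intro y
    obtain ⟨hP1, hP2⟩ := func_resolventFun (P := P) y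
    obtain ⟨hQ1, hQ2⟩ := func_resolventFun (P := Q) y
    rw [← hdom] at hQ1
    rw [← hval _ hQ1] at hQ2
    have hQ1' := memLp_vector_smul (-1) hQ1
    have h1 : P.func resolventFun y + (-1 : ℂ) • Q.func resolventFun y = 0 := by
      refine eq_zero_of_func_eq_neg_I_smul (memLp_vector_add hP1 hQ1') ?_
      rw [func_vector_add hP1 hQ1', func_vector_smul _ hQ1, hP2, hQ2]
      module
    rwa [neg_one_smul, ← sub_eq_add_neg, sub_eq_zero] at h1
  -- The functions on which the two calculi agree form a star algebra. It contains the resolvent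
  -- function, which is injective on `ℝ`, so it separates points and determines finite measures.
  refine ext_of_forall_mem_subalgebra_integral_eq_of_pseudoEMetric_complete_countable
    (A := eqFunc P Q) (𝕜 := ℂ) ?_ fun f hf => ?_
  · intro a b hab
    refine ⟨_, ⟨_, ⟨resolventFun, hr, rfl⟩, rfl⟩, fun h => hab ?_⟩
    have h' : ((a : ℂ) + Complex.I)⁻¹ = ((b : ℂ) + Complex.I)⁻¹ := h
    exact_mod_cast add_right_cancel (inv_injective h')
  · rw [← inner_self_func (memLp_boundedContinuous f x),
      ← inner_self_func (memLp_boundedContinuous f x), hf x]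

theorem memLp_iff_of_vectorMeasure_eq (h : ∀ x, P.vectorMeasure x = Q.vectorMeasure x)
    {f : ℝ → ℂ} {x : H} : MemLp f 2 (P.vectorMeasure x) ↔ MemLp f 2 (Q.vectorMeasure x) := by
  rw [h]

/-- The measures only record norms of projected vectors, but that suffices: `P(φ⁻¹ A) y = 0` forces
`Q(A) w y = 0`. Applying this to both components of `x` along `φ⁻¹ B` and its complement identifies
`Q(B) w x`; the complex behaviour of `w` plays no role. -/
theorem intertwining_of_vectorMeasure {φ : ℝ → ℝ} (hφ : Measurable φ) {w : H ≃ₗᵢ[ℝ] H}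
    (h : ∀ x, Q.vectorMeasure (w x) = (P.vectorMeasure x).map φ) (B : Set ℝ)
    (hB : MeasurableSet B) (x : H) : w (P.proj (φ ⁻¹' B) x) = Q.proj B (w x) := by
  have hzero : ∀ A, MeasurableSet A → ∀ y, P.proj (φ ⁻¹' A) y = 0 → Q.proj A (w y) = 0 := by
    intro A hA y hy
    have h1 := congrArg (fun ν => ν A) (h y)
    simp only [Measure.map_apply hφ hA, Q.vectorMeasure_apply_eq_enorm hA,
      P.vectorMeasure_apply_eq_enorm (hφ hA), hy] at h1
    simpa using h1
  have h1 : Q.proj B (w (P.proj (φ ⁻¹' B) x)) = w (P.proj (φ ⁻¹' B) x) := by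
    have h2 := proj_add_proj_compl (P := Q) hB (w (P.proj (φ ⁻¹' B) x))
    rwa [hzero _ hB.compl, add_zero] at h2
    rw [P.proj_proj_apply (hφ hB.compl) (hφ hB), Set.preimage_compl, Set.compl_inter_self, P.empty]
    rfl
  have h2 : Q.proj B (w (P.proj (φ ⁻¹' B)ᶜ x)) = 0 := by
    refine hzero _ hB _ ?_
    rw [P.proj_proj_apply (hφ hB) (hφ hB).compl, Set.inter_compl_self, P.empty]
    rfl
  conv_rhs => rw [← proj_add_proj_compl (P := P) (hφ hB) x, map_add, map_add, h1, h2, add_zero]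

theorem func_eq_of_vectorMeasure_eq (h : ∀ x, P.vectorMeasure x = Q.vectorMeasure x) {f : ℝ → ℝ}
    (hf : Measurable f) {x : H} (hx : MemLp (fun s => (f s : ℂ)) 2 (P.vectorMeasure x)) :
    P.func (fun s => (f s : ℂ)) x = Q.func (fun s => (f s : ℂ)) x := by
  have h1 := func_intertwining_real (P := Q) (Q := P) (w := LinearIsometryEquiv.refl ℝ H)
    measurable_id (intertwining_of_vectorMeasure measurable_id fun x => by
      rw [Measure.map_id]; exact h x) (Or.inl fun _ _ => rfl) hf hx
  exact h1

theorem ae_pos_of_proj_Iic_eq_zero (hP : P.proj (Set.Iic 0) = 0) (x : H) :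
    ∀ᵐ s ∂(P.vectorMeasure x), 0 < s := by
  have h : P.vectorMeasure x (Set.Iic 0) = 0 := by
    rw [P.vectorMeasure_apply_eq_enorm measurableSet_Iic, hP]
    simp
  have h2 : {s : ℝ | ¬ 0 < s} = Set.Iic 0 := by ext s; simp
  rw [ae_iff, h2, h]

end SpectralMeasure

/-- The exponent of the modular group. -/
theorem cpow_modular_eq {s : ℝ} (hs : 0 < s) (t : ℝ) :
    (s : ℂ) ^ (-(Complex.I * t) / (2 * Real.pi)) =
      Complex.exp (t * (-Real.log s / (2 * Real.pi) : ℝ) * Complex.I) := by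
  rw [Complex.cpow_def_of_ne_zero (by exact_mod_cast hs.ne'), ← Complex.ofReal_log hs.le]
  congr 1
  push_cast
  ring

/-- A finite measure on the positive half line is determined by its Mellin transform on the
imaginary axis. -/
theorem ext_of_integral_cpow {ν ν' : Measure ℝ} [IsFiniteMeasure ν] [IsFiniteMeasure ν']
    (hν : ∀ᵐ s ∂ν, 0 < s) (hν' : ∀ᵐ s ∂ν', 0 < s)
    (h : ∀ t : ℝ, ∫ s, (s : ℂ) ^ (-(Complex.I * t) / (2 * Real.pi)) ∂ν =
      ∫ s, (s : ℂ) ^ (-(Complex.I * t) / (2 * Real.pi)) ∂ν') : ν = ν' := by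
  -- In the coordinate `L`, with inverse `E` on the positive half line, the imaginary power is the
  -- character `exp (i t L)`, so uniqueness of characteristic functions applies.
  let L : ℝ → ℝ := fun s => -Real.log s / (2 * Real.pi)
  have hL : Measurable L := by fun_prop
  let E : ℝ → ℝ := fun s => Real.exp (-(2 * Real.pi) * s)
  have hE : Measurable E := by fun_prop
  have hEL : ∀ s, 0 < s → E (L s) = s := by
    intro s hs
    simp only [E, L]
    rw [show -(2 * Real.pi) * (-Real.log s / (2 * Real.pi)) = Real.log s by field_simp,
      Real.exp_log hs]
  have hchar : ∀ (μ : Measure ℝ), (∀ᵐ s ∂μ, 0 < s) → ∀ t, charFun (μ.map L) t =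
      ∫ s, (s : ℂ) ^ (-(Complex.I * t) / (2 * Real.pi)) ∂μ := by
    intro μ hμ t
    rw [charFun_apply_real, integral_map hL.aemeasurable
      (Continuous.aestronglyMeasurable (by fun_prop))]
    refine integral_congr_ae (hμ.mono fun s hs => ?_)
    exact (cpow_modular_eq hs t).symm
  have hmap : ∀ (μ : Measure ℝ), (∀ᵐ s ∂μ, 0 < s) → (μ.map L).map E = μ := by
    intro μ hμ
    rw [Measure.map_map hE hL, Measure.map_congr (hμ.mono hEL : E ∘ L =ᵐ[μ] id), Measure.map_id]
  rw [← hmap ν hν, ← hmap ν' hν']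
  congr 1
  exact Measure.ext_of_charFun (funext fun t => by rw [hchar ν hν, hchar ν' hν', h])

end SpectralUniqueness

/-! ### From a modular pair to a standard subspace and its modular objects -/

section BGL

open MeasureTheory Filter Topology


variable {H : Type*} [NormedAddCommGroup H] [InnerProductSpace ℂ H]

/-- The norm determines the real part of the inner product. Replacing `y` by `i y` gives the
imaginary part, with the sign reversed by antilinearity. -/
theorem IsAntiunitaryIsometry.inner_map_map {J : H ≃ₗᵢ[ℝ] H} (hJ : IsAntiunitaryIsometry J)
    (x y : H) : ⟪J x, J y⟫ = ⟪y, x⟫ := by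
  have hre : ∀ a b : H, (⟪J a, J b⟫).re = (⟪a, b⟫).re := by
    intro a b
    have h1 := norm_add_sq (𝕜 := ℂ) (J a) (J b)
    have h2 := norm_add_sq (𝕜 := ℂ) a b
    rw [← map_add, J.norm_map, J.norm_map, J.norm_map] at h1
    have h3 : RCLike.re (⟪J a, J b⟫) = RCLike.re (⟪a, b⟫) := by linarith
    exact h3
  refine Complex.ext ?_ ?_
  · rw [hre, ← inner_conj_symm x y, Complex.conj_re]
  · have h1 := hre x (Complex.I • y)
    rw [hJ, inner_smul_right, inner_smul_right, Complex.conj_I] at h1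
    simp at h1
    rw [h1, ← inner_conj_symm x y, Complex.conj_im]
    simp

variable [CompleteSpace H]

/-- The square root as a complex function. -/
abbrev sqrtFun : ℝ → ℂ := fun s => (Real.sqrt s : ℂ)

theorem measurable_sqrtFun : Measurable sqrtFun :=
  Complex.measurable_ofReal.comp Real.continuous_sqrt.measurable

/-- A spectral measure `P` on the positive half line and an antiunitary involution `J` with
`J P(B) J = P(B⁻¹)`. -/
structure IsModularPair (P : SpectralMeasure H) (J : H ≃ₗᵢ[ℝ] H) : Prop where
  proj_Iic : P.proj (Set.Iic 0) = 0
  antiunitary : IsAntiunitaryIsometry J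
  involutive : ∀ x, J (J x) = x
  intertwining : ∀ B, MeasurableSet B → ∀ x, J (P.proj (Inv.inv ⁻¹' B) x) = P.proj B (J x)

/-- `V` is the space of fixed points of `J ∘ ∫ √s dP(s)`. -/
def IsFixedSpace (P : SpectralMeasure H) (J : H ≃ₗᵢ[ℝ] H) (V : StandardSubspace H) : Prop :=
  ∀ x, x ∈ V.toClosedSubmodule ↔
    MemLp sqrtFun 2 (P.vectorMeasure x) ∧ J (P.func sqrtFun x) = x

namespace IsModularPair

open SpectralMeasure

variable {P : SpectralMeasure H} {J : H ≃ₗᵢ[ℝ] H} (h : IsModularPair P J)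
include h

theorem ae_pos (x : H) : ∀ᵐ s ∂(P.vectorMeasure x), 0 < s :=
  ae_pos_of_proj_Iic_eq_zero h.proj_Iic x

/-- The operator `S = J Δ^{1/2}` is an involution of its domain, because `J Δ^{1/2} J = Δ^{-1/2}`.
-/
theorem fix_mem {x : H} (hx : MemLp sqrtFun 2 (P.vectorMeasure x)) :
    MemLp sqrtFun 2 (P.vectorMeasure (J (P.func sqrtFun x))) ∧
      J (P.func sqrtFun (J (P.func sqrtFun x))) = x := by
  have hm : Measurable fun s : ℝ => sqrtFun s⁻¹ := measurable_sqrtFun.comp measurable_inv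
  have h1 : ((fun s : ℝ => sqrtFun s⁻¹) * sqrtFun) =ᵐ[P.vectorMeasure x] 1 := by
    filter_upwards [h.ae_pos x] with s hs
    simp only [Pi.mul_apply, Pi.one_apply]
    rw [← Complex.ofReal_mul, Real.sqrt_inv, inv_mul_cancel₀ (Real.sqrt_pos.2 hs).ne', Complex.ofReal_one]
  have h2 : MemLp ((fun s : ℝ => sqrtFun s⁻¹) * sqrtFun) 2 (P.vectorMeasure x) :=
    (memLp_congr_ae h1).2 memLp_one
  have h3 : MemLp sqrtFun 2 (P.vectorMeasure (J (P.func sqrtFun x))) := by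
    rw [memLp_intertwining measurable_inv h.intertwining measurable_sqrtFun,
      memLp_vectorMeasure_func measurable_sqrtFun hm hx]
    exact h2
  refine ⟨h3, ?_⟩
  rw [func_intertwining_real measurable_inv h.intertwining (Or.inr h.antiunitary)
    Real.continuous_sqrt.measurable h3, h.involutive,
    func_func measurable_sqrtFun hm hx h2, func_congr h1, func_one]

theorem fix_smul (c : ℂ) {x : H} (hx : MemLp sqrtFun 2 (P.vectorMeasure x)) :
    J (P.func sqrtFun (c • x)) = conj c • J (P.func sqrtFun x) := by
  rw [func_vector_smul c hx, h.antiunitary]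

omit h in
theorem fix_add {x y : H} (hx : MemLp sqrtFun 2 (P.vectorMeasure x))
    (hy : MemLp sqrtFun 2 (P.vectorMeasure y)) :
    J (P.func sqrtFun (x + y)) = J (P.func sqrtFun x) + J (P.func sqrtFun y) := by
  rw [func_vector_add hx hy, map_add]

/-- Decomposition of a vector in the domain of `J ∘ ∫ √s dP(s)` into fixed vectors. -/
theorem exists_fix_decomp {x : H} (hx : MemLp sqrtFun 2 (P.vectorMeasure x)) : ∃ v w : H,
    (MemLp sqrtFun 2 (P.vectorMeasure v) ∧ J (P.func sqrtFun v) = v) ∧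
    (MemLp sqrtFun 2 (P.vectorMeasure w) ∧ J (P.func sqrtFun w) = w) ∧
    x = v + Complex.I • w := by
  obtain ⟨h1, h2⟩ := h.fix_mem hx
  set y := J (P.func sqrtFun x) with hy
  have h3 := memLp_vector_smul (P := P) (-1) h1
  have h4 := memLp_vector_add hx h1
  have h5 := memLp_vector_add hx h3
  -- With `y = S x`, the components are `v = (x + S x)/2` and `w = (x - S x)/(2i)`.
  refine ⟨(1 / 2 : ℂ) • (x + y), (-Complex.I / 2 : ℂ) • (x + (-1 : ℂ) • y),
    ⟨memLp_vector_smul _ h4, ?_⟩, ⟨memLp_vector_smul _ h5, ?_⟩, ?_⟩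
  · rw [h.fix_smul _ h4, fix_add hx h1, ← hy, h2, add_comm y x]
    simp only [map_div₀, map_one, map_ofNat]
  · rw [h.fix_smul _ h5, fix_add hx h3, h.fix_smul _ h1, ← hy, h2]
    simp only [map_div₀, map_neg, Complex.conj_I, map_ofNat, map_one]
    module
  · rw [smul_smul, smul_add, smul_add, smul_smul]
    have h6 : Complex.I * (-Complex.I / 2) = 1 / 2 := by
      rw [mul_div_assoc', mul_neg, Complex.I_mul_I]; simp
    rw [h6]
    module

/-- The fixed points of `J ∘ ∫ √s dP(s)` form a standard subspace. -/
theorem exists_isFixedSpace : ∃ V : StandardSubspace H, IsFixedSpace P J V := by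
  have hreal : ∀ (a : ℝ) (x : H), a • x = (a : ℂ) • x := fun a x => (Complex.coe_smul a x).symm
  let S : Submodule ℝ H :=
    { carrier := {x | MemLp sqrtFun 2 (P.vectorMeasure x) ∧ J (P.func sqrtFun x) = x}
      zero_mem' := by
        refine ⟨(P.integral sqrtFun).domain.zero_mem, ?_⟩
        have := (P.integral sqrtFun).map_zero
        exact (congrArg J this).trans (map_zero J)
      add_mem' := fun {x y} hx hy => ⟨memLp_vector_add hx.1 hy.1, by
        rw [fix_add hx.1 hy.1, hx.2, hy.2]⟩
      smul_mem' := fun a x hx => by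
        rw [hreal]
        exact ⟨memLp_vector_smul _ hx.1, by rw [h.fix_smul _ hx.1, hx.2, Complex.conj_ofReal]⟩ }
  have hS : ∀ x, x ∈ S ↔ MemLp sqrtFun 2 (P.vectorMeasure x) ∧ J (P.func sqrtFun x) = x :=
    fun x => Iff.rfl
  -- For fixed vectors `Δ^{1/2} x n = J (x n)`, which converges along with `x n`; self-adjointness
  -- of `Δ^{1/2}` lets the equation pass to the limit.
  have hclosed : IsClosed (S : Set H) := by
    refine IsSeqClosed.isClosed fun x y hx hxy => ?_
    have h1 : ∀ n, P.func sqrtFun (x n) = J (x n) := fun n => by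
      conv_rhs => rw [← ((hS _).1 (hx n)).2, h.involutive]
    obtain ⟨h2, h3⟩ := memLp_and_func_eq_of_symmetric (P := P) Real.continuous_sqrt.measurable
      (y := y) (z := J y) fun a ha => by
        have h4 : Tendsto (fun n => ⟪x n, P.func sqrtFun a⟫) atTop (𝓝 ⟪y, P.func sqrtFun a⟫) :=
          hxy.inner tendsto_const_nhds
        have h5 : Tendsto (fun n => ⟪J (x n), a⟫) atTop (𝓝 ⟪J y, a⟫) :=
          ((J.continuous.tendsto y).comp hxy).inner tendsto_const_nhds
        refine tendsto_nhds_unique h4 (h5.congr fun n => ?_)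
        rw [← h1, inner_func_left_real ((hS _).1 (hx n)).1 ha]
    refine (hS y).2 ⟨h2, ?_⟩
    rw [h3, h.involutive]
  let K : ClosedSubmodule ℝ H := ⟨S, hclosed⟩
  have hmulI : ∀ x, x ∈ K.mulI ↔ -(Complex.I • x) ∈ S := by
    intro x
    rw [ClosedSubmodule.mem_mapEquiv_iff, scalarSMulCLE_symm_apply, Units.smul_def]
    simp only [Units.val_inv_eq_inv_val, Complex.val_UnitI, Complex.inv_I, neg_smul]
    exact Iff.rfl
  refine ⟨⟨K, ?_, ?_⟩, fun x => Iff.rfl⟩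
  · refine SetLike.ext fun x => ?_
    rw [ClosedSubmodule.mem_bot]
    constructor
    · rintro ⟨hx1, hx2⟩
      have hx1' := (hS x).1 hx1
      have hx2' := (hS _).1 ((hmulI x).1 hx2)
      have h3 := hx2'.2
      rw [← neg_smul, h.fix_smul _ hx1'.1, hx1'.2, map_neg, Complex.conj_I, neg_neg] at h3
      have h4 : (2 * Complex.I) • x = 0 := by
        rw [mul_smul, two_smul]
        nth_rewrite 1 [h3]
        simp
      exact (smul_eq_zero.1 h4).resolve_left (by simp)
    · rintro rfl
      exact ⟨S.zero_mem, (hmulI 0).2 (by simp)⟩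
  -- Spectral cutoffs of `x` lie in the domain of `S`, hence split into fixed vectors, and they
  -- converge to `x`.
  · refine eq_top_iff.2 fun x _ => ?_
    refine (K ⊔ K.mulI).isClosed.mem_of_tendsto (tendsto_proj_sublevel (P := P)
      measurable_sqrtFun x) (Eventually.of_forall fun n => ?_)
    obtain ⟨v, w, hv, hw, hvw⟩ := h.exists_fix_decomp (memLp_proj_sublevel (P := P)
      measurable_sqrtFun n x)
    rw [hvw]
    refine (K ⊔ K.mulI).toSubmodule.add_mem ?_ ?_
    · exact (le_sup_left : K ≤ K ⊔ K.mulI) hv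
    · refine (le_sup_right : K.mulI ≤ K ⊔ K.mulI) ((hmulI _).2 ?_)
      rw [smul_smul, Complex.I_mul_I, neg_one_smul, neg_neg]
      exact hw

theorem memLp_sqrtFun_of_memLp {x : H} (hx : MemLp (fun s : ℝ => (s : ℂ)) 2 (P.vectorMeasure x)) :
    MemLp sqrtFun 2 (P.vectorMeasure x) := by
  refine (memLp_one.add hx).mono measurable_sqrtFun.aestronglyMeasurable ?_
  filter_upwards [h.ae_pos x] with s hs
  simp only [Pi.add_apply, Pi.one_apply]
  rw [← Complex.ofReal_one, ← Complex.ofReal_add, Complex.norm_real, Complex.norm_real,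
    Real.norm_of_nonneg (Real.sqrt_nonneg s), Real.norm_of_nonneg (by positivity)]
  nlinarith [Real.sq_sqrt hs.le, Real.sqrt_nonneg s, sq_nonneg (Real.sqrt s - 1)]

variable {V : StandardSubspace H} (hV : IsFixedSpace P J V)
include hV

theorem mem_tomita_domain (x : H) :
    x ∈ V.tomita.domain ↔ MemLp sqrtFun 2 (P.vectorMeasure x) := by
  constructor
  · rintro ⟨⟨v, w⟩, hv, hw, rfl⟩
    exact memLp_vector_add ((hV _).1 hv).1 (memLp_vector_smul _ ((hV _).1 hw).1)
  · intro hx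
    obtain ⟨v, w, hv, hw, rfl⟩ := h.exists_fix_decomp hx
    exact ⟨(v, w), (hV v).2 hv, (hV w).2 hw, rfl⟩

theorem tomita_eq (x : V.tomita.domain) : V.tomita x = J (P.func sqrtFun x) := by
  obtain ⟨x, hx⟩ := x
  have hx' := hx
  obtain ⟨⟨v, w⟩, hv, hw, rfl⟩ := hx'
  refine (V.tomita_apply hv hw hx).trans ?_
  have hv' := (hV _).1 hv
  have hw' := (hV _).1 hw
  show _ = J (P.func sqrtFun (v + Complex.I • w))
  rw [fix_add hv'.1 (memLp_vector_smul _ hw'.1), h.fix_smul _ hw'.1, hv'.2, hw'.2,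
    Complex.conj_I, neg_smul, sub_eq_add_neg]

/-- Since `J` is antiunitary it cancels in `⟪S a, S x⟫ = ⟪Δ^{1/2} x, Δ^{1/2} a⟫`. Self-adjointness
of `Δ^{1/2}` turns the adjoint condition into `Δ^{1/2} Δ^{1/2} x = z` with the exact domain, and the
product is `Δ`, as the spectrum is positive almost everywhere. -/
theorem isModularSpectralMeasure : V.IsModularSpectralMeasure P := by
  have hsq : ∀ x, (sqrtFun * sqrtFun) =ᵐ[P.vectorMeasure x] fun s : ℝ => (s : ℂ) := by
    intro x
    filter_upwards [h.ae_pos x] with s hs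
    simp only [Pi.mul_apply]
    rw [← Complex.ofReal_mul, Real.mul_self_sqrt hs.le]
  have hgraph : V.modularOperator = P.integral fun s : ℝ => (s : ℂ) := by
    refine LinearPMap.eq_of_eq_graph (Submodule.ext fun p => ?_)
    obtain ⟨x, z⟩ := p
    rw [V.graph_modularOperator]
    have hinner : ∀ (hx : x ∈ V.tomita.domain) (a : V.tomita.domain),
        ⟪V.tomita a, V.tomita ⟨x, hx⟩⟫ = ⟪P.func sqrtFun x, P.func sqrtFun a⟫ := fun hx a => by
      rw [h.tomita_eq hV, h.tomita_eq hV, h.antiunitary.inner_map_map]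
    have hleft : (x, z) ∈ V.modularGraph ↔ ∃ hx : x ∈ V.tomita.domain, ∀ a : V.tomita.domain,
      ⟪P.func sqrtFun x, P.func sqrtFun a⟫ = ⟪z, (a : H)⟫ :=
      exists_congr fun hx => forall_congr' fun a => by rw [← hinner hx a]
    have hright : (x, z) ∈ (P.integral fun s : ℝ => (s : ℂ)).graph ↔
        MemLp (fun s : ℝ => (s : ℂ)) 2 (P.vectorMeasure x) ∧
          P.func (fun s : ℝ => (s : ℂ)) x = z := by
      rw [LinearPMap.mem_graph_iff]
      constructor
      · rintro ⟨y, rfl, rfl⟩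
        exact ⟨y.2, rfl⟩
      · rintro ⟨h1, rfl⟩
        exact ⟨⟨x, h1⟩, rfl, rfl⟩
    rw [hleft, hright]
    constructor
    · rintro ⟨hx, ha⟩
      have hx' := (h.mem_tomita_domain hV x).1 hx
      obtain ⟨h1, h2⟩ := memLp_and_func_eq_of_symmetric (P := P) Real.continuous_sqrt.measurable
        (y := P.func sqrtFun x) (z := z) fun a ha' =>
          ha ⟨a, (h.mem_tomita_domain hV a).2 ha'⟩
      rw [memLp_vectorMeasure_func measurable_sqrtFun measurable_sqrtFun hx'] at h1
      rw [func_func measurable_sqrtFun measurable_sqrtFun hx' h1, func_congr (hsq x)] at h2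
      exact ⟨(memLp_congr_ae (hsq x)).1 h1, h2⟩
    · rintro ⟨hx, rfl⟩
      have hx' := h.memLp_sqrtFun_of_memLp hx
      refine ⟨(h.mem_tomita_domain hV x).2 hx', fun a => ?_⟩
      have h1 := (memLp_congr_ae (hsq x)).2 hx
      rw [← inner_func_left_real
        ((memLp_vectorMeasure_func measurable_sqrtFun measurable_sqrtFun hx').2 h1)
        ((h.mem_tomita_domain hV a).1 a.2),
        func_func measurable_sqrtFun measurable_sqrtFun hx' h1, func_congr (hsq x)]
  show P.IsIntegral _ _
  rw [hgraph]
  exact isIntegral_integral Complex.measurable_ofReal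

theorem isModularConjugation (hJ : J ∈ AU H) : V.IsModularConjugation ⟨J, hJ⟩ :=
  ⟨h.antiunitary, P, P.integral sqrtFun, h.isModularSpectralMeasure hV,
    isIntegral_integral measurable_sqrtFun,
    Submodule.ext fun x => h.mem_tomita_domain hV x, fun x y hxy => by
      rw [h.tomita_eq hV, hxy]; rfl⟩

end IsModularPair

end BGL

/-! ### From a standard subspace to its modular objects -/

section ModularTheory

open MeasureTheory Filter Topology SpectralMeasure

variable {H : Type*} [NormedAddCommGroup H] [InnerProductSpace ℂ H]

/-- A unitary element of the real isometry group as a complex linear isometry. -/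
def IsUnitaryIsometry.toComplex {f : H ≃ₗᵢ[ℝ] H} (hf : IsUnitaryIsometry f) : H ≃ₗᵢ[ℂ] H where
  toFun := f
  invFun := f.symm
  left_inv := f.symm_apply_apply
  right_inv := f.apply_symm_apply
  map_add' := map_add f
  map_smul' := hf
  norm_map' := f.norm_map

theorem IsUnitaryIsometry.inner_map_map {f : H ≃ₗᵢ[ℝ] H} (hf : IsUnitaryIsometry f) (x y : H) :
    ⟪f x, f y⟫ = ⟪x, y⟫ := hf.toComplex.inner_map_map x y

theorem AU_map_mul_apply {G : Type*} [Group G] (u : G →* AU H) (a b : G) (x : H) :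
    (u (a * b)).1 x = (u a).1 ((u b).1 x) := by
  rw [map_mul]; rfl

theorem AU_map_one_apply {G : Type*} [Group G] (u : G →* AU H) (x : H) : (u 1).1 x = x := by
  rw [map_one]; rfl

/-- The exponential function as a map into the units of `ℝ`. -/
abbrev expUnit (t : ℝ) : ℝˣ := Units.mk0 (Real.exp t) (Real.exp_ne_zero t)

theorem expUnit_add (s t : ℝ) : expUnit (s + t) = expUnit s * expUnit t :=
  Units.ext (Real.exp_add s t)

theorem expUnit_zero : expUnit 0 = 1 := Units.ext Real.exp_zero

theorem expUnit_neg (t : ℝ) : expUnit (-t) = (expUnit t)⁻¹ := by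
  rw [eq_inv_iff_mul_eq_one, ← expUnit_add, neg_add_cancel, expUnit_zero]

theorem continuous_expUnit : Continuous expUnit := by
  rw [Units.continuous_iff]
  refine ⟨Real.continuous_exp, ?_⟩
  have : (fun t => ((expUnit t)⁻¹ : ℝˣ).val) = fun t => Real.exp (-t) := by
    ext t; rw [← expUnit_neg]; rfl
  exact this ▸ (by fun_prop : Continuous fun t : ℝ => Real.exp (-t))

theorem StandardSubspace.mem_smul_iff (f : AU H) (V : StandardSubspace H) (x : H) :
    x ∈ (f • V).toClosedSubmodule ↔ f.1.symm x ∈ V.toClosedSubmodule :=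
  ClosedSubmodule.mem_mapEquiv_iff f.1.toContinuousLinearEquiv V.toClosedSubmodule x

/-- The equation `v - i w = v + i w` forces `w = 0`. Through this description the polar
decomposition of the Tomita operator recovers the subspace. -/
theorem StandardSubspace.mem_iff_tomita_eq (V : StandardSubspace H) (x : H) :
    x ∈ V.toClosedSubmodule ↔ ∃ hx : x ∈ V.tomita.domain, V.tomita ⟨x, hx⟩ = x := by
  have h0 : (0 : H) ∈ V.toClosedSubmodule := V.toClosedSubmodule.toSubmodule.zero_mem
  constructor
  · intro hx
    have h1 : x + Complex.I • (0 : H) = x := by simp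
    have h2 : x + Complex.I • (0 : H) ∈ V.tomita.domain := ⟨(x, 0), hx, h0, rfl⟩
    have h3 := V.tomita_apply hx h0 h2
    simp only [smul_zero, add_zero, sub_zero] at h2 h3
    exact ⟨h2, h3⟩
  · rintro ⟨hx, h⟩
    have hx' := hx
    obtain ⟨⟨v, w⟩, hv, hw, rfl⟩ := hx'
    have h1 := (V.tomita_apply hv hw hx).symm.trans h
    have h2 : (2 * Complex.I) • w = 0 := by
      rw [mul_smul, two_smul]
      nth_rewrite 1 [show Complex.I • w = v - (v - Complex.I • w) by abel, h1]
      abel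
    rw [(smul_eq_zero.1 h2).resolve_left (by simp), smul_zero, add_zero]
    exact hv

theorem StandardSubspace.eq_zero_of_tomita_eq_zero (V : StandardSubspace H) {x : H}
    (hx : x ∈ V.tomita.domain) (h : V.tomita ⟨x, hx⟩ = 0) : x = 0 := by
  have h0 : (0 : H) ∈ V.toClosedSubmodule := V.toClosedSubmodule.toSubmodule.zero_mem
  have hx' := hx
  obtain ⟨⟨v, w⟩, hv, hw, rfl⟩ := hx'
  have h1 := (V.tomita_apply hv hw hx).symm.trans h
  obtain ⟨rfl, h3⟩ := V.decomp_unique hv (V.toClosedSubmodule.toSubmodule.neg_mem hw) h0 h0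
    (by rw [smul_neg, ← sub_eq_add_neg, h1]; simp)
  rw [neg_eq_zero.1 h3]
  simp

variable [CompleteSpace H] {P Q : SpectralMeasure H} {V : StandardSubspace H}

/-- On the range of `P([-n, 0])` the form `⟪Δ x, x⟫` is at most zero, yet it equals `‖S x‖²`. As `S`
is injective, these ranges vanish, and they exhaust that of `P((-∞, 0])`. -/
theorem StandardSubspace.IsModularSpectralMeasure.proj_Iic (hP : V.IsModularSpectralMeasure P) :
    P.proj (Set.Iic 0) = 0 := by
  have hΔ : V.modularOperator = P.integral fun s : ℝ => (s : ℂ) :=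
    IsIntegral.eq_integral Complex.measurable_ofReal hP
  ext b
  have hB : ∀ n : ℕ, MeasurableSet (Set.Icc (-(n : ℝ)) 0) := fun n => measurableSet_Icc
  have hzero : ∀ n : ℕ, P.proj (Set.Icc (-(n : ℝ)) 0) b = 0 := by
    intro n
    set x := P.proj (Set.Icc (-(n : ℝ)) 0) b with hxdef
    have hx : MemLp (fun s : ℝ => (s : ℂ)) 2 (P.vectorMeasure x) :=
      memLp_proj_of_bounded Complex.measurable_ofReal (hB n) (C := n) (fun s hs => by
        rw [Complex.norm_real, Real.norm_eq_abs, abs_le]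
        exact ⟨hs.1, hs.2.trans n.cast_nonneg⟩) b
    have h1 : (x, P.func (fun s : ℝ => (s : ℂ)) x) ∈ V.modularGraph := by
      rw [← V.graph_modularOperator, hΔ, LinearPMap.mem_graph_iff]
      exact ⟨⟨x, hx⟩, rfl, rfl⟩
    obtain ⟨hxS, h2⟩ := h1
    have h3 := h2 ⟨x, hxS⟩
    refine V.eq_zero_of_tomita_eq_zero hxS ?_
    have h4 : (⟪P.func (fun s : ℝ => (s : ℂ)) x, x⟫).re ≤ 0 := by
      rw [← inner_conj_symm, Complex.conj_re, inner_self_func hx, integral_complex_ofReal,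
        Complex.ofReal_re, hxdef, vectorMeasure_proj (hB n)]
      exact setIntegral_nonpos (hB n) fun s hs => hs.2
    have h5 := (congrArg Complex.re h3).trans_le h4
    have h6 : ‖V.tomita ⟨x, hxS⟩‖ ^ 2 ≤ 0 := by
      rwa [← inner_self_eq_norm_sq (𝕜 := ℂ)]
    exact norm_eq_zero.1 (pow_eq_zero_iff two_ne_zero |>.1 (le_antisymm h6 (sq_nonneg _)))
  have hU : Set.Iic (0 : ℝ) = ⋃ n : ℕ, Set.Icc (-(n : ℝ)) 0 := by
    ext s
    simp only [Set.mem_Iic, Set.mem_iUnion, Set.mem_Icc]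
    constructor
    · intro hs
      obtain ⟨n, hn⟩ := exists_nat_ge (-s)
      exact ⟨n, by linarith, hs⟩
    · rintro ⟨n, hn⟩
      exact hn.2
  have h5 : P.vectorMeasure b (Set.Iic 0) = 0 := by
    rw [hU]
    refine measure_iUnion_null fun n => ?_
    rw [P.vectorMeasure_apply_eq_enorm (hB n), hzero n]
    simp
  rw [P.vectorMeasure_apply_eq_enorm measurableSet_Iic] at h5
  simpa using h5

theorem isFixedSpace_congr (h : ∀ x, P.vectorMeasure x = Q.vectorMeasure x) {J : H ≃ₗᵢ[ℝ] H}
    (hV : IsFixedSpace P J V) : IsFixedSpace Q J V := fun x => by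
  rw [hV x, ← memLp_iff_of_vectorMeasure_eq h]
  refine and_congr_right fun hx => ?_
  rw [func_eq_of_vectorMeasure_eq h Real.continuous_sqrt.measurable hx]

theorem StandardSubspace.IsModularSpectralMeasure.vectorMeasure_eq
    (hP : V.IsModularSpectralMeasure P) (hQ : V.IsModularSpectralMeasure Q) (x : H) :
    P.vectorMeasure x = Q.vectorMeasure x :=
  vectorMeasure_eq_of_integral_eq ((IsIntegral.eq_integral Complex.measurable_ofReal hP).symm.trans
    (IsIntegral.eq_integral Complex.measurable_ofReal hQ)) x

/-- The square root of a strictly positive operator has dense range. -/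
theorem ext_of_comp_func_sqrtFun (hP : P.proj (Set.Iic 0) = 0) {J J' : H ≃ₗᵢ[ℝ] H}
    (h : ∀ x, MemLp sqrtFun 2 (P.vectorMeasure x) →
      J (P.func sqrtFun x) = J' (P.func sqrtFun x)) : J = J' := by
  ext b
  -- Vectors cut off to where `s^{-1/2}` is bounded are of the form `Δ^{1/2} g(P) z`, and they
  -- approximate every vector.
  let g : ℝ → ℂ := fun s => (sqrtFun s)⁻¹
  have hg : Measurable g := measurable_sqrtFun.inv
  have h1 : ∀ n, J (P.proj (sublevel g n) b) = J' (P.proj (sublevel g n) b) := by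
    intro n
    set z := P.proj (sublevel g n) b
    have hz : MemLp g 2 (P.vectorMeasure z) := memLp_proj_sublevel hg n b
    have hae : (sqrtFun * g) =ᵐ[P.vectorMeasure z] 1 := by
      filter_upwards [ae_pos_of_proj_Iic_eq_zero hP z] with s hs
      exact mul_inv_cancel₀ (Complex.ofReal_ne_zero.2 (Real.sqrt_pos.2 hs).ne')
    have hmem : MemLp (sqrtFun * g) 2 (P.vectorMeasure z) := (memLp_congr_ae hae).2 memLp_one
    have h2 := h (P.func g z) ((memLp_vectorMeasure_func hg measurable_sqrtFun hz).2 hmem)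
    rwa [func_func hg measurable_sqrtFun hz hmem, func_congr hae, func_one] at h2
  have h2 := tendsto_proj_sublevel (P := P) hg b
  exact tendsto_nhds_unique (((J.continuous.tendsto b).comp h2).congr h1)
    ((J'.continuous.tendsto b).comp h2)

namespace StandardSubspace

/-- The polar decomposition of the Tomita operator in terms of the functional calculus. -/
theorem IsModularConjugation.exists_polar {J : AU H} (hJ : V.IsModularConjugation J) :
    ∃ P : SpectralMeasure H, V.IsModularSpectralMeasure P ∧
      (∀ x, x ∈ V.tomita.domain ↔ MemLp sqrtFun 2 (P.vectorMeasure x)) ∧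
      ∀ x : V.tomita.domain, V.tomita x = J.1 (P.func sqrtFun x) := by
  obtain ⟨-, P, T, hP, hT, hdom, hval⟩ := hJ
  obtain rfl := IsIntegral.eq_integral measurable_sqrtFun hT
  have hmem : ∀ x, x ∈ V.tomita.domain ↔ MemLp sqrtFun 2 (P.vectorMeasure x) := fun x => by
    rw [hdom, mem_integral_domain]
  exact ⟨P, hP, hmem, fun x => hval x ⟨x, (hmem x).1 x.2⟩ rfl⟩

theorem IsModularConjugation.exists_isFixedSpace {J : AU H} (hJ : V.IsModularConjugation J) :
    ∃ P : SpectralMeasure H, V.IsModularSpectralMeasure P ∧ IsFixedSpace P J.1 V := by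
  obtain ⟨P, hP, hmem, hval⟩ := hJ.exists_polar
  refine ⟨P, hP, fun x => ?_⟩
  rw [V.mem_iff_tomita_eq, ← hmem]
  constructor
  · rintro ⟨hx, h⟩
    exact ⟨hx, (hval ⟨x, hx⟩).symm.trans h⟩
  · rintro ⟨hx, h⟩
    exact ⟨hx, (hval ⟨x, hx⟩).trans h⟩

/-- The spectral measures of the two polar decompositions have the same vector measures, so both
involve the same `Δ^{1/2}`, whose range is dense. -/
theorem IsModularConjugation.unique {J J' : AU H} (hJ : V.IsModularConjugation J)
    (hJ' : V.IsModularConjugation J') : J = J' := by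
  obtain ⟨P, hP, hmem, hval⟩ := hJ.exists_polar
  obtain ⟨P', hP', -, hval'⟩ := hJ'.exists_polar
  refine Subtype.ext (ext_of_comp_func_sqrtFun hP.proj_Iic fun x hx => ?_)
  have h1 := (hval ⟨x, (hmem x).2 hx⟩).symm.trans (hval' ⟨x, (hmem x).2 hx⟩)
  rwa [← func_eq_of_vectorMeasure_eq (hP.vectorMeasure_eq hP') Real.continuous_sqrt.measurable hx]
    at h1

end StandardSubspace

end ModularTheory

/-! ### Standard subspaces and representations of `ℝˣ` -/

section ModularRepresentation

open MeasureTheory Filter Topology SpectralMeasure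

variable {H : Type*} [NormedAddCommGroup H] [InnerProductSpace ℂ H] [CompleteSpace H]

/-- `P` is the spectral measure of a strictly positive operator `Δ` with
`u(e^t) = Δ^{-it/2π}`. -/
structure IsGenerator (P : SpectralMeasure H) (u : ℝˣ →* AU H) : Prop where
  proj_Iic : P.proj (Set.Iic 0) = 0
  unitary : ∀ t, IsUnitaryIsometry (u (expUnit t)).1
  inner_eq : ∀ t x, ⟪x, (u (expUnit t)).1 x⟫ =
    ∫ s, (s : ℂ) ^ (-(Complex.I * t) / (2 * Real.pi)) ∂(P.vectorMeasure x)

theorem cpow_modular_inv {s : ℝ} (hs : 0 < s) (t : ℝ) :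
    ((s⁻¹ : ℝ) : ℂ) ^ (-(Complex.I * t) / (2 * Real.pi)) =
      (s : ℂ) ^ (-(Complex.I * (-t : ℝ)) / (2 * Real.pi)) := by
  rw [cpow_modular_eq (inv_pos.2 hs), cpow_modular_eq hs, Real.log_inv]
  congr 1
  push_cast
  ring

theorem measurable_cpow_modular (t : ℝ) :
    Measurable fun s : ℝ => (s : ℂ) ^ (-(Complex.I * t) / (2 * Real.pi)) := by
  fun_prop

namespace IsGenerator

variable {P Q : SpectralMeasure H} {u : ℝˣ →* AU H}

theorem ae_pos (hP : IsGenerator P u) (x : H) : ∀ᵐ s ∂(P.vectorMeasure x), 0 < s :=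
  ae_pos_of_proj_Iic_eq_zero hP.proj_Iic x

theorem vectorMeasure_eq (hP : IsGenerator P u) (hQ : IsGenerator Q u) (x : H) :
    P.vectorMeasure x = Q.vectorMeasure x :=
  ext_of_integral_cpow (hP.ae_pos x) (hQ.ae_pos x) fun t => by rw [← hP.inner_eq, ← hQ.inner_eq]

theorem integral_map_inv (hP : IsGenerator P u) (x : H) (t : ℝ) :
    ∫ s, (s : ℂ) ^ (-(Complex.I * t) / (2 * Real.pi)) ∂((P.vectorMeasure x).map Inv.inv) =
      ⟪x, (u (expUnit (-t))).1 x⟫ := by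
  rw [hP.inner_eq, integral_map measurable_inv.aemeasurable
    (measurable_cpow_modular t).aestronglyMeasurable]
  exact integral_congr_ae ((hP.ae_pos x).mono fun s hs => cpow_modular_inv hs t)

theorem map_inv (hP : IsGenerator P u) :
    IsGenerator (P.map Inv.inv measurable_inv) (invHom u) where
  proj_Iic := by
    show P.proj (Inv.inv ⁻¹' Set.Iic 0) = 0
    rw [← hP.proj_Iic]
    congr 1
    ext s
    simp
  unitary t := by
    show IsUnitaryIsometry (u (expUnit t)⁻¹).1
    rw [← expUnit_neg]
    exact hP.unitary _
  inner_eq t x := by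
    rw [vectorMeasure_map, hP.integral_map_inv, expUnit_neg]
    rfl

/-- As `ℝˣ` is abelian, `J` commutes with `u(e^t)`, and antiunitarity gives `⟪J x, u(e^t) J x⟫ = ⟪x,
u(e^{-t}) x⟫`. Hence the measure of `J x` is the image of that of `x` under inversion. -/
theorem isModularPair (hP : IsGenerator P u) (hJ : IsAntiunitaryIsometry (u (-1)).1) :
    IsModularPair P (u (-1)).1 where
  proj_Iic := hP.proj_Iic
  antiunitary := hJ
  involutive x := by
    rw [← AU_map_mul_apply, neg_one_mul, neg_neg, AU_map_one_apply]
  intertwining := by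
    refine fun B hB x => intertwining_of_vectorMeasure measurable_inv (fun x => ?_) B hB x
    refine ext_of_integral_cpow (hP.ae_pos _) ?_ fun t => ?_
    · rw [ae_map_iff measurable_inv.aemeasurable measurableSet_Ioi]
      exact (hP.ae_pos x).mono fun s hs => inv_pos.2 hs
    · rw [← hP.inner_eq, hP.integral_map_inv, ← AU_map_mul_apply, mul_comm, AU_map_mul_apply,
        hJ.inner_map_map, ← (hP.unitary (-t)).inner_map_map, ← AU_map_mul_apply, expUnit_neg,
        inv_mul_cancel, AU_map_one_apply]

/-- Stone's theorem: the positive part of a strongly continuous representation of `ℝˣ` has a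
generator. -/
theorem exists_isGenerator (hu : ∀ t, IsUnitaryIsometry (u (expUnit t)).1)
    (hc : ∀ x, Continuous fun r => (u r).1 x) : ∃ P : SpectralMeasure H, IsGenerator P u := by
  obtain ⟨E, hE⟩ := exists_spectralMeasure_charFun
    (fun t => ((hu t).toComplex.toContinuousLinearEquiv : H →L[ℂ] H))
    (by
      ext x
      show (u (expUnit 0)).1 x = x
      rw [expUnit_zero, AU_map_one_apply])
    (fun r t x => by
      show ⟪(u (expUnit r)).1 x, (u (expUnit t)).1 x⟫ = ⟪x, (u (expUnit (t - r))).1 x⟫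
      rw [← (hu r).inner_map_map x, ← AU_map_mul_apply, ← expUnit_add, add_sub_cancel])
    (fun x => (hc x).comp continuous_expUnit)
  -- The substitution `s = exp (-2πr)` turns `s^{-it/2π}` into Stone's character `exp (itr)` and has
  -- positive values only.
  have hφ : Measurable fun r : ℝ => Real.exp (-(2 * Real.pi) * r) := by fun_prop
  refine ⟨E.map _ hφ, ?_, hu, fun t x => ?_⟩
  · show E.proj (_ ⁻¹' Set.Iic 0) = 0
    rw [← E.empty]
    congr 1
    ext r
    simp [Real.exp_pos]
  · rw [vectorMeasure_map, integral_map hφ.aemeasurable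
      (measurable_cpow_modular t).aestronglyMeasurable]
    have h1 : ⟪x, (u (expUnit t)).1 x⟫ = charFun (E.vectorMeasure x) t := (hE x t).symm
    rw [h1, charFun_apply_real]
    congr 1
    ext r
    rw [cpow_modular_eq (Real.exp_pos _), Real.log_exp]
    congr 3
    have := Real.pi_ne_zero
    push_cast
    field_simp

end IsGenerator

/-- This is `V' = J V`. If `⟪x, v⟫` is real for all `v` in `V`, then `⟪J x, Δ^{1/2} v⟫ = ⟪J x, J v⟫
= ⟪x, v⟫`. This extends linearly to `V + iV`, the domain of `Δ^{1/2}`, so self-adjointness gives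
`Δ^{1/2} J x = x`, that is, `J x` is fixed by `J Δ^{1/2}`. -/
theorem IsModularPair.mem_symplComp {P : SpectralMeasure H} {J : H ≃ₗᵢ[ℝ] H}
    (h : IsModularPair P J) {V : StandardSubspace H} (hV : IsFixedSpace P J V) (x : H) :
    x ∈ V.symplComp.toClosedSubmodule ↔ J x ∈ V.toClosedSubmodule := by
  have hfix : ∀ v ∈ V.toClosedSubmodule, MemLp sqrtFun 2 (P.vectorMeasure v) ∧
      P.func sqrtFun v = J v := fun v hv =>
    ⟨((hV v).1 hv).1, by rw [← h.involutive (P.func sqrtFun v), ((hV v).1 hv).2]⟩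
  refine (ClosedSubmodule.mem_symplComp_iff (S := V.toClosedSubmodule)).trans ⟨fun hx => ?_, ?_⟩
  · have hsymm : ∀ v ∈ V.toClosedSubmodule, ⟪J x, P.func sqrtFun v⟫ = ⟪x, v⟫ := fun v hv => by
      rw [(hfix v hv).2, h.antiunitary.inner_map_map, ← inner_conj_symm x v]
      exact (Complex.conj_eq_iff_im.2 (hx v hv)).symm
    obtain ⟨h1, h2⟩ := memLp_and_func_eq_of_symmetric (P := P) Real.continuous_sqrt.measurable
      (y := J x) (z := x) fun a ha => by
        obtain ⟨v, w, hv, hw, rfl⟩ := h.exists_fix_decomp ha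
        rw [func_vector_add hv.1 (memLp_vector_smul _ hw.1), func_vector_smul _ hw.1,
          inner_add_right, inner_add_right, inner_smul_right, inner_smul_right,
          hsymm v ((hV v).2 hv), hsymm w ((hV w).2 hw)]
    exact (hV _).2 ⟨h1, by rw [h2]⟩
  · intro hx v hv
    have h1 : ⟪v, x⟫ = ⟪x, v⟫ := by
      conv_lhs => rw [← h.involutive x, ← ((hV v).1 hv).2]
      rw [h.antiunitary.inner_map_map, ← inner_func_left_real (hfix _ hx).1 (hfix v hv).1,
        (hfix _ hx).2, h.involutive]
    rw [← inner_conj_symm] at h1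
    exact Complex.conj_eq_iff_im.1 (by rw [inner_conj_symm, ← h1, inner_conj_symm])

namespace StandardSubspace

variable {V W : StandardSubspace H} {u : ℝˣ →* AU H}

/-- This replaces the unbounded operators `S` and `S* S` by the functional calculus of one generator
of `u`; every later statement on modular representations goes through it. -/
theorem isModularRep_iff : V.IsModularRep u ↔ IsAntiunitaryIsometry (u (-1)).1 ∧
    ∃ P : SpectralMeasure H, IsGenerator P u ∧ IsFixedSpace P (u (-1)).1 V := by
  constructor
  · rintro ⟨h1, P, hP, h2⟩
    obtain ⟨Q, hQ, hV⟩ := h1.exists_isFixedSpace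
    exact ⟨h1.1, P, ⟨hP.proj_Iic, fun t => (h2 t).1, fun t => (h2 t).2⟩,
      isFixedSpace_congr (hQ.vectorMeasure_eq hP) hV⟩
  · rintro ⟨hJ, P, hP, hV⟩
    have h := hP.isModularPair hJ
    exact ⟨h.isModularConjugation hV (u (-1)).2, P, h.isModularSpectralMeasure hV,
      fun t => ⟨hP.unitary t, hP.inner_eq t⟩⟩

theorem IsModularRep.unique (hV : V.IsModularRep u) (hW : W.IsModularRep u) : V = W := by
  obtain ⟨-, P, hP, hPV⟩ := isModularRep_iff.1 hV
  obtain ⟨-, Q, hQ, hQW⟩ := isModularRep_iff.1 hW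
  refine StandardSubspace.ext (SetLike.ext fun x => ?_)
  rw [hQW x]
  exact isFixedSpace_congr (hP.vectorMeasure_eq hQ) hPV x

/-- The Brunetti-Guido-Longo construction. -/
theorem exists_isModularRep (hJ : IsAntiunitaryIsometry (u (-1)).1)
    (hu : ∀ t, IsUnitaryIsometry (u (expUnit t)).1) (hc : ∀ x, Continuous fun r => (u r).1 x) :
    ∃ V : StandardSubspace H, V.IsModularRep u := by
  obtain ⟨P, hP⟩ := IsGenerator.exists_isGenerator hu hc
  obtain ⟨V, hV⟩ := (hP.isModularPair hJ).exists_isFixedSpace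
  exact ⟨V, isModularRep_iff.2 ⟨hJ, P, hP, hV⟩⟩

/-- All data are transported by the unitary `f`: the generator becomes `f P f⁻¹`, and the fixed
space of the conjugated operator is the image of the fixed space. -/
theorem IsModularRep.smul (hV : V.IsModularRep u) {f : AU H} (hf : IsUnitaryIsometry f.1) :
    (f • V).IsModularRep (conjHom f u) := by
  obtain ⟨hJ, P, hP, hPV⟩ := isModularRep_iff.1 hV
  have hsymm : IsUnitaryIsometry f.1.symm := fun c x => hf.toComplex.symm.map_smul c x
  have hconj : ∀ r x, (conjHom f u r).1 x = f.1 ((u r).1 (f.1.symm x)) := fun _ _ => rfl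
  have hw : ∀ B, MeasurableSet B → ∀ x, f.1 (P.proj (id ⁻¹' B) x) =
      (P.conjBy hf.toComplex).proj B (f.1 x) := fun B _ x => by
    show _ = f.1 (P.proj B (f.1.symm (f.1 x)))
    rw [f.1.symm_apply_apply]
    rfl
  have hvec : ∀ x, (P.conjBy hf.toComplex).vectorMeasure x =
      P.vectorMeasure (f.1.symm x) := fun x => by
    have := vectorMeasure_intertwining measurable_id hw (f.1.symm x)
    rwa [f.1.apply_symm_apply, Measure.map_id] at this
  refine isModularRep_iff.2 ⟨fun c x => ?_, P.conjBy hf.toComplex, ⟨?_, fun t c x => ?_,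
    fun t x => ?_⟩, fun x => ?_⟩
  · rw [hconj, hconj, hsymm, hJ, hf]
  · ext x
    show f.1 (P.proj (Set.Iic 0) (f.1.symm x)) = 0
    rw [hP.proj_Iic]
    exact map_zero _
  · rw [hconj, hconj, hsymm, hP.unitary, hf]
  · rw [hvec, ← hP.inner_eq, hconj, ← hf.inner_map_map (f.1.symm x), f.1.apply_symm_apply]
  · rw [mem_smul_iff, hPV, hvec]
    refine and_congr_right fun hx => ?_
    have h1 : MemLp sqrtFun 2 ((P.conjBy hf.toComplex).vectorMeasure (f.1 (f.1.symm x))) := by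
      rwa [hvec, f.1.symm_apply_apply]
    have h2 := func_intertwining_real measurable_id hw f.2 Real.continuous_sqrt.measurable h1
    rw [f.1.apply_symm_apply] at h2
    rw [hconj, h2, f.1.symm_apply_apply, LinearIsometryEquiv.eq_symm_apply]
    rfl

theorem IsModularRep.symplComp_eq (hV : V.IsModularRep u) : V.symplComp = u (-1) • V := by
  obtain ⟨hJ, P, hP, hPV⟩ := isModularRep_iff.1 hV
  have h := hP.isModularPair hJ
  refine StandardSubspace.ext (SetLike.ext fun x => ?_)
  have h1 : (u (-1)).1.symm x = (u (-1)).1 x := by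
    rw [LinearIsometryEquiv.symm_apply_eq, h.involutive]
  rw [h.mem_symplComp hPV, mem_smul_iff, h1]

theorem invHom_neg_one {G : Type*} [Group G] (γ : ℝˣ →* G) : invHom γ (-1) = γ (-1) := by
  show γ (-1)⁻¹ = γ (-1)
  rw [inv_neg_one]

/-- Inverting the parameter replaces `Δ` by `Δ⁻¹` and keeps `J`. Since `V' = J V` and `J` carries
the inverted spectral measure to the original one, `V'` is the fixed space of `J Δ^{-1/2}`. -/
theorem IsModularRep.symplComp (hV : V.IsModularRep u) : V.symplComp.IsModularRep (invHom u) := by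
  obtain ⟨hJ, P, hP, hPV⟩ := isModularRep_iff.1 hV
  have h := hP.isModularPair hJ
  refine isModularRep_iff.2 ⟨by rwa [invHom_neg_one], _, hP.map_inv, fun x => ?_⟩
  have hw : ∀ B, MeasurableSet B → ∀ x,
      (u (-1)).1 ((P.map Inv.inv measurable_inv).proj (id ⁻¹' B) x) = P.proj B ((u (-1)).1 x) :=
    h.intertwining
  rw [h.mem_symplComp hPV, hPV, memLp_intertwining measurable_id hw measurable_sqrtFun,
    invHom_neg_one]
  refine and_congr_right fun hx => ?_
  rw [func_intertwining_real measurable_id hw (u (-1)).2 Real.continuous_sqrt.measurable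
    ((memLp_intertwining measurable_id hw measurable_sqrtFun x).2 hx)]
  exact (u (-1)).1.injective.eq_iff

end StandardSubspace

end ModularRepresentation

/-! ### Covariance and geometric modular action of the net -/

section Nets

variable {G : Type*} [Group G] [TopologicalSpace G] {G₁ : Subgroup G}

theorem IsPairHom.neg_one_notMem {γ : ℝˣ →* G} (hγ : IsPairHom G₁ γ) : γ (-1) ∉ G₁ := fun h => by
  have := (hγ.2 _).1 h
  norm_num at this

theorem map_neg_one_mul_self {G : Type*} [Group G] (γ : ℝˣ →* G) : γ (-1) * γ (-1) = 1 := by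
  rw [← map_mul, neg_one_mul, neg_neg, map_one]

theorem IsPairHom.orderOf_neg_one {γ : ℝˣ →* G} (hγ : IsPairHom G₁ γ) :
    orderOf (γ (-1)) = 2 := by
  refine orderOf_eq_prime (by rw [pow_two, map_neg_one_mul_self]) fun h => hγ.neg_one_notMem ?_
  rw [h]
  exact G₁.one_mem

theorem conjHom_mul {G : Type*} [Group G] (g h : G) (γ : ℝˣ →* G) :
    conjHom (g * h) γ = conjHom g (conjHom h γ) := by
  ext t
  simp [conjHom, mul_assoc]

theorem conjHom_map {G : Type*} [Group G] (r : ℝˣ) (γ : ℝˣ →* G) : conjHom (γ r) γ = γ := by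
  ext t
  show γ r * γ t * (γ r)⁻¹ = γ t
  rw [← map_mul, mul_comm, map_mul, mul_inv_cancel_right]

theorem conjHom_invHom {G : Type*} [Group G] (g : G) (γ : ℝˣ →* G) :
    conjHom g (invHom γ) = invHom (conjHom g γ) := rfl

theorem invHom_invHom {G : Type*} [Group G] (γ : ℝˣ →* G) : invHom (invHom γ) = γ := by
  ext t
  simp [invHom]

theorem conjHom_one {G : Type*} [Group G] (γ : ℝˣ →* G) : conjHom 1 γ = γ := by
  ext t
  simp [conjHom]

theorem comp_conjHom {G K : Type*} [Group G] [Group K] (f : G →* K) (g : G) (γ : ℝˣ →* G) :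
    f.comp (conjHom g γ) = conjHom (f g) (f.comp γ) := by
  ext t
  simp [conjHom]

variable {H : Type*} [NormedAddCommGroup H] [InnerProductSpace ℂ H] [CompleteSpace H]
  (U : AntiunitaryRep G₁ H)

namespace AntiunitaryRep

open StandardSubspace

theorem existsUnique_isModularRep {γ : ℝˣ →* G} (hγ : IsPairHom G₁ γ) :
    ∃! V : StandardSubspace H, V.IsModularRep (U.toHom.comp γ) := by
  obtain ⟨V, hV⟩ := exists_isModularRep (u := U.toHom.comp γ)
    (U.antiunitary _ hγ.neg_one_notMem)
    (fun t => U.unitary _ ((hγ.2 (expUnit t)).2 (Real.exp_pos t)))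
    (fun x => (U.continuous x).comp hγ.1)
  exact ⟨V, hV, fun W hW => hW.unique hV⟩

theorem isModularRep_smul_of_mem {γ : ℝˣ →* G} {V : StandardSubspace H}
    (hV : V.IsModularRep (U.toHom.comp γ)) {g : G} (hg : g ∈ G₁) :
    (U.toHom g • V).IsModularRep (U.toHom.comp (conjHom g γ)) := by
  rw [comp_conjHom]
  exact hV.smul (U.unitary g hg)

/-- By index two, `g γ(-1)` lies in `G₁`, and `γ(-1)` centralizes `γ`, so the unitary case gives `W
= U_{g γ(-1)} V`. Applying `J_W = U_{g γ(-1) g⁻¹}` gives `W' = U_g V`, because `γ(-1)² = 1`. -/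
theorem smul_eq_symplComp_of_notMem (hG₁ : G₁.index = 2) {γ : ℝˣ →* G} (hγ : IsPairHom G₁ γ)
    {V W : StandardSubspace H} (hV : V.IsModularRep (U.toHom.comp γ)) {g : G} (hg : g ∉ G₁)
    (hW : W.IsModularRep (U.toHom.comp (conjHom g γ))) : U.toHom g • V = W.symplComp := by
  have hh : g * γ (-1) ∈ G₁ :=
    (Subgroup.mul_mem_iff_of_index_two hG₁).2 (iff_of_false hg hγ.neg_one_notMem)
  have h1 := U.isModularRep_smul_of_mem hV hh
  rw [conjHom_mul, conjHom_map] at h1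
  rw [hW.symplComp_eq, hW.unique h1, smul_smul]
  show _ = (U.toHom (g * γ (-1) * g⁻¹) * _) • V
  rw [← map_mul]
  congr 2
  simp only [mul_assoc, inv_mul_cancel_left, map_neg_one_mul_self, mul_one]

end AntiunitaryRep

end Nets

end

theorem proposition5p8
    {E : Type*} [NormedAddCommGroup E] [NormedSpace ℝ E] [FiniteDimensional ℝ E]
    {G : Type*} [Group G] [TopologicalSpace G] [ChartedSpace E G] [LieGroup 𝓘(ℝ, E) ∞ G]
    (G₁ : Subgroup G) (hG₁ : G₁.index = 2)
    {H : Type*} [NormedAddCommGroup H] [InnerProductSpace ℂ H] [CompleteSpace H]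
    (U : AntiunitaryRep G₁ H)
    (Γ : Set (ℝˣ →* G)) (hne : Γ.Nonempty) (hΓ : ∀ γ ∈ Γ, IsPairHom G₁ γ)
    (hconj : ∀ γ ∈ Γ, ∀ g : G, conjHom g γ ∈ Γ) (hinv : ∀ γ ∈ Γ, invHom γ ∈ Γ) :
    -- every `γ` determines a standard subspace `V_γ` by `U^{V_γ} = U ∘ γ`
    (∀ γ : ℝˣ →* G, IsPairHom G₁ γ →
      ∃! V : StandardSubspace H, V.IsModularRep (U.toHom.comp γ)) ∧
    -- properties of the resulting net
    ∀ V : Γ → StandardSubspace H,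
      (∀ γ : Γ, (V γ).IsModularRep (U.toHom.comp (γ : ℝˣ →* G))) →
      -- covariance
      (∀ (γ : Γ), ∀ g ∈ G₁, U.toHom g • V γ = V ⟨conjHom g γ, hconj γ γ.2 g⟩) ∧
      (∀ (γ : Γ), ∀ g ∉ G₁, U.toHom g • V γ = (V ⟨conjHom g γ, hconj γ γ.2 g⟩).symplComp) ∧
      -- the elements `γ(-1)` form a conjugation invariant set of involutions in `G \ G₁`
      (∀ γ ∈ Γ, γ (-1) ∉ G₁ ∧ orderOf (γ (-1)) = 2) ∧
      (∀ g : G, ∀ r ∈ (fun γ : ℝˣ →* G => γ (-1)) '' Γ,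
        g * r * g⁻¹ ∈ (fun γ : ℝˣ →* G => γ (-1)) '' Γ) ∧
      -- the modular conjugation of `V_γ` is `U_{γ(-1)}`
      (∀ (γ : Γ) (J : AU H),
        (V γ).IsModularConjugation J ↔ J = U.toHom ((γ : ℝˣ →* G) (-1))) ∧
      -- the modular symmetry group is the image of the group generated by the `γ(-1)`
      modularSymmetryGroup V =
        (Subgroup.closure ((fun γ : ℝˣ →* G => γ (-1)) '' Γ)).map U.toHom ∧
      -- geometric modular action
      CGMA V := by
  refine ⟨fun γ hγ => U.existsUnique_isModularRep hγ, fun V hV => ?_⟩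
  have hneg : ∀ (γ : Γ), ∀ g ∉ G₁,
      U.toHom g • V γ = (V ⟨conjHom g γ, hconj γ γ.2 g⟩).symplComp := fun γ g hg =>
    U.smul_eq_symplComp_of_notMem hG₁ (hΓ γ γ.2) (hV γ) hg (hV ⟨_, hconj γ γ.2 g⟩)
  have hJ : ∀ (γ : Γ) (J : AU H),
      (V γ).IsModularConjugation J ↔ J = U.toHom ((γ : ℝˣ →* G) (-1)) := fun γ J =>
    ⟨fun h => h.unique (hV γ).1, fun h => h ▸ (hV γ).1⟩
  refine ⟨fun γ g hg => ?_, hneg, fun γ hγ => ⟨(hΓ γ hγ).neg_one_notMem,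
    (hΓ γ hγ).orderOf_neg_one⟩, ?_, hJ, ?_, ?_⟩
  · exact (U.isModularRep_smul_of_mem (hV γ) hg).unique (hV ⟨_, hconj γ γ.2 g⟩)
  · rintro g _ ⟨γ, hγ, rfl⟩
    exact ⟨conjHom g γ, hconj γ hγ g, rfl⟩
  · rw [MonoidHom.map_closure, modularSymmetryGroup]
    congr 1
    ext J
    constructor
    · rintro ⟨γ, h⟩
      exact ⟨_, ⟨γ, γ.2, rfl⟩, ((hJ γ J).1 h).symm⟩
    · rintro ⟨_, ⟨γ, hγ, rfl⟩, rfl⟩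
      exact ⟨⟨γ, hγ⟩, (hJ ⟨γ, hγ⟩ _).2 rfl⟩
  · refine (Subgroup.closure_le _).2 ?_
    rintro J ⟨γ, h⟩
    rw [(hJ γ J).1 h]
    set r := (γ : ℝˣ →* G) (-1) with hr
    -- As `r ∉ G₁`, the operator `U_r` sends `V_δ` to the symplectic complement of `V_{δ^r}`, which
    -- belongs to `(δ^r)^∨`. Conjugation commutes with inversion and `r² = 1`, so `σ` is an
    -- involution and hence a permutation.
    let σ : Γ → Γ := fun δ => ⟨invHom (conjHom r δ), hinv _ (hconj δ δ.2 r)⟩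
    have hσ : Function.Involutive σ := fun δ => Subtype.ext (by
      show invHom (conjHom r (invHom (conjHom r δ))) = δ
      rw [conjHom_invHom, invHom_invHom, ← conjHom_mul, hr, map_neg_one_mul_self, conjHom_one])
    refine ⟨hσ.toPerm, fun δ => ?_⟩
    rw [hneg δ r (hΓ γ γ.2).neg_one_notMem]
    exact (hV ⟨_, hconj δ δ.2 r⟩).symplComp.unique (hV (σ δ))
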